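/- Let $\sigma_2\colon\mathbb R/\mathbb Z\to\mathbb R/\mathbb Z$, $\sigma_2(x)=2x$, and identify $\mathbb R/\mathbb Z$ with the unit circle. A \emph{lamination} is an equivalence relation $\sim$ on $\mathbb R/\mathbb Z$ with closed graph and with finite, pairwise unlinked classes. It is \emph{quadratic} (i.e. $\sigma_2$-invariant) if $\sigma_2$ maps every class $\mathbf g$ onto a class, and either $\sigma_2(\mathbf g)$ is a point or every positively oriented hole $(a,b)$ of $\mathbf g$ gives a hole $(\sigma_2(a),\sigma_2(b))$ of $\sigma_2(\mathbf g)$. It is \emph{empty} if all classes are points. \emph{Leaves} are the edges of the convex hulls of classes; \emph{gaps} are the closures of the components of the complement in the open disk of the union of all leaves; a gap is a \emph{Fatou gap} if its basis (its intersection with the circle) is infinite. Leaves and gaps are identified with their bases. The \emph{period} of a periodic leaf or gap $A$ is the least $n\ge1$ with $\sigma_2^n(A)=A$. Such an $A$ is \emph{rotational} if $\sigma_2^n|_A$ extends to a monotone circle map of degree one and either $A$ is finite and the rotation number is non-zero in $\mathbb R/\mathbb Z$, or $A$ is infinite and the rotation number is irrational (a \emph{Siegel gap}). Invariant (period one) rotational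 sets are also considered without a lamination: these are the closed sets $G$ of at least two points with $\sigma_2(G)=G$, such that for every hole $(a,b)$ of $G$ either $\sigma_2(a)=\sigma_2(b)$ or $(\sigma_2(a),\sigma_2(b))$ is a hole of $G$, and which are rotational in the above sense. The \emph{canonical lamination} of an invariant rotational set $G$ is the only quadratic lamination which has $G$ as a leaf or gap with a cycle of Fatou gaps attached to the edges of $G$, if $G$ is finite, and the only quadratic lamination which has $G$ as a gap, if $G$ is a Siegel gap. The \emph{minor} of a non-empty quadratic lamination is the $\sigma_2$-image (a chord or a point) of a longest leaf. The \emph{Combinatorial Main Cardioid} $\mathrm{CA}^c$ is the part of Thurston's model of the Mandelbrot set given by the closed central gap of the family of all minors of quadratic laminations (the convex hull of the set of all points of the circle that no minor strictly separates from the centre of the disk): it consists of the empty lamination and of the non-empty quadratic laminations whose minor has its endpoints in this central gap. \textbf{Proposition.} (1) Let $\sim$ be a non-empty quadratic lamination with at most one periodic rotational set. Then $\sim$ has exactly one periodic rotational set $G$, the set $G$ is fixed, i.e. $\sigma_2(G)=G$, and $\sim$ is the canonical lamination of $G$. (2) The Combinatorial Main Cardioid $\mathrm{CA}^c$ is exactly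 the set of all quadratic laminations with at most one periodic rotational set. -/

import Mathlib

open Set

noncomputable section

/-! ## The circle `ℝ/ℤ`, arcs, holes and the doubling map -/

/-- The doubling map `σ₂` of the circle `ℝ/ℤ` (that is, `z ↦ z ^ 2` on the unit circle). -/
def dbl (x : UnitAddCircle) : UnitAddCircle := 2 • x

/-- The length, in `(0, 1]`, of the positively oriented arc from `a` to `b`.
The arc from a point to itself goes once around the circle. -/
def arcLen (a b : UnitAddCircle) : ℝ := (AddCircle.equivIoc (1 : ℝ) 0 (b - a) : ℝ)

/-- The open positively oriented arc `(a, b)`; in particular `(a, a)` is the circle without `a`. -/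
def openArc (a b : UnitAddCircle) : Set UnitAddCircle := {z | arcLen a z < arcLen a b}

/-- `(a, b)` is a (positively oriented) hole of the closed set `A`, that is, a component of the
complement of `A`. -/
def IsHole (A : Set UnitAddCircle) (a b : UnitAddCircle) : Prop :=
  a ∈ A ∧ b ∈ A ∧ Disjoint (openArc a b) A

/-! ## Quadratic invariant laminations, their leaves and gaps -/

/-- The equivalence class of `x`. -/
def lamClass (r : Setoid UnitAddCircle) (x : UnitAddCircle) : Set UnitAddCircle := {y | r x y}

/-- Laminations: closed equivalence relations on the circle with finite, pairwise unlinked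
classes.  (Two chords joining four distinct points of the circle meet inside the disk exactly
when the endpoints of the second lie in different arcs cut out by the first.) -/
structure IsLamination (r : Setoid UnitAddCircle) : Prop where
  closed : IsClosed {p : UnitAddCircle × UnitAddCircle | r p.1 p.2}
  unlinked : ∀ t₁ t₂ t₃ t₄ : UnitAddCircle, r t₁ t₂ → r t₃ t₄ → ¬ r t₂ t₃ → t₁ ≠ t₂ →
    ¬ (t₃ ∈ openArc t₁ t₂ ∧ t₄ ∈ openArc t₂ t₁)
  finite : ∀ x : UnitAddCircle, (lamClass r x).Finite

/-- Quadratic (that is, `σ₂`-invariant) laminations: classes map onto classes, in a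
covering and orientation preserving fashion. -/
structure IsQuadraticLamination (r : Setoid UnitAddCircle) : Prop where
  lamination : IsLamination r
  forward : ∀ x : UnitAddCircle, dbl '' lamClass r x = lamClass r (dbl x)
  covering : ∀ x : UnitAddCircle, (dbl '' lamClass r x).Subsingleton ∨
    ∀ a b : UnitAddCircle, IsHole (lamClass r x) a b →
      IsHole (dbl '' lamClass r x) (dbl a) (dbl b)

/-- The chord joining `a` and `b` is a (non-degenerate) leaf of the lamination, that is, an edge
of the convex hull of a class. -/
def IsLeaf (r : Setoid UnitAddCircle) (a b : UnitAddCircle) : Prop :=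
  a ≠ b ∧ (IsHole (lamClass r a) a b ∨ IsHole (lamClass r a) b a)

/-- `A` is the basis of a gap of the lamination: the convex hull of the closed set `A` has
non-empty interior, all its edges are leaves, and no leaf meets its interior (no leaf has points
of `A` strictly on both sides).  Equivalently, the convex hull of `A` is the closure of a
component of the complement in the open disk of the union of all leaves. -/
structure IsGap (r : Setoid UnitAddCircle) (A : Set UnitAddCircle) : Prop where
  closed : IsClosed A
  three_le : 3 ≤ A.encard
  edges : ∀ a b : UnitAddCircle, IsHole A a b → IsLeaf r a b
  no_crossing : ∀ a b : UnitAddCircle, IsLeaf r a b →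
    Disjoint (openArc a b) A ∨ Disjoint (openArc b a) A

/-- Fatou gaps: gaps with infinite basis. -/
def IsFatouGap (r : Setoid UnitAddCircle) (A : Set UnitAddCircle) : Prop :=
  IsGap r A ∧ A.Infinite

/-- `A` is the basis of a leaf or of a gap of the lamination. -/
def IsLeafOrGap (r : Setoid UnitAddCircle) (A : Set UnitAddCircle) : Prop :=
  (∃ a b : UnitAddCircle, IsLeaf r a b ∧ A = {a, b}) ∨ IsGap r A

/-! ## Rotation numbers and rotational sets -/

/-- `A` is periodic of (least) period `n`. -/
def HasPeriod (A : Set UnitAddCircle) (n : ℕ) : Prop :=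
  IsLeast {k : ℕ | 0 < k ∧ dbl^[k] '' A = A} n

/-- The restriction of `σ₂ⁿ` to `A` extends to a monotone circle map of degree one whose rotation
number is `τ` modulo one. -/
def HasRotationNumber (A : Set UnitAddCircle) (n : ℕ) (τ : ℝ) : Prop :=
  ∃ F : CircleDeg1Lift,
    (∀ t : ℝ, (t : UnitAddCircle) ∈ A →
      ((F t : ℝ) : UnitAddCircle) = dbl^[n] (t : UnitAddCircle)) ∧
    F.translationNumber = τ

/-- A set of period `n` is rotational if it is finite with non-zero rotation number in `ℝ/ℤ`, or
if it is of Siegel type: infinite, with irrational rotation number. -/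
def IsRotationalOfPeriod (A : Set UnitAddCircle) (n : ℕ) : Prop :=
  (A.Finite ∧ ∃ τ : ℝ, HasRotationNumber A n τ ∧ ∀ k : ℤ, τ ≠ k) ∨
  (A.Infinite ∧ ∃ τ : ℝ, HasRotationNumber A n τ ∧ Irrational τ)

/-- `A` is (the basis of) a periodic rotational set of the lamination: a periodic leaf or gap
which is rotational. -/
def IsPeriodicRotationalSet (r : Setoid UnitAddCircle) (A : Set UnitAddCircle) : Prop :=
  IsLeafOrGap r A ∧ ∃ n : ℕ, HasPeriod A n ∧ IsRotationalOfPeriod A n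

/-- The lamination has at most one periodic rotational set. -/
def AtMostOneRotationalSet (r : Setoid UnitAddCircle) : Prop :=
  ∀ A B : Set UnitAddCircle,
    IsPeriodicRotationalSet r A → IsPeriodicRotationalSet r B → A = B

/-- `G` is (the basis of) a stand alone `σ₂`-invariant rotational set; no lamination is involved.
It is a closed set of at least two points which maps onto itself, holes going to holes or
collapsing to points, and it is rotational. -/
structure IsInvariantRotationalSet (G : Set UnitAddCircle) : Prop where
  closed : IsClosed G
  two_le : 2 ≤ G.encard
  invariant : dbl '' G = G
  holes : ∀ a b : UnitAddCircle, IsHole G a b → dbl a = dbl b ∨ IsHole G (dbl a) (dbl b)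
  rotational : IsRotationalOfPeriod G 1

/-! ## Canonical laminations -/

/-- `G` is a leaf or gap of the lamination, and Fatou gaps of the lamination are attached to the
edges of `G` and permuted by `σ₂`: to every hole `(a, b)` of `G` there corresponds a Fatou gap
`V a b` contained in the closed arc `[a, b]`, having the chord from `a` to `b` as an edge, and
mapped by `σ₂` onto the Fatou gap corresponding to the hole `(σ₂ a, σ₂ b)`.  (A leaf has two
holes, one on each side.) -/
def HasAttachedFatouCycle (r : Setoid UnitAddCircle) (G : Set UnitAddCircle) : Prop :=
  IsLeafOrGap r G ∧
  ∃ V : UnitAddCircle → UnitAddCircle → Set UnitAddCircle,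
    ∀ a b : UnitAddCircle, IsHole G a b →
      IsFatouGap r (V a b) ∧ a ∈ V a b ∧ b ∈ V a b ∧ V a b ⊆ openArc a b ∪ {a, b} ∧
        IsHole G (dbl a) (dbl b) ∧ dbl '' V a b = V (dbl a) (dbl b)

/-- The property that singles out the canonical lamination of `G`: if `G` is finite, a cycle of
Fatou gaps is attached to the edges of `G`; if `G` is infinite, `G` is a gap. -/
def CarriesCanonically (r : Setoid UnitAddCircle) (G : Set UnitAddCircle) : Prop :=
  (G.Finite ∧ HasAttachedFatouCycle r G) ∨ (G.Infinite ∧ IsGap r G)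

/-- `r` is the canonical lamination of the invariant rotational set `G`: the only quadratic
lamination with a cycle of Fatou gaps attached to the edges of `G` (if `G` is finite), the only
quadratic lamination which has `G` as a gap (if `G` is of Siegel type). -/
def IsCanonicalLamination (r : Setoid UnitAddCircle) (G : Set UnitAddCircle) : Prop :=
  IsInvariantRotationalSet G ∧ IsQuadraticLamination r ∧ CarriesCanonically r G ∧
    ∀ r' : Setoid UnitAddCircle, IsQuadraticLamination r' → CarriesCanonically r' G → r' = r

/-! ## Thurston's minors and the Combinatorial Main Cardioid -/

/-- The leaf joining `a` and `b` is a major of the lamination, that is, a longest leaf. -/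
def IsMajor (r : Setoid UnitAddCircle) (a b : UnitAddCircle) : Prop :=
  IsLeaf r a b ∧ ∀ c d : UnitAddCircle, IsLeaf r c d → dist c d ≤ dist a b

/-- The chord (possibly a point) joining `p` and `q` is a minor, that is, the image of a major, of
some quadratic lamination. -/
def IsMinor (p q : UnitAddCircle) : Prop :=
  ∃ (r : Setoid UnitAddCircle) (a b : UnitAddCircle),
    IsQuadraticLamination r ∧ IsMajor r a b ∧ p = dbl a ∧ q = dbl b

/-- The point `z` of the circle is strictly separated from the centre of the disk by the chord
joining `p` and `q`: it lies in the open arc shorter than `1/2` cut out by the chord. -/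
def SeparatedFromCentre (p q z : UnitAddCircle) : Prop :=
  (arcLen p q < 1 / 2 ∧ z ∈ openArc p q) ∨ (arcLen q p < 1 / 2 ∧ z ∈ openArc q p)

/-- The basis of the central gap of the family of all minors (Thurston's quadratic minor
lamination): the points of the circle not separated from the centre of the disk by a minor. -/
def centralGapBasis : Set UnitAddCircle :=
  {z | ∀ p q : UnitAddCircle, IsMinor p q → ¬ SeparatedFromCentre p q z}

/-- The Combinatorial Main Cardioid: the quadratic laminations represented, in Thurston's model of
the Mandelbrot set, by the closed central gap of the family of minors.  The interior of this gap
represents the empty lamination `⊥` (equality); the points and the edges on its boundary represent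
the non-empty laminations whose minor is contained in it. -/
def combinatorialMainCardioid : Set (Setoid UnitAddCircle) :=
  {r | IsQuadraticLamination r ∧
    (r = ⊥ ∨ ∃ a b : UnitAddCircle, IsMajor r a b ∧
      dbl a ∈ centralGapBasis ∧ dbl b ∈ centralGapBasis)}

end

/-!
Everything is governed by the major `α β` of a non-empty quadratic lamination, normalised to
`0 < α < 1/2 < β < 1`.

*Rotational sets from return maps.* Let `u v` be a chord of a class whose endpoints are fixed by
`σ₂ⁿ`, and suppose that the major lies in the strip between this chord and its translate by `1/2`
(`ReturnStrip`). The return map to the strip has two affine branches of slope `2ⁿ`, and the set of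
points which stay between `α` and `β` forever is not empty. If it contains a periodic orbit, then
the orbit is contained in one class, and this class is rotational
(`ReturnStrip.exists_rotational_class`); otherwise the major is a diameter, and an edge of a Siegel
gap (`ReturnStrip.exists_siegel_gap`). For `n = 1` the strip is the whole disk, so every non-empty
lamination has a fixed rotational set `G`. If `G` is finite with long edge `x y`, and the major is
not this edge, then the argument applies to the strip along `x y` and yields a second rotational set
(`FiniteRotation.exists_rotationalSet_ne`). This gives the three cases of `cases_of_isMajor`.

*Rigidity.* Suppose that `G` is finite and that its long edge is the major, or that `G` is a Siegel
gap. Then the intervals between two equivalent points avoid `G` as long as they are not in `G`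
(respectively, on the diameter), and they double in length under `σ₂`. So all non-degenerate classes
are preimages of `G` (respectively, of the diameter) (`CardioidLamination.exists_iterate_mem`,
`SiegelLamination.exists_iterate_mem`). Consequently `G` is the only periodic rotational set, and
the lamination is determined by `G`. The Fatou gaps attached to a finite `G` consist of the points
which never enter the arc cut off by the long edge of `G + 1/2` (`fatouGap`); conversely, an attached
cycle of Fatou gaps forces the lamination to be of this form (`cardioidLamination_of_attached`).

*The central gap.* In the case with a second rotational set the image of the long edge of `G` is the
minor of the lamination generated by `G` (`FiniteRotation.isMinor`), and separates the minor at hand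
from the centre. Conversely, let `z` be an endpoint of a minor in one of the other cases. Its orbit
stays in a closed half circle bounded by the two halves of `z`. A minor separating `z` from the
centre would lie under the image of the long edge of another finite rotational set, and under this
edge no point has an orbit of this kind (`FiniteRotation.exists_iterate_notMem`).
-/

/-! ### Arcs of the circle in real coordinates -/

theorem coe_eq_coe_iff_exists_int {a b : ℝ} :
    (a : UnitAddCircle) = b ↔ ∃ k : ℤ, a = b + k := by
  rw [← sub_eq_zero, ← AddCircle.coe_sub, AddCircle.coe_eq_zero_iff]
  constructor
  · rintro ⟨k, hk⟩; exact ⟨k, by simp at hk; linarith⟩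
  · rintro ⟨k, hk⟩; exact ⟨k, by simp; linarith⟩

@[simp] theorem coe_add_intCast (a : ℝ) (k : ℤ) : ((a + k : ℝ) : UnitAddCircle) = a :=
  coe_eq_coe_iff_exists_int.2 ⟨k, rfl⟩

@[simp] theorem coe_sub_intCast (a : ℝ) (k : ℤ) : ((a - k : ℝ) : UnitAddCircle) = a :=
  coe_eq_coe_iff_exists_int.2 ⟨-k, by push_cast; ring⟩

theorem coe_add_one' (a : ℝ) : ((a + 1 : ℝ) : UnitAddCircle) = a := by
  have := coe_add_intCast a 1
  rwa [Int.cast_one] at this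

theorem coe_sub_one' (a : ℝ) : ((a - 1 : ℝ) : UnitAddCircle) = a := by
  have := coe_sub_intCast a 1
  rwa [Int.cast_one] at this

theorem int_eq_zero_of_abs_lt {k : ℤ} (h1 : -1 < (k : ℝ)) (h2 : (k : ℝ) < 1) : k = 0 := by
  have h3 : (-1 : ℤ) < k := by exact_mod_cast h1
  have h4 : k < (1 : ℤ) := by exact_mod_cast h2
  omega

theorem eq_of_coe_eq {a b : ℝ} (h : (a : UnitAddCircle) = b) (h1 : a - b < 1) (h2 : b - a < 1) :
    a = b := by
  obtain ⟨k, hk⟩ := coe_eq_coe_iff_exists_int.1 h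
  have : k = 0 := int_eq_zero_of_abs_lt (by linarith) (by linarith)
  subst this; simpa using hk

theorem exists_coe_Ico (u : ℝ) (t : UnitAddCircle) : ∃ x : ℝ, u ≤ x ∧ x < u + 1 ∧ (x : UnitAddCircle) = t := by
  have : t ∈ ((↑) : ℝ → UnitAddCircle) '' Ico u (u + 1) := by
    rw [AddCircle.coe_image_Ico_eq]; trivial
  obtain ⟨x, hx, rfl⟩ := this
  exact ⟨x, hx.1, hx.2, rfl⟩

theorem exists_coe_Ioc (u : ℝ) (t : UnitAddCircle) : ∃ x : ℝ, u < x ∧ x ≤ u + 1 ∧ (x : UnitAddCircle) = t := by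
  have : t ∈ ((↑) : ℝ → UnitAddCircle) '' Ioc u (u + 1) := by
    rw [AddCircle.coe_image_Ioc_eq]; trivial
  obtain ⟨x, hx, rfl⟩ := this
  exact ⟨x, hx.1, hx.2, rfl⟩

theorem exists_coe (t : UnitAddCircle) : ∃ x : ℝ, (x : UnitAddCircle) = t :=
  let ⟨x, _, _, h⟩ := exists_coe_Ico 0 t; ⟨x, h⟩

theorem exists_coe_pair (a b : UnitAddCircle) :
    ∃ x y : ℝ, x < y ∧ y ≤ x + 1 ∧ (x : UnitAddCircle) = a ∧ (y : UnitAddCircle) = b := by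
  obtain ⟨x, rfl⟩ := exists_coe a
  obtain ⟨y, h1, h2, rfl⟩ := exists_coe_Ioc x b
  exact ⟨x, y, h1, h2, rfl, rfl⟩

theorem arcLen_coe {x y : ℝ} (h1 : x < y) (h2 : y ≤ x + 1) : arcLen x y = y - x := by
  unfold arcLen
  rw [← AddCircle.coe_sub, AddCircle.equivIoc_coe_eq (p := (1 : ℝ)) (a := 0) (x := y - x)
    ⟨by linarith, by linarith⟩]

theorem arcLen_pos (a b : UnitAddCircle) : 0 < arcLen a b := by
  obtain ⟨x, y, h1, h2, rfl, rfl⟩ := exists_coe_pair a b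
  rw [arcLen_coe h1 h2]; linarith

theorem arcLen_le_one (a b : UnitAddCircle) : arcLen a b ≤ 1 := by
  obtain ⟨x, y, h1, h2, rfl, rfl⟩ := exists_coe_pair a b
  rw [arcLen_coe h1 h2]; linarith

theorem mem_openArc_iff {x y : ℝ} {t : UnitAddCircle} (h1 : x < y) (h2 : y ≤ x + 1) :
    t ∈ openArc x y ↔ ∃ z : ℝ, x < z ∧ z < y ∧ (z : UnitAddCircle) = t := by
  obtain ⟨z, h3, h4, rfl⟩ := exists_coe_Ioc x t
  unfold openArc
  rw [mem_ofPred_eq, arcLen_coe h1 h2, arcLen_coe h3 h4]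
  constructor
  · intro h; exact ⟨z, h3, by linarith, rfl⟩
  · rintro ⟨w, h5, h6, h7⟩
    have := eq_of_coe_eq h7 (by linarith) (by linarith)
    linarith

theorem coe_mem_openArc {x y z : ℝ} (h1 : x < z) (h2 : z < y) (h3 : y ≤ x + 1) :
    (z : UnitAddCircle) ∈ openArc x y :=
  (mem_openArc_iff (h1.trans h2) h3).2 ⟨z, h1, h2, rfl⟩

/-- Membership in an arc, read off in a fundamental interval that starts at an endpoint. -/
theorem coe_mem_openArc_iff {x y z : ℝ} (h1 : x < y) (h2 : y ≤ x + 1) (h3 : x ≤ z) (h4 : z ≤ x + 1) :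
    (z : UnitAddCircle) ∈ openArc x y ↔ x < z ∧ z < y := by
  rw [mem_openArc_iff h1 h2]
  constructor
  · rintro ⟨w, h5, h6, h7⟩
    obtain ⟨k, hk⟩ := coe_eq_coe_iff_exists_int.1 h7
    have : k = 0 := int_eq_zero_of_abs_lt (by linarith) (by linarith)
    subst this; simp at hk; subst hk; exact ⟨h5, h6⟩
  · rintro ⟨h5, h6⟩; exact ⟨z, h5, h6, rfl⟩

theorem left_notMem_openArc (a b : UnitAddCircle) : a ∉ openArc a b := by
  obtain ⟨x, y, h1, h2, rfl, rfl⟩ := exists_coe_pair a b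
  rw [coe_mem_openArc_iff h1 h2 le_rfl (by linarith)]
  simp

theorem right_notMem_openArc (a b : UnitAddCircle) : b ∉ openArc a b := by
  simp [openArc]

theorem isOpen_openArc (a b : UnitAddCircle) : IsOpen (openArc a b) := by
  obtain ⟨x, y, h1, h2, rfl, rfl⟩ := exists_coe_pair a b
  have : openArc (x : UnitAddCircle) y = ((↑) : ℝ → UnitAddCircle) '' Ioo x y := by
    ext t; rw [mem_openArc_iff h1 h2]
    constructor
    · rintro ⟨z, h3, h4, h5⟩; exact ⟨z, ⟨h3, h4⟩, h5⟩
    · rintro ⟨z, ⟨h3, h4⟩, h5⟩; exact ⟨z, h3, h4, h5⟩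
  rw [this]
  exact QuotientAddGroup.isOpenMap_coe _ isOpen_Ioo

/-- Every point other than the endpoints lies in one of the two arcs cut out by a chord. -/
theorem mem_openArc_or_mem_openArc {a b t : UnitAddCircle} (ha : t ≠ a) (hb : t ≠ b) :
    t ∈ openArc a b ∨ t ∈ openArc b a := by
  obtain ⟨x, y, h1, h2, rfl, rfl⟩ := exists_coe_pair a b
  obtain ⟨z, h3, h4, rfl⟩ := exists_coe_Ioc x t
  rcases lt_trichotomy z y with h | h | h
  · exact Or.inl (coe_mem_openArc h3 h h2)
  · exact absurd (by rw [h]) hb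
  · right
    rw [← coe_add_one' x]
    refine coe_mem_openArc h (lt_of_le_of_ne h4 ?_) (by linarith)
    rintro rfl; exact ha (coe_add_one' x)

theorem disjoint_openArc_openArc {a b : UnitAddCircle} (hab : a ≠ b) :
    Disjoint (openArc a b) (openArc b a) := by
  rw [Set.disjoint_left]
  intro t h h'
  obtain ⟨x, y, h1, h2, rfl, rfl⟩ := exists_coe_pair a b
  have h2' : y < x + 1 := lt_of_le_of_ne h2 (by rintro rfl; exact hab (coe_add_one' x).symm)
  obtain ⟨z, h3, h4, rfl⟩ := (mem_openArc_iff h1 h2).1 h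
  rw [← coe_add_one' x] at h'
  obtain ⟨w, h5, h6, h7⟩ := (mem_openArc_iff h2' (by linarith)).1 h'
  have := eq_of_coe_eq h7 (by linarith) (by linarith)
  linarith

theorem isHole_coe_iff {A : Set UnitAddCircle} {x y : ℝ} (h1 : x < y) (h2 : y ≤ x + 1) :
    IsHole A x y ↔ (x : UnitAddCircle) ∈ A ∧ (y : UnitAddCircle) ∈ A ∧
      ∀ z : ℝ, x < z → z < y → (z : UnitAddCircle) ∉ A := by
  unfold IsHole
  rw [Set.disjoint_left]
  refine and_congr_right fun _ => and_congr_right fun _ => ⟨fun h z h3 h4 => h (coe_mem_openArc h3 h4 h2), ?_⟩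
  intro h t ht
  obtain ⟨z, h3, h4, rfl⟩ := (mem_openArc_iff h1 h2).1 ht
  exact h z h3 h4

theorem IsHole.right_unique {A : Set UnitAddCircle} {a b c : UnitAddCircle}
    (h : IsHole A a b) (h' : IsHole A a c) : b = c := by
  obtain ⟨x, y, h1, h2, rfl, rfl⟩ := exists_coe_pair a b
  obtain ⟨z, h3, h4, rfl⟩ := exists_coe_Ioc x c
  rw [isHole_coe_iff h1 h2] at h
  rw [isHole_coe_iff h3 h4] at h'
  rcases lt_trichotomy y z with h5 | h5 | h5
  · exact absurd h.2.1 (h'.2.2 y h1 h5)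
  · rw [h5]
  · exact absurd h'.2.1 (h.2.2 z h3 h5)

/-- Holes with different left endpoints are disjoint. -/
theorem IsHole.disjoint {A : Set UnitAddCircle} {a b c d : UnitAddCircle}
    (h : IsHole A a b) (h' : IsHole A c d) (hac : a ≠ c) :
    Disjoint (openArc a b) (openArc c d) := by
  rw [Set.disjoint_left]
  intro t ht ht'
  obtain ⟨x, y, h1, h2, rfl, rfl⟩ := exists_coe_pair a b
  obtain ⟨z, h3, h4, rfl⟩ := (mem_openArc_iff h1 h2).1 ht
  obtain ⟨w, h5, h6, rfl⟩ := exists_coe_Ico (z - 1) c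
  obtain ⟨v, h7, h8, rfl⟩ := exists_coe_Ioc w d
  rw [isHole_coe_iff h1 h2] at h
  rw [isHole_coe_iff h7 h8] at h'
  have hw : (z - 1 : ℝ) ≠ w := by
    rintro rfl
    exact h.2.2 z h3 h4 (by rw [← coe_sub_one']; exact h'.1)
  have h5' := lt_of_le_of_ne h5 hw
  rw [coe_mem_openArc_iff h7 h8 (by linarith) (by linarith)] at ht'
  rcases lt_trichotomy x w with h9 | h9 | h9
  · exact h.2.2 w h9 (by linarith) h'.1
  · exact hac (by rw [h9])
  · exact h'.2.2 x h9 (by linarith) h.1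

theorem isClosed_preimage_coe {A : Set UnitAddCircle} (hA : IsClosed A) :
    IsClosed {x : ℝ | (x : UnitAddCircle) ∈ A} :=
  hA.preimage (AddCircle.continuous_mk' (1 : ℝ))

/-- A point outside a nonempty closed set lies in a hole of this set. -/
theorem exists_isHole_mem {A : Set UnitAddCircle} (hA : IsClosed A) (hne : A.Nonempty)
    {t : UnitAddCircle} (ht : t ∉ A) : ∃ a b, IsHole A a b ∧ t ∈ openArc a b := by
  obtain ⟨z, rfl⟩ := exists_coe t
  obtain ⟨t₀, ht₀⟩ := hne
  have hcl := isClosed_preimage_coe hA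
  obtain ⟨p, hp1, hp2, hp3⟩ := exists_coe_Ico (z - 1) t₀
  -- the last point of `A` before `z`, and the first point of `A` after `z`
  obtain ⟨x, ⟨hx1, hx2⟩, hx3⟩ : ∃ x, IsGreatest ({x : ℝ | (x : UnitAddCircle) ∈ A} ∩ Icc (z - 1) z) x :=
    (isCompact_Icc.inter_left hcl).exists_isGreatest ⟨p, by simp [hp3, ht₀], hp1, by linarith⟩
  obtain ⟨q, hq1, hq2, hq3⟩ := exists_coe_Ico z t₀
  obtain ⟨y, ⟨hy1, hy2⟩, hy3⟩ : ∃ y, IsLeast ({x : ℝ | (x : UnitAddCircle) ∈ A} ∩ Icc z (z + 1)) y :=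
    (isCompact_Icc.inter_left hcl).exists_isLeast ⟨q, by simp [hq3, ht₀], hq1, by linarith⟩
  have hxz : x < z := lt_of_le_of_ne hx2.2 (by rintro rfl; exact ht hx1)
  have hzy : z < y := lt_of_le_of_ne hy2.1 (by rintro rfl; exact ht hy1)
  have hyx : y ≤ x + 1 := hy3 ⟨by simpa [coe_add_one'] using hx1, by linarith [hx2.1], by linarith⟩
  refine ⟨x, y, (isHole_coe_iff (hxz.trans hzy) hyx).2 ⟨hx1, hy1, ?_⟩, coe_mem_openArc hxz hzy hyx⟩
  intro w hw1 hw2 hw3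
  rcases le_total w z with h | h
  · linarith [hx3 ⟨hw3, by linarith [hx2.1], h⟩]
  · linarith [hy3 ⟨hw3, h, by linarith [hy2.2]⟩]

/-- In a finite set every point is the left endpoint of a hole. -/
theorem exists_isHole_left {A : Set UnitAddCircle} (hA : A.Finite) {a : UnitAddCircle} (ha : a ∈ A) :
    ∃ b, IsHole A a b := by
  obtain ⟨x, rfl⟩ := exists_coe a
  let f : UnitAddCircle → ℝ := fun t => (exists_coe_Ioc x t).choose
  have hf : ∀ t, x < f t ∧ f t ≤ x + 1 ∧ (f t : UnitAddCircle) = t :=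
    fun t => (exists_coe_Ioc x t).choose_spec
  obtain ⟨t, ht, hmin⟩ := hA.exists_minimalFor f A ⟨_, ha⟩
  refine ⟨t, ?_⟩
  rw [← (hf t).2.2, isHole_coe_iff (hf t).1 (hf t).2.1, (hf t).2.2]
  refine ⟨ha, ht, fun z hz1 hz2 hz3 => ?_⟩
  have h1 : f z = z := eq_of_coe_eq (hf z).2.2 (by linarith [(hf z).2.1]) (by linarith [(hf z).1, (hf t).2.1])
  have := hmin hz3 (by rw [h1]; exact hz2.le)
  linarith

/-! ### The doubling map -/

@[simp] theorem dbl_coe (x : ℝ) : dbl (x : UnitAddCircle) = ((2 * x : ℝ) : UnitAddCircle) := by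
  unfold dbl; rw [two_nsmul, ← AddCircle.coe_add, two_mul]

theorem dbl_iterate_coe (n : ℕ) (x : ℝ) :
    dbl^[n] (x : UnitAddCircle) = ((2 ^ n * x : ℝ) : UnitAddCircle) := by
  induction n with
  | zero => simp
  | succ n ih => rw [Function.iterate_succ_apply', ih, dbl_coe]; congr 1; ring

theorem continuous_dbl : Continuous dbl := by unfold dbl; fun_prop

theorem continuous_dbl_iterate (n : ℕ) : Continuous dbl^[n] := continuous_dbl.iterate n

theorem dbl_add_half (x : ℝ) : dbl ((x + 1 / 2 : ℝ) : UnitAddCircle) = dbl x := by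
  rw [dbl_coe, dbl_coe, ← coe_add_one' (2 * x)]; congr 1; ring

theorem dbl_sub_half (x : ℝ) : dbl ((x - 1 / 2 : ℝ) : UnitAddCircle) = dbl x := by
  rw [← dbl_add_half]; congr 2; ring

theorem coe_add_half_eq_sub_half (x : ℝ) :
    ((x + 1 / 2 : ℝ) : UnitAddCircle) = ((x - 1 / 2 : ℝ) : UnitAddCircle) := by
  rw [← coe_sub_one']; congr 1; ring

theorem dbl_eq_dbl_iff {x y : ℝ} : dbl (x : UnitAddCircle) = dbl y ↔
    (x : UnitAddCircle) = y ∨ (x : UnitAddCircle) = ((y + 1 / 2 : ℝ) : UnitAddCircle) := by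
  constructor
  · rw [dbl_coe, dbl_coe, coe_eq_coe_iff_exists_int]
    rintro ⟨k, hk⟩
    rcases Int.even_or_odd' k with ⟨m, rfl | rfl⟩
    · left; exact coe_eq_coe_iff_exists_int.2 ⟨m, by push_cast at hk; linarith⟩
    · right; exact coe_eq_coe_iff_exists_int.2 ⟨m, by push_cast at hk; linarith⟩
  · rintro (h | h)
    · rw [h]
    · rw [h, dbl_add_half]

theorem finite_dbl_preimage {A : Set UnitAddCircle} (hA : A.Finite) : (dbl ⁻¹' A).Finite := by
  refine hA.preimage' fun t _ => ?_
  obtain ⟨x, rfl⟩ := exists_coe t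
  refine Set.Finite.subset (s := {((x / 2 : ℝ) : UnitAddCircle), ((x / 2 + 1 / 2 : ℝ) : UnitAddCircle)})
    (by simp) ?_
  intro s hs
  obtain ⟨y, rfl⟩ := exists_coe s
  have h : dbl (y : UnitAddCircle) = dbl ((x / 2 : ℝ) : UnitAddCircle) := by
    rw [dbl_coe (x / 2)]; rw [show 2 * (x / 2) = x by ring]; exact hs
  simpa using dbl_eq_dbl_iff.1 h

theorem finite_dbl_iterate_preimage {A : Set UnitAddCircle} (hA : A.Finite) (n : ℕ) :
    (dbl^[n] ⁻¹' A).Finite := by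
  induction n with
  | zero => simpa using hA
  | succ n ih => rw [Function.iterate_succ, Set.preimage_comp]; exact finite_dbl_preimage ih

/-- An arc of length at most `1/2` is mapped into the arc between the images of its endpoints. -/
theorem dbl_mem_openArc {a b t : UnitAddCircle} (h : arcLen a b ≤ 1 / 2) (ht : t ∈ openArc a b) :
    dbl t ∈ openArc (dbl a) (dbl b) := by
  obtain ⟨x, y, h1, h2, rfl, rfl⟩ := exists_coe_pair a b
  rw [arcLen_coe h1 h2] at h
  obtain ⟨z, h3, h4, rfl⟩ := (mem_openArc_iff h1 h2).1 ht
  simp only [dbl_coe]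
  exact coe_mem_openArc (by linarith) (by linarith) (by linarith)

theorem dist_coe_of_le {x y : ℝ} (h1 : x ≤ y) (h2 : y ≤ x + 1 / 2) :
    dist (x : UnitAddCircle) y = y - x := by
  rw [dist_comm, dist_eq_norm, ← AddCircle.coe_sub]
  rw [(AddCircle.norm_coe_eq_abs_iff (1 : ℝ) one_ne_zero).2]
  · rw [abs_of_nonneg (by linarith)]
  · rw [abs_of_nonneg (by linarith), abs_one]; linarith

theorem dist_coe_of_ge {x y : ℝ} (h1 : x + 1 / 2 ≤ y) (h2 : y ≤ x + 1) :
    dist (x : UnitAddCircle) y = 1 - (y - x) := by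
  rw [← coe_add_one' x, dist_comm, dist_coe_of_le (by linarith) (by linarith)]; ring

theorem dist_le_half (a b : UnitAddCircle) : dist a b ≤ 1 / 2 := by
  obtain ⟨x, y, h1, h2, rfl, rfl⟩ := exists_coe_pair a b
  rcases le_total y (x + 1 / 2) with h | h
  · rw [dist_coe_of_le h1.le h]; linarith
  · rw [dist_coe_of_ge h h2]; linarith

theorem dist_dbl_of_le {a b : UnitAddCircle} (h : dist a b ≤ 1 / 4) :
    dist (dbl a) (dbl b) = 2 * dist a b := by
  obtain ⟨x, y, h1, h2, rfl, rfl⟩ := exists_coe_pair a b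
  rcases le_total y (x + 1 / 2) with h3 | h3
  · rw [dist_coe_of_le h1.le h3] at h ⊢
    rw [dbl_coe, dbl_coe, dist_coe_of_le (by linarith) (by linarith)]; ring
  · rw [dist_coe_of_ge h3 h2] at h ⊢
    rw [dbl_coe, dbl_coe, ← coe_add_one' (2 * x), ← coe_add_one', dist_comm, dist_coe_of_le (by linarith) (by linarith)]; ring

theorem dist_dbl_of_ge {a b : UnitAddCircle} (h : 1 / 4 ≤ dist a b) :
    dist (dbl a) (dbl b) = 1 - 2 * dist a b := by
  obtain ⟨x, y, h1, h2, rfl, rfl⟩ := exists_coe_pair a b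
  rcases le_total y (x + 1 / 2) with h3 | h3
  · rw [dist_coe_of_le h1.le h3] at h ⊢
    rw [dbl_coe, dbl_coe, dist_coe_of_ge (by linarith) (by linarith)]; ring
  · rw [dist_coe_of_ge h3 h2] at h ⊢
    rw [dbl_coe, dbl_coe, ← coe_add_one' (2 * x), dist_coe_of_le (by linarith) (by linarith)]; ring

/-! ### Classes and leaves of a lamination -/

section Lamination
variable {r : Setoid UnitAddCircle}

theorem mem_openArc_swap {x y p q : UnitAddCircle} (hpq : p ≠ q) (hx : x ∈ openArc q p)
    (hy : y ∈ openArc p q) : p ∈ openArc x y ∧ q ∈ openArc y x := by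
  obtain ⟨p, q, h1, h2, rfl, rfl⟩ := exists_coe_pair p q
  have h2' : q < p + 1 := lt_of_le_of_ne h2 (by rintro rfl; exact hpq (coe_add_one' p).symm)
  obtain ⟨y, h3, h4, rfl⟩ := (mem_openArc_iff h1 h2).1 hy
  rw [← coe_add_one' p] at hx
  obtain ⟨x, h5, h6, rfl⟩ := (mem_openArc_iff h2' (by linarith)).1 hx
  refine ⟨?_, coe_mem_openArc h4 h5 (by linarith)⟩
  rw [← coe_sub_one' x]
  exact coe_mem_openArc (by linarith) h3 (by linarith)

theorem mem_lamClass {x y : UnitAddCircle} : y ∈ lamClass r x ↔ r x y := Iff.rfl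

theorem self_mem_lamClass (x : UnitAddCircle) : x ∈ lamClass r x := r.refl' x

theorem lamClass_eq {x y : UnitAddCircle} (h : r x y) : lamClass r x = lamClass r y := by
  ext z; exact ⟨fun hz => r.trans' (r.symm' h) hz, fun hz => r.trans' h hz⟩

theorem IsLamination.isClosed_lamClass (hl : IsLamination r) (x : UnitAddCircle) :
    IsClosed (lamClass r x) := (hl.finite x).isClosed

theorem IsLeaf.rel {a b : UnitAddCircle} (h : IsLeaf r a b) : r a b := by
  rcases h.2 with h | h
  · exact h.2.1
  · exact h.1

theorem IsLeaf.symm {a b : UnitAddCircle} (h : IsLeaf r a b) : IsLeaf r b a :=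
  ⟨h.1.symm, by rw [← lamClass_eq h.rel]; exact h.2.symm⟩

theorem isLeaf_of_isHole {x a b : UnitAddCircle} (hab : a ≠ b) (h : IsHole (lamClass r x) a b) :
    IsLeaf r a b :=
  ⟨hab, by rw [← lamClass_eq (show r x a from h.1)]; exact Or.inl h⟩

/-- A leaf does not separate two equivalent points. -/
theorem IsLamination.leaf_pair (hl : IsLamination r) {a b c d : UnitAddCircle} (h : IsLeaf r a b)
    (hcd : r c d) (hc : c ∈ openArc a b) (hd : d ∈ openArc b a) : False := by
  by_cases hbc : r b c
  · have hac : r a c := r.trans' h.rel hbc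
    rcases h.2 with h' | h'
    · exact Set.disjoint_left.1 h'.2.2 hc hac
    · exact Set.disjoint_left.1 h'.2.2 hd (r.trans' hac hcd)
  · exact hl.unlinked a b c d h.rel hcd hbc h.1 ⟨hc, hd⟩

theorem isLeaf_coe_iff {a b : ℝ} (h1 : a < b) (h2 : b < a + 1) :
    IsLeaf r a b ↔ r a b ∧ ((∀ z : ℝ, a < z → z < b → ¬ r a z) ∨
      (∀ z : ℝ, b < z → z < a + 1 → ¬ r a z)) := by
  have hne : (a : UnitAddCircle) ≠ b := fun h => by
    have := eq_of_coe_eq h (by linarith) (by linarith); linarith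
  constructor
  · intro h
    refine ⟨h.rel, ?_⟩
    rcases h.2 with h' | h'
    · left; exact ((isHole_coe_iff h1 h2.le).1 h').2.2
    · right
      rw [← coe_add_one' a, isHole_coe_iff h2 (by linarith), coe_add_one'] at h'
      exact h'.2.2
  · rintro ⟨h, h' | h'⟩
    · exact ⟨hne, Or.inl ((isHole_coe_iff h1 h2.le).2 ⟨r.refl' _, h, h'⟩)⟩
    · refine ⟨hne, Or.inr ?_⟩
      rw [← coe_add_one' a, isHole_coe_iff h2 (by linarith), coe_add_one']
      exact ⟨h, r.refl' _, h'⟩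

theorem IsLamination.leaf_pair_coe (hl : IsLamination r) {a b c d : ℝ} (h : IsLeaf r a b)
    (hcd : r c d) (h1 : a < c) (h2 : c < b) (h3 : b < d) (h4 : d < a + 1) : False := by
  refine hl.leaf_pair h hcd (coe_mem_openArc h1 h2 (by linarith)) ?_
  rw [← coe_add_one' a]
  exact coe_mem_openArc h3 h4 (by linarith)

/-- Leaves are the non-degenerate chords of a class that separate no two equivalent points. -/
theorem IsLamination.isLeaf_iff (hl : IsLamination r) {a b : UnitAddCircle} :
    IsLeaf r a b ↔ a ≠ b ∧ r a b ∧
      ∀ c d, r c d → c ≠ d → ¬ (a ∈ openArc d c ∧ b ∈ openArc c d) := by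
  constructor
  · intro h
    refine ⟨h.1, h.rel, fun c d hcd hne h' => ?_⟩
    obtain ⟨h1, h2⟩ := mem_openArc_swap hne h'.1 h'.2
    exact hl.leaf_pair h hcd h1 h2
  · rintro ⟨h1, h2, h3⟩
    refine ⟨h1, ?_⟩
    by_contra hcon
    simp only [IsHole, not_or, not_and, Set.not_disjoint_iff] at hcon
    obtain ⟨c, hc, hc'⟩ := hcon.1 (r.refl' _) h2
    obtain ⟨d, hd, hd'⟩ := hcon.2 h2 (r.refl' _)
    have hcd : c ≠ d := by
      rintro rfl
      exact Set.disjoint_left.1 (disjoint_openArc_openArc h1) hc hd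
    exact h3 c d (r.trans' (r.symm' hc') hd') hcd (mem_openArc_swap h1 hd hc)

theorem exists_isLeaf_left {r : Setoid UnitAddCircle} (hl : IsLamination r) {x y : UnitAddCircle}
    (h : r x y) (hxy : x ≠ y) :
    ∃ b, IsLeaf r x b ∧ IsHole (lamClass r x) x b := by
  obtain ⟨b, hb⟩ := exists_isHole_left (hl.finite x) (self_mem_lamClass x)
  refine ⟨b, isLeaf_of_isHole ?_ hb, hb⟩
  rintro rfl
  have := mem_openArc_or_mem_openArc (a := x) (b := x) hxy.symm hxy.symm
  exact Set.disjoint_left.1 hb.2.2 (this.elim id id) h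

theorem isLeafOrGap_lamClass (hl : IsLamination r) {x : UnitAddCircle}
    (h : (lamClass r x).Nontrivial) : IsLeafOrGap r (lamClass r x) := by
  by_cases h3 : 3 ≤ (lamClass r x).encard
  · right
    refine ⟨hl.isClosed_lamClass x, h3, fun a b hab => isLeaf_of_isHole ?_ hab, fun a b hab => ?_⟩
    · rintro rfl
      obtain ⟨c, hc, hca⟩ := h.exists_ne a
      have := mem_openArc_or_mem_openArc (a := a) (b := a) hca hca
      exact Set.disjoint_left.1 hab.2.2 (this.elim id id) hc
    · by_contra hcon
      simp only [not_or, Set.not_disjoint_iff] at hcon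
      obtain ⟨⟨c, hc, hc'⟩, ⟨d, hd, hd'⟩⟩ := hcon
      exact hl.leaf_pair hab (r.trans' (r.symm' hc') hd') hc hd
  · left
    have h2 : (lamClass r x).encard = 2 := by
      have h2 := Set.one_lt_encard_iff_nontrivial.2 h
      have h4 : (2 : ℕ∞) ≤ (lamClass r x).encard := by
        have := Order.add_one_le_of_lt h2; simpa [one_add_one_eq_two] using this
      refine le_antisymm ?_ h4
      have h5 : (lamClass r x).encard < 2 + 1 := by
        have := not_le.1 h3; rwa [show (2 : ℕ∞) + 1 = 3 by norm_num]
      exact Order.le_of_lt_add_one h5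
    obtain ⟨a, b, hab, heq⟩ := Set.encard_eq_two.1 h2
    refine ⟨a, b, isLeaf_of_isHole (x := x) hab ?_, heq⟩
    rw [heq]
    refine ⟨by simp, by simp, ?_⟩
    rw [Set.disjoint_left]
    rintro t ht (rfl | rfl)
    · exact left_notMem_openArc _ _ ht
    · exact right_notMem_openArc _ _ ht

/-- A gap does not meet both sides of a chord of a class, if it has a point outside the class. -/
theorem IsGap.not_mem_arcs {G : Set UnitAddCircle} (hl : IsLamination r) (hG : IsGap r G)
    {a b u v : UnitAddCircle} (hab : r a b) (hne : a ≠ b) (hu : u ∈ openArc a b) (huG : u ∈ G)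
    (hau : ¬ r a u) (hv : v ∈ openArc b a) (hvG : v ∈ G) : False := by
  obtain ⟨c, d, hcd, hucd⟩ := exists_isHole_mem (hl.isClosed_lamClass a) ⟨a, self_mem_lamClass a⟩ hau
  have hcne : c ≠ d := by
    rintro rfl
    have hmem : ∀ x, r a x → x = c := fun x hx => by
      by_contra h
      exact Set.disjoint_left.1 hcd.2.2 ((mem_openArc_or_mem_openArc h h).elim id id) hx
    exact hne ((hmem a (r.refl' a)).trans (hmem b hab).symm)
  have hleaf : IsLeaf r c d := isLeaf_of_isHole hcne hcd
  have hv' : v ∈ openArc d c := by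
    obtain ⟨x, y, h1, h2, rfl, rfl⟩ := exists_coe_pair c d
    obtain ⟨z, h3, h4, rfl⟩ := (mem_openArc_iff h1 h2).1 hucd
    rw [isHole_coe_iff h1 h2] at hcd
    obtain ⟨p, h5, h6, rfl⟩ := exists_coe_Ico (z - 1) a
    obtain ⟨q, h7, h8, rfl⟩ := exists_coe_Ioc p b
    have hqp : q < p + 1 := lt_of_le_of_ne h8 (by rintro rfl; exact hne (coe_add_one' p).symm)
    rw [coe_mem_openArc_iff h7 h8 (by linarith) (by linarith)] at hu
    have hpx : p ≤ x := by
      by_contra h; exact hcd.2.2 p (by linarith) (by linarith) (self_mem_lamClass _)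
    have hqy : y ≤ q := by
      by_contra h; exact hcd.2.2 q (by linarith) (by linarith) hab
    rw [← coe_add_one' p] at hv
    obtain ⟨w, h9, h10, rfl⟩ := (mem_openArc_iff hqp (by linarith)).1 hv
    rw [← coe_add_one' x]
    exact coe_mem_openArc (by linarith) (by linarith) (by linarith)
  rcases hG.no_crossing c d hleaf with h | h
  · exact Set.disjoint_left.1 h hucd huG
  · exact Set.disjoint_left.1 h hv' hvG

/-- Equivalent points are not separated by an infinite gap. -/
theorem IsGap.pair_of_infinite {G : Set UnitAddCircle} (hl : IsLamination r) (hG : IsGap r G)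
    (hinf : G.Infinite) {a b : UnitAddCircle} (hab : r a b) (hne : a ≠ b) :
    Disjoint (openArc a b) G ∨ Disjoint (openArc b a) G := by
  by_contra hcon
  simp only [not_or, Set.not_disjoint_iff] at hcon
  obtain ⟨⟨u, hu, huG⟩, ⟨v, hv, hvG⟩⟩ := hcon
  obtain ⟨w, hwG, hw⟩ := hinf.exists_notMem_finset (hl.finite a).toFinset
  rw [Set.Finite.mem_toFinset, mem_lamClass] at hw
  rcases mem_openArc_or_mem_openArc (t := w) (a := a) (b := b) (by rintro rfl; exact hw (r.refl' _))
    (by rintro rfl; exact hw hab) with h | h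
  · exact hG.not_mem_arcs hl hab hne h hwG hw hv hvG
  · exact hG.not_mem_arcs hl (r.symm' hab) hne.symm h hwG (fun h' => hw (r.trans' hab h')) hu huG

end Lamination

/-! ### Invariance under doubling -/

section Quadratic
variable {r : Setoid UnitAddCircle}

theorem IsQuadraticLamination.rel_dbl (hr : IsQuadraticLamination r) {x y : UnitAddCircle}
    (h : r x y) : r (dbl x) (dbl y) := by
  have : dbl y ∈ dbl '' lamClass r x := ⟨y, h, rfl⟩
  rwa [hr.forward] at this

theorem IsQuadraticLamination.rel_iterate (hr : IsQuadraticLamination r) {x y : UnitAddCircle}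
    (h : r x y) (n : ℕ) : r (dbl^[n] x) (dbl^[n] y) := by
  induction n with
  | zero => exact h
  | succ n ih => rw [Function.iterate_succ_apply', Function.iterate_succ_apply']; exact hr.rel_dbl ih

theorem IsQuadraticLamination.exists_rel_of_rel_dbl (hr : IsQuadraticLamination r)
    {x w : UnitAddCircle} (h : r (dbl x) w) : ∃ z, r x z ∧ dbl z = w := by
  have : w ∈ dbl '' lamClass r x := by rw [hr.forward]; exact h
  exact this

theorem IsQuadraticLamination.image_iterate (hr : IsQuadraticLamination r) (x : UnitAddCircle)
    (n : ℕ) : dbl^[n] '' lamClass r x = lamClass r (dbl^[n] x) := by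
  induction n with
  | zero => simp
  | succ n ih =>
    rw [Function.iterate_succ', Set.image_comp, ih, hr.forward]; rfl

/-- A quadratic lamination is symmetric about the centre. -/
theorem IsQuadraticLamination.rel_add_half (hr : IsQuadraticLamination r) {x y : ℝ}
    (h : r x y) : r ((x + 1 / 2 : ℝ) : UnitAddCircle) ((y + 1 / 2 : ℝ) : UnitAddCircle) := by
  -- otherwise the two lifts of the class of `dbl x` through `x` and `x + 1/2` agree above `dbl y`
  by_contra hcon
  obtain ⟨z, hz, hzd⟩ := hr.exists_rel_of_rel_dbl (x := ((x + 1 / 2 : ℝ) : UnitAddCircle))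
    (w := dbl y) (by rw [dbl_add_half]; exact hr.rel_dbl h)
  obtain ⟨z, rfl⟩ := exists_coe z
  rcases dbl_eq_dbl_iff.1 hzd with h1 | h1
  swap
  · rw [h1] at hz; exact hcon hz
  rw [h1] at hz
  have hxx : r x ((x + 1 / 2 : ℝ) : UnitAddCircle) := r.trans' h (r.symm' hz)
  have hy : ((y + 1 / 2 : ℝ) : UnitAddCircle) ∉ lamClass r x := fun h2 =>
    hcon (r.trans' (r.symm' hxx) h2)
  obtain ⟨c, d, hcd, hyd⟩ := exists_isHole_mem (hr.lamination.isClosed_lamClass x)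
    ⟨x, self_mem_lamClass _⟩ hy
  by_cases hlen : arcLen c d ≤ 1 / 2
  · have h3 := dbl_mem_openArc hlen hyd
    rw [dbl_add_half] at h3
    have hdy : dbl y ∈ dbl '' lamClass r x := ⟨y, h, rfl⟩
    rcases hr.covering x with h4 | h4
    · -- the image is a point, so the class is `{x, x + 1/2}`
      have h5 := h4 hdy ⟨x, self_mem_lamClass _, rfl⟩
      rcases dbl_eq_dbl_iff.1 h5 with h6 | h6
      · apply hy
        have : ((y + 1 / 2 : ℝ) : UnitAddCircle) = ((x + 1 / 2 : ℝ) : UnitAddCircle) := by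
          rw [AddCircle.coe_add, h6, ← AddCircle.coe_add]
        rw [this]; exact hxx
      · apply hy
        have : ((y + 1 / 2 : ℝ) : UnitAddCircle) = x := by
          rw [AddCircle.coe_add, h6, ← AddCircle.coe_add, ← coe_add_one' x]; congr 1; ring
        rw [this]; exact self_mem_lamClass _
    · exact Set.disjoint_left.1 (h4 c d hcd).2.2 h3 hdy
  · obtain ⟨c, d, h1, h2, rfl, rfl⟩ := exists_coe_pair c d
    rw [arcLen_coe h1 h2] at hlen
    rw [isHole_coe_iff h1 h2] at hcd
    obtain ⟨x', h3, h4, hx'⟩ := exists_coe_Ioc c (x : UnitAddCircle)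
    have h5 : d ≤ x' := by
      by_contra h; exact hcd.2.2 x' h3 (by linarith) (by rw [hx']; exact self_mem_lamClass _)
    apply hcd.2.2 (x' - 1 / 2) (by linarith) (by linarith)
    rw [← coe_add_half_eq_sub_half, AddCircle.coe_add, hx', ← AddCircle.coe_add]
    exact hxx

theorem IsQuadraticLamination.rel_sub_half (hr : IsQuadraticLamination r) {x y : ℝ}
    (h : r x y) : r ((x - 1 / 2 : ℝ) : UnitAddCircle) ((y - 1 / 2 : ℝ) : UnitAddCircle) := by
  rw [← coe_add_half_eq_sub_half, ← coe_add_half_eq_sub_half]; exact hr.rel_add_half h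

theorem IsQuadraticLamination.rel_add_half_iff (hr : IsQuadraticLamination r) {x y : ℝ} :
    r ((x + 1 / 2 : ℝ) : UnitAddCircle) ((y + 1 / 2 : ℝ) : UnitAddCircle) ↔ r x y := by
  refine ⟨fun h => ?_, hr.rel_add_half⟩
  have := hr.rel_sub_half h
  simpa using this

/-- If the doubles are equivalent, then one of the two pairs of lifts is. -/
theorem IsQuadraticLamination.rel_or_rel (hr : IsQuadraticLamination r) {x y : ℝ}
    (h : r ((2 * x : ℝ) : UnitAddCircle) ((2 * y : ℝ) : UnitAddCircle)) :
    r x y ∨ r x ((y + 1 / 2 : ℝ) : UnitAddCircle) := by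
  rw [← dbl_coe, ← dbl_coe] at h
  obtain ⟨z, hz, hzd⟩ := hr.exists_rel_of_rel_dbl h
  obtain ⟨z, rfl⟩ := exists_coe z
  rcases dbl_eq_dbl_iff.1 hzd with h1 | h1
  · left; rwa [h1] at hz
  · right; rwa [h1] at hz

theorem IsQuadraticLamination.isLeaf_add_half (hr : IsQuadraticLamination r) {x y : ℝ}
    (h : IsLeaf r x y) :
    IsLeaf r ((x + 1 / 2 : ℝ) : UnitAddCircle) ((y + 1 / 2 : ℝ) : UnitAddCircle) := by
  obtain ⟨y', h1, h2, hy'⟩ := exists_coe_Ioc x (y : UnitAddCircle)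
  have e : ((y + 1 / 2 : ℝ) : UnitAddCircle) = ((y' + 1 / 2 : ℝ) : UnitAddCircle) := by
    rw [AddCircle.coe_add, ← hy', ← AddCircle.coe_add]
  rw [e]; rw [← hy'] at h
  have h3 : y' < x + 1 := lt_of_le_of_ne h2 (by rintro rfl; exact h.1 (coe_add_one' x).symm)
  rw [isLeaf_coe_iff (by linarith) (by linarith)]
  rw [isLeaf_coe_iff h1 h3] at h
  refine ⟨hr.rel_add_half h.1, h.2.imp (fun h z hz1 hz2 hz => ?_) (fun h z hz1 hz2 hz => ?_)⟩
  · refine h (z - 1 / 2) (by linarith) (by linarith) ?_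
    simpa using hr.rel_sub_half hz
  · refine h (z - 1 / 2) (by linarith) (by linarith) ?_
    simpa using hr.rel_sub_half hz

theorem IsQuadraticLamination.isLeaf_dbl (hr : IsQuadraticLamination r) {a b : UnitAddCircle}
    (h : IsLeaf r a b) (hne : dbl a ≠ dbl b) : IsLeaf r (dbl a) (dbl b) := by
  refine ⟨hne, ?_⟩
  rw [← hr.forward]
  rcases hr.covering a with h1 | h1
  · exact absurd (h1 ⟨a, self_mem_lamClass a, rfl⟩ ⟨b, h.rel, rfl⟩) hne
  · exact h.2.imp (h1 a b) (h1 b a)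

theorem IsQuadraticLamination.isLeaf_iterate (hr : IsQuadraticLamination r) {a b : UnitAddCircle}
    (h : IsLeaf r a b) (n : ℕ) (hne : dbl^[n] a ≠ dbl^[n] b) : IsLeaf r (dbl^[n] a) (dbl^[n] b) := by
  induction n with
  | zero => exact h
  | succ n ih =>
    rw [Function.iterate_succ_apply', Function.iterate_succ_apply'] at hne ⊢
    exact hr.isLeaf_dbl (ih fun h => hne (by rw [h])) hne

theorem IsQuadraticLamination.isHole_iterate (hr : IsQuadraticLamination r) {x a b : UnitAddCircle}
    (h : IsHole (lamClass r x) a b) (n : ℕ) (hnt : (dbl^[n] '' lamClass r x).Nontrivial) :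
    IsHole (dbl^[n] '' lamClass r x) (dbl^[n] a) (dbl^[n] b) := by
  induction n with
  | zero => simpa using h
  | succ n ih =>
    rw [Function.iterate_succ', Set.image_comp] at hnt ⊢
    have h1 := ih (Set.nontrivial_of_image _ _ hnt)
    rw [hr.image_iterate] at h1 hnt ⊢
    rcases hr.covering (dbl^[n] x) with h2 | h2
    · exact absurd h2 (Set.not_subsingleton_iff.2 hnt)
    · exact h2 _ _ h1

/-- The fixed point of doubling is a class by itself. -/
theorem IsQuadraticLamination.rel_zero (hr : IsQuadraticLamination r) {x : UnitAddCircle}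
    (h : r 0 x) : x = 0 := by
  -- the class of `0` is finite, invariant and doubling is injective on it; its holes are fixed,
  -- so a hole `(0, b)` has its endpoint fixed
  by_contra hx
  have hd0 : dbl 0 = 0 := by simp [dbl]
  have himg : dbl '' lamClass r 0 = lamClass r 0 := by rw [hr.forward, hd0]
  obtain ⟨b, hb, hhole⟩ := exists_isLeaf_left hr.lamination h (Ne.symm hx)
  rcases hr.covering 0 with h1 | h1
  · rw [himg] at h1
    exact hx (h1 (self_mem_lamClass 0) h).symm
  · have h2 := h1 0 b hhole
    rw [himg, hd0] at h2
    have h3 : dbl b = b := h2.right_unique hhole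
    apply hb.1
    have h4 : b + b = b := by rw [← two_nsmul]; exact h3
    exact (add_eq_left.1 h4).symm

end Quadratic

section Quadratic
variable {r : Setoid UnitAddCircle}

theorem IsQuadraticLamination.rel_half (hr : IsQuadraticLamination r) {x : ℝ}
    (h : r ((1 / 2 : ℝ) : UnitAddCircle) x) : (x : UnitAddCircle) = ((1 / 2 : ℝ) : UnitAddCircle) := by
  have h1 := hr.rel_sub_half h
  rw [sub_self, AddCircle.coe_zero] at h1
  have h2 := hr.rel_zero h1
  have h3 : x = (x - 1 / 2) + 1 / 2 := by ring
  rw [h3, AddCircle.coe_add, h2, zero_add]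

/-- The class of a diameter that is a leaf consists of its endpoints. -/
theorem IsQuadraticLamination.lamClass_diameter (hr : IsQuadraticLamination r) {a : ℝ}
    (h : IsLeaf r a ((a + 1 / 2 : ℝ) : UnitAddCircle)) :
    lamClass r a = {(a : UnitAddCircle), ((a + 1 / 2 : ℝ) : UnitAddCircle)} := by
  have hrel := h.rel
  rw [isLeaf_coe_iff (by linarith) (by linarith)] at h
  ext t
  constructor
  swap
  · rintro (rfl | rfl)
    · exact self_mem_lamClass _
    · exact hrel
  intro ht
  obtain ⟨x, h1, h2, rfl⟩ := exists_coe_Ico a t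
  rw [mem_lamClass] at ht
  rcases eq_or_lt_of_le h1 with h3 | h3
  · left; rw [h3]
  rcases lt_trichotomy x (a + 1 / 2) with h4 | h4 | h4
  · rcases h.2 with h5 | h5
    · exact absurd ht (h5 x h3 h4)
    · exact absurd (r.trans' hrel (hr.rel_add_half ht)) (h5 (x + 1 / 2) (by linarith) (by linarith))
  · right; rw [h4]; rfl
  · rcases h.2 with h5 | h5
    · refine absurd (r.trans' hrel ?_) (h5 (x - 1 / 2) (by linarith) (by linarith))
      have := hr.rel_sub_half (r.trans' (r.symm' hrel) ht)
      rw [show a + 1 / 2 - 1 / 2 = a by ring] at this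
      exact r.trans' (r.symm' hrel) this
    · exact absurd ht (h5 x h4 h2)

theorem injOn_of_image_eq {A : Set UnitAddCircle} (hA : A.Finite) {f : UnitAddCircle → UnitAddCircle}
    (h : f '' A = A) : InjOn f A := (Set.ncard_image_iff hA).1 (by rw [h])

theorem IsLamination.isClosed_leaves (hl : IsLamination r) {δ : ℝ} (hδ : 0 < δ) :
    IsClosed {p : UnitAddCircle × UnitAddCircle | IsLeaf r p.1 p.2 ∧ δ ≤ dist p.1 p.2} := by
  have : {p : UnitAddCircle × UnitAddCircle | IsLeaf r p.1 p.2 ∧ δ ≤ dist p.1 p.2} =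
      {p | r p.1 p.2} ∩ {p | δ ≤ dist p.1 p.2} ∩ ⋂ (c) (d) (_ : r c d) (_ : c ≠ d),
        (openArc d c ×ˢ openArc c d)ᶜ := by
    ext ⟨a, b⟩
    simp only [Set.mem_inter_iff, Set.mem_ofPred_eq, Set.mem_iInter, Set.mem_compl_iff,
      Set.mem_prod, hl.isLeaf_iff]
    constructor
    · rintro ⟨⟨_, h2, h3⟩, h4⟩
      exact ⟨⟨h2, h4⟩, h3⟩
    · rintro ⟨⟨h2, h4⟩, h3⟩
      refine ⟨⟨?_, h2, h3⟩, h4⟩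
      rintro rfl
      rw [dist_self] at h4; linarith
  rw [this]
  refine (hl.closed.inter (isClosed_le continuous_const (by fun_prop))).inter ?_
  refine isClosed_iInter fun c => isClosed_iInter fun d => isClosed_iInter fun _ =>
    isClosed_iInter fun _ => ?_
  exact ((isOpen_openArc d c).prod (isOpen_openArc c d)).isClosed_compl

theorem IsLamination.exists_isMajor (hl : IsLamination r) (hne : r ≠ ⊥) :
    ∃ a b, IsMajor r a b := by
  obtain ⟨x, y, hxy, hne⟩ : ∃ x y, r x y ∧ x ≠ y := by
    by_contra h
    push Not at h
    apply hne
    ext x y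
    exact ⟨fun hxy => h x y hxy, fun hxy => by
      have : x = y := hxy
      rw [this]⟩
  obtain ⟨b, hb, -⟩ := exists_isLeaf_left hl hxy hne
  have hδ : 0 < dist x b := dist_pos.2 hb.1
  obtain ⟨S, hS, hmem⟩ : ∃ S : Set (UnitAddCircle × UnitAddCircle), IsCompact S ∧
      ∀ p, p ∈ S ↔ IsLeaf r p.1 p.2 ∧ dist x b ≤ dist p.1 p.2 :=
    ⟨_, (hl.isClosed_leaves hδ).isCompact, fun p => Iff.rfl⟩
  obtain ⟨p, hp, hmax⟩ := hS.exists_isMaxOn ⟨(x, b), (hmem _).2 ⟨hb, le_rfl⟩⟩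
    (continuous_dist (α := UnitAddCircle)).continuousOn
  rw [hmem] at hp
  refine ⟨p.1, p.2, hp.1, fun c d hcd => ?_⟩
  rcases le_total (dist x b) (dist c d) with h | h
  · exact isMaxOn_iff.1 hmax (c, d) ((hmem _).2 ⟨hcd, h⟩)
  · exact h.trans hp.2

theorem IsQuadraticLamination.third_le_of_isMajor (hr : IsQuadraticLamination r)
    {a b : UnitAddCircle} (h : IsMajor r a b) : 1 / 3 ≤ dist a b := by
  by_contra hcon
  push Not at hcon
  have h0 : 0 < dist a b := dist_pos.2 h.1.1
  rcases le_total (dist a b) (1 / 4) with h1 | h1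
  · have h2 := dist_dbl_of_le h1
    have h3 := h.2 _ _ (hr.isLeaf_dbl h.1 (dist_pos.1 (by linarith)))
    linarith
  · have h2 := dist_dbl_of_ge h1
    have h3 := h.2 _ _ (hr.isLeaf_dbl h.1 (dist_pos.1 (by linarith)))
    linarith

theorem IsMajor.symm {a b : UnitAddCircle} (h : IsMajor r a b) : IsMajor r b a :=
  ⟨h.1.symm, fun c d hcd => by rw [dist_comm b a]; exact h.2 c d hcd⟩

theorem IsQuadraticLamination.isMajor_add_half (hr : IsQuadraticLamination r) {x y : ℝ}
    (h : IsMajor r x y) :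
    IsMajor r ((x + 1 / 2 : ℝ) : UnitAddCircle) ((y + 1 / 2 : ℝ) : UnitAddCircle) := by
  refine ⟨hr.isLeaf_add_half h.1, fun c d hcd => ?_⟩
  rw [AddCircle.coe_add, AddCircle.coe_add, dist_add_right]
  exact h.2 c d hcd

theorem IsQuadraticLamination.exists_major_lift_aux (hr : IsQuadraticLamination r) {x y : ℝ}
    (h : IsMajor r x y) (hx : 0 < x) (hxy : x < y) (hy : y < 1 / 2) : False := by
  have h3 := hr.third_le_of_isMajor h
  rw [dist_coe_of_le hxy.le (by linarith)] at h3
  have h4 := hr.rel_dbl h.1.rel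
  rw [dbl_coe, dbl_coe] at h4
  exact hr.lamination.leaf_pair_coe h.1 h4 (by linarith) (by linarith) (by linarith) (by linarith)

/-- Up to a half turn and up to its orientation, a major separates the fixed point from `1/2`, and
the shorter arc that it cuts out contains `1/2`. -/
theorem IsQuadraticLamination.exists_major_lift (hr : IsQuadraticLamination r) {a b : UnitAddCircle}
    (h : IsMajor r a b) : ∃ α β : ℝ, 0 < α ∧ α < 1 / 2 ∧ 1 / 2 < β ∧ β < 1 ∧ β - α ≤ 1 / 2 ∧
      IsMajor r α β ∧ ((dbl a = dbl α ∧ dbl b = dbl β) ∨ (dbl a = dbl β ∧ dbl b = dbl α)) := by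
  have key : ∀ {x y : ℝ}, IsMajor r x y → 0 < x → x < y → y < 1 →
      ∃ α β : ℝ, 0 < α ∧ α < 1 / 2 ∧ 1 / 2 < β ∧ β < 1 ∧ β - α ≤ 1 / 2 ∧ IsMajor r α β ∧
        ((dbl x = dbl α ∧ dbl y = dbl β) ∨ (dbl x = dbl β ∧ dbl y = dbl α)) := by
    intro x y hm hx hxy hy
    have hx2 : x ≠ 1 / 2 := by
      rintro rfl
      exact hm.1.1 (hr.rel_half hm.1.rel).symm
    have hy2 : y ≠ 1 / 2 := by
      rintro rfl
      exact hm.1.1 (hr.rel_half hm.1.symm.rel)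
    rcases lt_or_gt_of_ne hx2 with h1 | h1 <;> rcases lt_or_gt_of_ne hy2 with h2 | h2
    · exact (hr.exists_major_lift_aux hm hx hxy h2).elim
    · rcases le_total (y - x) (1 / 2) with h3 | h3
      · exact ⟨x, y, hx, h1, h2, hy, h3, hm, Or.inl ⟨rfl, rfl⟩⟩
      · refine ⟨y - 1 / 2, x + 1 / 2, by linarith, by linarith, by linarith, by linarith,
          by linarith, ?_, Or.inr ⟨(dbl_add_half x).symm, (dbl_sub_half y).symm⟩⟩
        have := (hr.isMajor_add_half hm).symm
        rwa [coe_add_half_eq_sub_half y] at this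
    · linarith
    · have := hr.isMajor_add_half hm
      rw [coe_add_half_eq_sub_half, coe_add_half_eq_sub_half] at this
      exact (hr.exists_major_lift_aux this (by linarith) (by linarith) (by linarith)).elim
  have h0 : ∀ {a b : UnitAddCircle}, IsMajor r a b → a ≠ 0 := by
    rintro a b h rfl
    exact h.1.1 (hr.rel_zero h.1.rel).symm
  obtain ⟨x, hx1, hx2, rfl⟩ := exists_coe_Ico 0 a
  obtain ⟨y, hy1, hy2, rfl⟩ := exists_coe_Ico 0 b
  have hx3 : 0 < x := lt_of_le_of_ne hx1 (by rintro rfl; exact h0 h rfl)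
  have hy3 : 0 < y := lt_of_le_of_ne hy1 (by rintro rfl; exact h0 h.symm rfl)
  rcases lt_trichotomy x y with h1 | h1 | h1
  · exact key h hx3 h1 (by linarith)
  · rw [h1] at h; exact absurd rfl h.1.1
  · obtain ⟨α, β, h2, h3, h4, h5, h6, h7, h8⟩ := key h.symm hy3 h1 (by linarith)
    exact ⟨α, β, h2, h3, h4, h5, h6, h7, h8.symm.imp And.symm And.symm⟩

end Quadratic

/-! ### Rotation numbers on invariant subsets of the circle -/

section Rotation

/-- `F` lifts the restriction of `dbl^[n]` to `A`. -/
def IsLiftOn (F : CircleDeg1Lift) (A : Set UnitAddCircle) (n : ℕ) : Prop :=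
  ∀ t : ℝ, (t : UnitAddCircle) ∈ A → ((F t : ℝ) : UnitAddCircle) = dbl^[n] (t : UnitAddCircle)

/-- A monotone function on a fundamental interval extends to a lift of degree one. -/
theorem exists_isLiftOn {A : Set UnitAddCircle} {n : ℕ} (x : ℝ) (φ : ℝ → ℝ)
    (hφ : MonotoneOn φ (Icc x (x + 1))) (h1 : φ (x + 1) = φ x + 1)
    (h : ∀ t, x ≤ t → t < x + 1 → (t : UnitAddCircle) ∈ A →
      (φ t : UnitAddCircle) = dbl^[n] (t : UnitAddCircle)) :
    ∃ F : CircleDeg1Lift, IsLiftOn F A n := by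
  have hb : ∀ t : ℝ, t - ⌊t - x⌋ ∈ Icc x (x + 1) := fun t =>
    ⟨by linarith [Int.floor_le (t - x)], by linarith [Int.lt_floor_add_one (t - x)]⟩
  let F : CircleDeg1Lift :=
    { toFun := fun t => φ (t - ⌊t - x⌋) + ⌊t - x⌋
      monotone' := by
        intro s t hst
        have hf : ⌊s - x⌋ ≤ ⌊t - x⌋ := Int.floor_le_floor (by linarith)
        rcases eq_or_lt_of_le hf with h2 | h2
        · have := hφ (hb s) (hb t) (by rw [h2]; linarith)
          simp only [h2] at this ⊢; linarith
        · have h3 : ((⌊s - x⌋ : ℤ) : ℝ) + 1 ≤ ⌊t - x⌋ := by exact_mod_cast h2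
          have h4 := hφ (hb s) (right_mem_Icc.2 (by linarith)) (hb s).2
          have h5 := hφ (left_mem_Icc.2 (by linarith)) (hb t) (hb t).1
          simp only; linarith
      map_add_one' := by
        intro t
        have : ⌊t + 1 - x⌋ = ⌊t - x⌋ + 1 := by
          rw [← Int.floor_add_one]; congr 1; ring
        simp only [this]; push_cast
        rw [show t + 1 - ((⌊t - x⌋ : ℝ) + 1) = t - ⌊t - x⌋ by ring]; ring }
  refine ⟨F, fun t ht => ?_⟩
  change ((φ (t - ⌊t - x⌋) + ⌊t - x⌋ : ℝ) : UnitAddCircle) = _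
  rw [coe_add_intCast, h _ (hb t).1 (by linarith [Int.lt_floor_add_one (t - x)]), coe_sub_intCast]
  rwa [coe_sub_intCast]

theorem IsLiftOn.mono {F : CircleDeg1Lift} {A B : Set UnitAddCircle} {n : ℕ} (h : IsLiftOn F B n)
    (hAB : A ⊆ B) : IsLiftOn F A n := fun t ht => h t (hAB ht)

theorem mapsTo_iterate_mul {A : Set UnitAddCircle} {n : ℕ} (hA : MapsTo dbl^[n] A A) (m : ℕ) :
    MapsTo dbl^[n * m] A A := by
  rw [Function.iterate_mul]; exact hA.iterate m

theorem IsLiftOn.pow {F : CircleDeg1Lift} {A : Set UnitAddCircle} {n : ℕ} (h : IsLiftOn F A n)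
    (hA : MapsTo dbl^[n] A A) (m : ℕ) : IsLiftOn (F ^ m) A (n * m) := by
  induction m with
  | zero => intro t _; simp
  | succ m ih =>
    intro t ht
    have h1 : ((F t : ℝ) : UnitAddCircle) ∈ A := by rw [h t ht]; exact hA ht
    rw [pow_succ, CircleDeg1Lift.mul_apply, ih _ h1, h t ht, Nat.mul_succ,
      Function.iterate_add_apply]

theorem IsLiftOn.translationNumber_of_periodic {F : CircleDeg1Lift} {A : Set UnitAddCircle} {n : ℕ}
    (h : IsLiftOn F A n) (hA : MapsTo dbl^[n] A A) {t : UnitAddCircle} (ht : t ∈ A) {m : ℕ}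
    (hm : 0 < m) (hp : dbl^[n * m] t = t) :
    ∃ j : ℤ, F.translationNumber = j / m := by
  obtain ⟨x, rfl⟩ := exists_coe t
  have h1 := h.pow hA m x ht
  rw [hp, coe_eq_coe_iff_exists_int] at h1
  obtain ⟨j, hj⟩ := h1
  exact ⟨j, CircleDeg1Lift.translationNumber_of_map_pow_eq_add_int _ hj hm⟩

theorem exists_periodic_of_finite {A : Set UnitAddCircle} (hA : A.Finite) {n : ℕ}
    (hmaps : MapsTo dbl^[n] A A) (hne : A.Nonempty) :
    ∃ t ∈ A, ∃ m : ℕ, 0 < m ∧ dbl^[n * m] t = t := by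
  obtain ⟨t, ht⟩ := hne
  have hall : ∀ i : ℕ, dbl^[n * i] t ∈ A := fun i => mapsTo_iterate_mul hmaps i ht
  obtain ⟨i, j, hij, h⟩ : ∃ i j : ℕ, i < j ∧ dbl^[n * i] t = dbl^[n * j] t := by
    have := hA.to_subtype
    obtain ⟨i, j, hij, h⟩ := Finite.exists_ne_map_eq_of_infinite (fun i : ℕ => (⟨_, hall i⟩ : A))
    rcases lt_or_gt_of_ne hij with h1 | h1
    · exact ⟨i, j, h1, congrArg Subtype.val h⟩
    · exact ⟨j, i, h1, (congrArg Subtype.val h).symm⟩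
  refine ⟨_, hall i, j - i, by omega, ?_⟩
  rw [← Function.iterate_add_apply, ← Nat.mul_add, Nat.sub_add_cancel hij.le, h]

/-- A finite set with integral rotation number contains a fixed point. -/
theorem IsLiftOn.exists_fixed_of_finite {F : CircleDeg1Lift} {A : Set UnitAddCircle} {n : ℕ}
    (h : IsLiftOn F A n) (hA : A.Finite) (hmaps : MapsTo dbl^[n] A A) (hne : A.Nonempty) {k : ℤ}
    (hk : F.translationNumber = k) : ∃ t ∈ A, dbl^[n] t = t := by
  obtain ⟨t, ht, m, hm, hp⟩ := exists_periodic_of_finite hA hmaps hne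
  obtain ⟨x, rfl⟩ := exists_coe t
  refine ⟨x, ht, ?_⟩
  have h1 := h.pow hmaps m x ht
  rw [hp, coe_eq_coe_iff_exists_int] at h1
  obtain ⟨j, hj⟩ := h1
  have h2 := CircleDeg1Lift.translationNumber_of_map_pow_eq_add_int _ hj hm
  rw [hk, eq_div_iff (by positivity)] at h2
  rw [CircleDeg1Lift.coe_pow, ← h2, mul_comm, CircleDeg1Lift.iterate_pos_eq_iff _ hm] at hj
  rw [← h x ht, hj, coe_add_intCast]

theorem exists_fixed_of_bounded {A : Set UnitAddCircle} (hA : IsClosed A) {m : ℕ} {s : ℕ → ℝ}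
    (hs : Monotone s ∨ Antitone s) {C : ℝ} (hC : ∀ i, |s i| ≤ C)
    (hsA : ∀ i, (s i : UnitAddCircle) ∈ A)
    (hstep : ∀ i, (s (i + 1) : UnitAddCircle) = dbl^[m] (s i : UnitAddCircle)) :
    ∃ p ∈ A, dbl^[m] p = p := by
  obtain ⟨L, hL⟩ : ∃ L, Filter.Tendsto s Filter.atTop (nhds L) := by
    rcases hs with hs | hs
    · exact ⟨_, tendsto_atTop_ciSup hs ⟨C, by rintro _ ⟨i, rfl⟩; exact (abs_le.1 (hC i)).2⟩⟩
    · exact ⟨_, tendsto_atTop_ciInf hs ⟨-C, by rintro _ ⟨i, rfl⟩; exact (abs_le.1 (hC i)).1⟩⟩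
  have hL' : Filter.Tendsto (fun i => (s i : UnitAddCircle)) Filter.atTop (nhds (L : UnitAddCircle)) :=
    ((AddCircle.continuous_mk' (1 : ℝ)).tendsto L).comp hL
  refine ⟨L, hA.mem_of_tendsto hL' (Filter.Eventually.of_forall hsA), ?_⟩
  have h1 := ((continuous_dbl_iterate m).tendsto _).comp hL'
  have h2 := hL'.comp (Filter.tendsto_add_atTop_nat 1)
  refine tendsto_nhds_unique h1 (h2.congr fun i => ?_)
  simp only [Function.comp]; exact hstep i

/-- On a closed set without periodic points the rotation number is irrational. -/
theorem IsLiftOn.irrational {F : CircleDeg1Lift} {A : Set UnitAddCircle} {n : ℕ} (hn : 0 < n)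
    (h : IsLiftOn F A n) (hA : IsClosed A) (hmaps : MapsTo dbl^[n] A A) (hne : A.Nonempty)
    (hper : ∀ t ∈ A, ∀ m : ℕ, 0 < m → dbl^[m] t ≠ t) : Irrational F.translationNumber := by
  rintro ⟨q, hq⟩
  have hq0 : 0 < q.den := q.den_pos
  let H : CircleDeg1Lift := F ^ q.den
  have hH : H.translationNumber = q.num := by
    rw [CircleDeg1Lift.translationNumber_pow, ← hq]
    exact_mod_cast Rat.den_mul_eq_num q
  have hlift := h.pow hmaps q.den
  have hmH := mapsTo_iterate_mul hmaps q.den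
  obtain ⟨t, ht⟩ := hne
  obtain ⟨x, rfl⟩ := exists_coe t
  let s : ℕ → ℝ := fun i => (H ^ i) x - i * q.num
  have hsucc : ∀ i, s (i + 1) = H (s i) - q.num := fun i => by
    have h1 : H (s i) = H ((H ^ i) x) - ((i * q.num : ℤ) : ℝ) := by
      rw [← CircleDeg1Lift.map_sub_int]; simp [s]
    rw [h1]; simp only [s, pow_succ', CircleDeg1Lift.mul_apply]; push_cast; ring
  have hsA : ∀ i, (s i : UnitAddCircle) ∈ A := fun i => by
    induction i with
    | zero => simpa [s] using ht
    | succ i ih => rw [hsucc, coe_sub_intCast, hlift _ ih]; exact hmH ih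
  have hmono : Monotone s ∨ Antitone s := by
    have hm : Monotone fun y : ℝ => H y - q.num := fun a b hab => by
      have := H.monotone hab; simp only; linarith
    have hiter : s = fun i => (fun y : ℝ => H y - q.num)^[i] x := by
      funext i
      induction i with
      | zero => simp [s]
      | succ i ih => rw [hsucc, Function.iterate_succ_apply', ← ih]
    rcases le_total x (H x - q.num) with h1 | h1
    · left; rw [hiter]; exact hm.monotone_iterate_of_le_map h1
    · right; rw [hiter]; exact hm.antitone_iterate_of_map_le h1
  have hbd : ∀ i, |s i| ≤ |x| + 1 := fun i => by
    have htr : (H ^ i).translationNumber = ((i * q.num : ℤ) : ℝ) := by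
      rw [CircleDeg1Lift.translationNumber_pow, hH]; push_cast; rfl
    have h1 := (H ^ i).map_lt_of_translationNumber_lt_int (n := i * q.num + 1)
      (by rw [htr]; push_cast; linarith) x
    have h2 := (H ^ i).lt_map_of_int_lt_translationNumber (n := i * q.num - 1)
      (by rw [htr]; push_cast; linarith) x
    push_cast at h1 h2
    simp only [s]
    rw [abs_le]
    constructor <;> linarith [le_abs_self x, neg_abs_le x]
  obtain ⟨p, hp, hfix⟩ := exists_fixed_of_bounded hA hmono hbd hsA (m := n * q.den) (fun i => by
    rw [hsucc, coe_sub_intCast, hlift _ (hsA i)])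
  exact hper p hp _ (by positivity) hfix

theorem dist_iterate_of_lt {a b : UnitAddCircle} {n : ℕ} (h : dist a b * 2 ^ n ≤ 1 / 2) :
    dist (dbl^[n] a) (dbl^[n] b) = 2 ^ n * dist a b := by
  induction n with
  | zero => simp
  | succ n ih =>
    rw [pow_succ] at h ⊢
    have h0 : 0 ≤ dist a b * 2 ^ n := by positivity
    have h1 := ih (by linarith)
    rw [Function.iterate_succ_apply', Function.iterate_succ_apply', dist_dbl_of_le, h1]
    · ring
    · rw [h1]; linarith

theorem frequently_dist_ge {n : ℕ} (hn : 0 < n) {x y : UnitAddCircle}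
    (hne : ∀ i, dbl^[n * i] x ≠ dbl^[n * i] y) (N : ℕ) :
    ∃ i ≥ N, 1 / 2 ^ (n + 1) ≤ dist (dbl^[n * i] x) (dbl^[n * i] y) := by
  by_contra hcon
  push Not at hcon
  have h2 : (2 : ℝ) ≤ 2 ^ n := by
    calc (2 : ℝ) = 2 ^ 1 := by norm_num
      _ ≤ 2 ^ n := pow_le_pow_right₀ (by norm_num) hn
  have key : ∀ j, 2 ^ j * dist (dbl^[n * N] x) (dbl^[n * N] y) ≤
      dist (dbl^[n * (N + j)] x) (dbl^[n * (N + j)] y) := by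
    intro j
    induction j with
    | zero => simp
    | succ j ih =>
      have h1 := hcon (N + j) (by omega)
      rw [lt_div_iff₀ (by positivity), pow_succ] at h1
      have h4 := dist_iterate_of_lt (n := n)
        (show dist (dbl^[n * (N + j)] x) (dbl^[n * (N + j)] y) * 2 ^ n ≤ 1 / 2 by linarith)
      rw [← add_assoc, Nat.mul_succ, add_comm (n * (N + j)) n, Function.iterate_add_apply,
        Function.iterate_add_apply, h4, pow_succ]
      have h3 : 0 ≤ dist (dbl^[n * (N + j)] x) (dbl^[n * (N + j)] y) := dist_nonneg
      nlinarith
  have h0 := dist_pos.2 (hne N)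
  obtain ⟨j, hj⟩ := pow_unbounded_of_one_lt (1 / dist (dbl^[n * N] x) (dbl^[n * N] y)) (by norm_num : (1 : ℝ) < 2)
  rw [div_lt_iff₀ h0] at hj
  have := key j
  have := dist_le_half (dbl^[n * (N + j)] x) (dbl^[n * (N + j)] y)
  linarith

end Rotation

section Rotation
variable {r : Setoid UnitAddCircle}

/-- A bounded orbit of a lift on a closed set is monotone, hence converges to a periodic point. -/
theorem IsLiftOn.exists_fixed_of_bounded {H : CircleDeg1Lift} {A : Set UnitAddCircle} {m : ℕ}
    (h : IsLiftOn H A m) (hA : IsClosed A) (hmaps : MapsTo dbl^[m] A A) (k : ℤ) {x C : ℝ}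
    (hx : (x : UnitAddCircle) ∈ A) (hbd : ∀ i, |(fun y : ℝ => H y - k)^[i] x| ≤ C) :
    ∃ p ∈ A, dbl^[m] p = p := by
  have hm : Monotone fun y : ℝ => H y - k := fun a b hab => by
    have := H.monotone hab; simp only; linarith
  have hsucc : ∀ i, (fun y : ℝ => H y - k)^[i + 1] x = H ((fun y : ℝ => H y - k)^[i] x) - k :=
    fun i => Function.iterate_succ_apply' _ _ _
  have hsA : ∀ i, (((fun y : ℝ => H y - k)^[i] x : ℝ) : UnitAddCircle) ∈ A := fun i => by
    induction i with
    | zero => exact hx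
    | succ i ih => rw [hsucc, coe_sub_intCast, h _ ih]; exact hmaps ih
  refine _root_.exists_fixed_of_bounded hA (s := fun i => (fun y : ℝ => H y - k)^[i] x) ?_ hbd hsA
    (fun i => ?_)
  · rcases le_total x (H x - k) with h1 | h1
    · left; exact hm.monotone_iterate_of_le_map h1
    · right; exact hm.antitone_iterate_of_map_le h1
  · rw [hsucc, coe_sub_intCast, h _ (hsA i)]

theorem exists_coe_of_dist_lt {a ε : ℝ} {t : UnitAddCircle} (h : dist (a : UnitAddCircle) t < ε) :
    ∃ a' : ℝ, |a' - a| < ε ∧ (a' : UnitAddCircle) = t := by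
  obtain ⟨x, h1, h2, rfl⟩ := exists_coe_Ioc (a - 1 / 2) t
  refine ⟨x, ?_, rfl⟩
  rcases le_total a x with h3 | h3
  · rw [dist_coe_of_le h3 (by linarith)] at h
    rwa [abs_of_nonneg (by linarith)]
  · rw [dist_comm, dist_coe_of_le h3 (by linarith)] at h
    rwa [abs_of_nonpos (by linarith), neg_sub]

theorem exists_close_pairs {n : ℕ} (hn : 0 < n) {x y : UnitAddCircle}
    (hne : ∀ i, dbl^[n * i] x ≠ dbl^[n * i] y) {ε : ℝ} (hε : 0 < ε) :
    ∃ i j, i < j ∧ 1 / 2 ^ (n + 1) ≤ dist (dbl^[n * i] x) (dbl^[n * i] y) ∧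
      dist (dbl^[n * i] x) (dbl^[n * j] x) < ε ∧ dist (dbl^[n * i] y) (dbl^[n * j] y) < ε := by
  obtain ⟨φ, hφ, hφd⟩ := Filter.extraction_of_frequently_atTop
    (P := fun i => 1 / 2 ^ (n + 1) ≤ dist (dbl^[n * i] x) (dbl^[n * i] y))
    (Filter.frequently_atTop.2 fun N => frequently_dist_ge hn hne N)
  obtain ⟨a, ψ, hψ, ha⟩ := CompactSpace.tendsto_subseq
    (fun i => (dbl^[n * φ i] x, dbl^[n * φ i] y))
  obtain ⟨N, hN⟩ := (Metric.tendsto_atTop.1 ha) (ε / 2) (by linarith)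
  have h1 := hN N le_rfl
  have h2 := hN (N + 1) (by omega)
  simp only [Function.comp, Prod.dist_eq, max_lt_iff] at h1 h2
  refine ⟨φ (ψ N), φ (ψ (N + 1)), hφ (hψ (by omega)), hφd _, ?_, ?_⟩
  · have := dist_triangle_right (dbl^[n * φ (ψ N)] x) (dbl^[n * φ (ψ (N + 1))] x) a.1
    linarith [h1.1, h2.1]
  · have := dist_triangle_right (dbl^[n * φ (ψ N)] y) (dbl^[n * φ (ψ (N + 1))] y) a.2
    linarith [h1.2, h2.2]

/-- Over a closed set without periodic points on which the first return is order preserving, two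
equivalent points have the same forward orbit from some time on. Otherwise the expansion makes the
images of the pair return close to each other, so that an iterate of the lift maps a compact interval
into itself. -/
theorem IsLiftOn.exists_iterate_eq {F : CircleDeg1Lift} {A : Set UnitAddCircle} {n : ℕ}
    (hr : IsQuadraticLamination r) (hn : 0 < n) (h : IsLiftOn F A n) (hA : IsClosed A)
    (hmaps : MapsTo dbl^[n] A A) (hper : ∀ t ∈ A, ∀ m : ℕ, 0 < m → dbl^[m] t ≠ t)
    {x y : UnitAddCircle} (hx : x ∈ A) (hy : y ∈ A) (hxy : r x y) :
    ∃ i, dbl^[n * i] x = dbl^[n * i] y := by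
  by_contra hcon
  push Not at hcon
  obtain ⟨δ, hδ⟩ : ∃ δ : ℝ, δ = 1 / 2 ^ (n + 1) := ⟨_, rfl⟩
  have hδ0 : 0 < δ := by rw [hδ]; positivity
  obtain ⟨i, j, hij, h1, h2, h3⟩ := exists_close_pairs hn hcon (ε := δ / 4) (by linarith)
  rw [← hδ] at h1
  have hrel := hr.rel_iterate hxy (n * i)
  have hxA := mapsTo_iterate_mul hmaps i hx
  have hyA := mapsTo_iterate_mul hmaps i hy
  obtain ⟨d, rfl⟩ : ∃ d, j = d + i := ⟨j - i, by omega⟩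
  have hd : 0 < d := by omega
  rw [Nat.mul_add, Function.iterate_add_apply] at h2 h3
  generalize dbl^[n * i] x = p at *
  generalize dbl^[n * i] y = q at *
  have hlift := h.pow hmaps d
  have hmd := mapsTo_iterate_mul hmaps d
  -- a class that returns to itself contains periodic points
  have hnrel : ¬ r p (dbl^[n * d] p) := by
    intro hr1
    obtain ⟨t, ht, m, hm, hp⟩ := exists_periodic_of_finite
      (A := lamClass r p ∩ A) (n := n * d) ((hr.lamination.finite p).inter_of_left A)
      (fun t ht => ⟨r.trans' hr1 (hr.rel_iterate ht.1 _), hmd ht.2⟩) ⟨p, self_mem_lamClass p, hxA⟩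
    exact hper t ht.2 _ (by positivity) hp
  have hrel2 := hr.rel_iterate hrel (n * d)
  obtain ⟨a, b, hab, hb1, rfl, rfl⟩ := exists_coe_pair p q
  have hd1 : δ ≤ b - a ∧ b - a ≤ 1 - δ := by
    rcases le_total b (a + 1 / 2) with h4 | h4
    · rw [dist_coe_of_le hab.le h4] at h1
      exact ⟨h1, by have := h1; rw [hδ] at this ⊢; have : (1 : ℝ) / 2 ^ (n + 1) ≤ 1 / 2 := by
                      apply one_div_le_one_div_of_le (by norm_num)
                      calc (2 : ℝ) = 2 ^ 1 := by norm_num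
                        _ ≤ 2 ^ (n + 1) := pow_le_pow_right₀ (by norm_num) (by omega)
                    linarith⟩
    · rw [dist_coe_of_ge h4 hb1] at h1
      exact ⟨by have : (1 : ℝ) / 2 ^ (n + 1) ≤ 1 / 2 := by
                      apply one_div_le_one_div_of_le (by norm_num)
                      calc (2 : ℝ) = 2 ^ 1 := by norm_num
                        _ ≤ 2 ^ (n + 1) := pow_le_pow_right₀ (by norm_num) (by omega)
                rw [hδ]; linarith, by linarith⟩
  obtain ⟨a', ha', hpa⟩ := exists_coe_of_dist_lt h2
  obtain ⟨b', hb', hqb⟩ := exists_coe_of_dist_lt h3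
  rw [abs_lt] at ha' hb'
  rw [← hpa] at hnrel hrel2
  rw [← hqb] at hrel2
  obtain ⟨k, hk⟩ := coe_eq_coe_iff_exists_int.1 ((hlift a hxA).trans hpa.symm)
  obtain ⟨k', hk'⟩ := coe_eq_coe_iff_exists_int.1 ((hlift b hyA).trans hqb.symm)
  have hkk : k' = k := by
    have h4 := (F ^ d).monotone hab.le
    have h5 := (F ^ d).monotone hb1
    rw [CircleDeg1Lift.map_add_one] at h5
    have : k' - k = 0 := int_eq_zero_of_abs_lt (by push_cast; linarith) (by push_cast; linarith)
    omega
  subst hkk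
  have haa : a ≠ a' := by rintro rfl; exact hnrel (r.refl' _)
  have hbb : b ≠ b' := by rintro rfl; exact hnrel (r.trans' hrel (r.symm' hrel2))
  have hnb : ¬ r b a' := fun h4 => hnrel (r.trans' hrel h4)
  have hnb' : ¬ r b' a := fun h4 => hnrel (r.symm' (r.trans' hrel2 h4))
  have hmono : Monotone fun y : ℝ => (F ^ d) y - k' := fun s t hst => by
    have := (F ^ d).monotone hst; simp only; linarith
  have hself : ∀ {s t : ℝ}, s ≤ (F ^ d) s - k' → (F ^ d) t - k' ≤ t → s ≤ t →
      ∀ i, |(fun y : ℝ => (F ^ d) y - k')^[i] s| ≤ |s| + |t| := by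
    intro s t hs ht hst i
    have h4 : s ≤ (fun y : ℝ => (F ^ d) y - k')^[i] s ∧ (fun y : ℝ => (F ^ d) y - k')^[i] s ≤ t := by
      induction i with
      | zero => exact ⟨le_rfl, hst⟩
      | succ i ih =>
        rw [Function.iterate_succ_apply']
        exact ⟨hs.trans (hmono ih.1), (hmono ih.2).trans ht⟩
    rw [abs_le]
    constructor <;> linarith [le_abs_self s, neg_abs_le s, le_abs_self t, neg_abs_le t, abs_nonneg t, abs_nonneg s]
  rcases lt_or_gt_of_ne haa with h4 | h4 <;> rcases lt_or_gt_of_ne hbb with h5 | h5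
  · refine hr.lamination.unlinked a b a' b' hrel hrel2 hnb ?_ ⟨coe_mem_openArc h4 (by linarith) hb1, ?_⟩
    · intro h6; have := eq_of_coe_eq h6 (by linarith) (by linarith); linarith
    · rw [← coe_add_one' a]; exact coe_mem_openArc h5 (by linarith) (by linarith)
  · obtain ⟨p, hp, hfix⟩ := hlift.exists_fixed_of_bounded hA hmd k' hxA
      (hself (s := a) (t := b) (by linarith) (by linarith) hab.le)
    exact hper p hp _ (by positivity) hfix
  · obtain ⟨p, hp, hfix⟩ := hlift.exists_fixed_of_bounded hA hmd k' hyA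
      (hself (s := b) (t := a + 1) (by linarith)
        (by rw [CircleDeg1Lift.map_add_one]; linarith) hb1)
    exact hper p hp _ (by positivity) hfix
  · refine hr.lamination.unlinked a' b' a b hrel2 hrel hnb' ?_
      ⟨coe_mem_openArc h4 (by linarith) (by linarith), ?_⟩
    · intro h6; have := eq_of_coe_eq h6 (by linarith) (by linarith); linarith
    · rw [← coe_add_one' a']; exact coe_mem_openArc h5 (by linarith) (by linarith)

end Rotation

/-! ### First return maps of strips -/

/-- The expanding map with two branches of slope `K`: the left one fixes `u`, the right one
fixes `v`. -/
noncomputable def retMap (K u v x : ℝ) : ℝ := if x < (u + v) / 2 then u + K * (x - u) else v + K * (x - v)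

/-- The domain of the two branches inside `(u, v)`: the interval without the central strip
`[v - 1/2, u + 1/2]`. -/
def InPieces (u v x : ℝ) : Prop := u < x ∧ x < v ∧ (x < v - 1 / 2 ∨ u + 1 / 2 < x)

/-- The points whose orbit under the return map stays in `[a, b]` and avoids the central strip. -/
def staySet (K u v a b : ℝ) : Set ℝ :=
  {x | ∀ j : ℕ, a ≤ (retMap K u v)^[j] x ∧ (retMap K u v)^[j] x ≤ b ∧
    ((retMap K u v)^[j] x < v - 1 / 2 ∨ u + 1 / 2 < (retMap K u v)^[j] x)}

/-- The setting in which a periodic rotational set is constructed. The chord `u v` with endpoints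
fixed by `dbl^[n]` belongs to a class, it bounds with its translate a strip, the return map of
which is `retMap`, and the major `α β` lies in this strip and crosses it from side to side. For
`n = 1` the strip is the whole disk: `u = 0` and `v = 1`. -/
structure ReturnStrip (r : Setoid UnitAddCircle) (n : ℕ) (K u v α β : ℝ) : Prop where
  quad : IsQuadraticLamination r
  pos : 0 < n
  hK : K = 2 ^ n
  rel : r u v
  len : (v - u) * (K - 1) = K / 2
  int : ∃ m : ℤ, (K - 1) * u = m
  nolink : ∀ c d : ℝ, u < c → c < v → v < d → d < u + 1 → ¬ r c d
  ncls : ∀ t : ℝ, u < t → t < v → ¬ r u t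
  major : IsMajor r α β
  u_lt : u < α
  lt_v : α + 1 / 2 < v
  u_lt' : u + 1 / 2 < β
  lt_v' : β < v
  le_half : β - α ≤ 1 / 2
  disj : ∀ k, 0 < k → k < n → ∀ x y : ℝ, InPieces u v x → u < y → y < v →
    ((2 ^ k * x : ℝ) : UnitAddCircle) ≠ y

namespace ReturnStrip
variable {r : Setoid UnitAddCircle} {n : ℕ} {K u v α β : ℝ}

theorem two_le (h : ReturnStrip r n K u v α β) : 2 ≤ K := by
  rw [h.hK]
  calc (2 : ℝ) = 2 ^ 1 := by norm_num
    _ ≤ 2 ^ n := pow_le_pow_right₀ (by norm_num) h.pos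

theorem len_le (h : ReturnStrip r n K u v α β) : v - u ≤ 1 := by
  nlinarith [h.len, h.two_le]

theorem lt (h : ReturnStrip r n K u v α β) : α < β := by
  linarith [h.len_le, h.lt_v, h.u_lt']

theorem map_left (h : ReturnStrip r n K u v α β) {x : ℝ} (hx : x < v - 1 / 2) :
    retMap K u v x = u + K * (x - u) := by
  unfold retMap; rw [if_pos]; linarith [h.len_le]

theorem map_right (h : ReturnStrip r n K u v α β) {x : ℝ} (hx : u + 1 / 2 < x) :
    retMap K u v x = u + K * (x - 1 / 2 - u) := by
  unfold retMap; rw [if_neg (by linarith [h.len_le])]; linarith [h.len]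

theorem coe_map (h : ReturnStrip r n K u v α β) (x : ℝ) :
    (retMap K u v x : UnitAddCircle) = dbl^[n] (x : UnitAddCircle) := by
  rw [dbl_iterate_coe, ← h.hK, coe_eq_coe_iff_exists_int]
  obtain ⟨m, hm⟩ := h.int
  unfold retMap
  split_ifs
  · exact ⟨-m, by push_cast; linarith⟩
  · refine ⟨-m - 2 ^ (n - 1), ?_⟩
    have h1 : K = 2 * 2 ^ (n - 1) := by
      rw [h.hK, ← pow_succ']; congr 1; have := h.pos; omega
    push_cast
    linarith [h.len]

theorem coe_map_iterate (h : ReturnStrip r n K u v α β) (x : ℝ) (j : ℕ) :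
    ((retMap K u v)^[j] x : UnitAddCircle) = dbl^[n * j] (x : UnitAddCircle) := by
  induction j with
  | zero => rfl
  | succ j ih =>
    rw [Function.iterate_succ_apply', h.coe_map, ih, ← Function.iterate_add_apply, Nat.mul_succ,
      add_comm]

theorem map_mem (h : ReturnStrip r n K u v α β) {x : ℝ} (hx : InPieces u v x) :
    u < retMap K u v x ∧ retMap K u v x < v := by
  obtain ⟨h1, h2, h3 | h3⟩ := hx
  · rw [h.map_left h3]
    constructor <;> nlinarith [h.len, h.two_le]
  · rw [h.map_right h3]
    constructor <;> nlinarith [h.len, h.two_le]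

theorem lt_map (h : ReturnStrip r n K u v α β) {x : ℝ} (h1 : u < x) (h2 : x < v - 1 / 2) :
    x < retMap K u v x := by
  rw [h.map_left h2]; nlinarith [h.two_le]

theorem map_lt (h : ReturnStrip r n K u v α β) {x : ℝ} (h1 : u + 1 / 2 < x) (h2 : x < v) :
    retMap K u v x < x := by
  rw [h.map_right h1]; nlinarith [h.two_le, h.len]

theorem map_ne (h : ReturnStrip r n K u v α β) {x : ℝ} (hx : InPieces u v x) :
    retMap K u v x ≠ x := by
  obtain ⟨h1, h2, h3 | h3⟩ := hx
  · exact (h.lt_map h1 h3).ne'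
  · exact (h.map_lt h3 h2).ne

theorem rel_iff_map (h : ReturnStrip r n K u v α β) {x y : ℝ} (hxy : r x y) :
    r (retMap K u v x : UnitAddCircle) (retMap K u v y : UnitAddCircle) := by
  rw [h.coe_map, h.coe_map]; exact h.quad.rel_iterate hxy n

/-- A class with a point in the two pieces is contained in them. -/
theorem exists_inPieces (h : ReturnStrip r n K u v α β) {x : ℝ} (hx : InPieces u v x)
    {z : UnitAddCircle} (hz : r x z) : ∃ z' : ℝ, InPieces u v z' ∧ (z' : UnitAddCircle) = z := by
  obtain ⟨z, h1, h2, rfl⟩ := exists_coe_Ico u z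
  obtain ⟨hx1, hx2, hx3⟩ := hx
  have hz1 : u < z := lt_of_le_of_ne h1 (by
    rintro rfl; exact h.ncls x hx1 hx2 (r.symm' hz))
  have hz2 : z < v := by
    rcases lt_trichotomy z v with h3 | h3 | h3
    · exact h3
    · subst h3; exact absurd (r.trans' h.rel (r.symm' hz)) (h.ncls x hx1 hx2)
    · exact absurd hz (h.nolink x z hx1 hx2 h3 h2)
  refine ⟨z, ⟨hz1, hz2, ?_⟩, rfl⟩
  by_contra hcon
  simp only [not_or, not_lt] at hcon
  have hz' := h.quad.rel_add_half hz
  have hrel' := h.quad.rel_add_half h.rel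
  rcases hx3 with h3 | h3
  · rcases eq_or_lt_of_le hcon.1 with h4 | h4
    · have e : v = z + 1 / 2 := by linarith
      rw [← e] at hz'
      exact h.ncls (x + 1 / 2) (by linarith) (by linarith) (r.trans' h.rel (r.symm' hz'))
    rcases eq_or_lt_of_le hcon.2 with h5 | h5
    · subst h5
      rw [show u + 1 / 2 + 1 / 2 = u + 1 by ring, coe_add_one'] at hz'
      exact h.ncls (x + 1 / 2) (by linarith) (by linarith) (r.symm' hz')
    · exact h.nolink (x + 1 / 2) (z + 1 / 2) (by linarith) (by linarith) (by linarith)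
        (by linarith) hz'
  · rw [coe_add_half_eq_sub_half x] at hz'
    rcases eq_or_lt_of_le hcon.1 with h4 | h4
    · have e : v = z + 1 / 2 := by linarith
      rw [← e] at hz'
      exact h.ncls (x - 1 / 2) (by linarith) (by linarith) (r.trans' h.rel (r.symm' hz'))
    rcases eq_or_lt_of_le hcon.2 with h5 | h5
    · subst h5
      rw [show u + 1 / 2 + 1 / 2 = u + 1 by ring, coe_add_one'] at hz'
      exact h.ncls (x - 1 / 2) (by linarith) (by linarith) (r.symm' hz')
    · exact h.nolink (x - 1 / 2) (z + 1 / 2) (by linarith) (by linarith) (by linarith)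
        (by linarith) hz'

theorem inPieces_of_rel (h : ReturnStrip r n K u v α β) {x z : ℝ} (hx : InPieces u v x)
    (hz : r x z) (h1 : u < z) (h2 : z < u + 1) : InPieces u v z := by
  obtain ⟨z', hz', he⟩ := h.exists_inPieces hx hz
  have := h.len_le
  have e := eq_of_coe_eq he (by linarith [hz'.1, hz'.2.1]) (by linarith [hz'.1, hz'.2.1])
  rwa [← e]

theorem inPieces_left (h : ReturnStrip r n K u v α β) : InPieces u v α :=
  ⟨h.u_lt, by linarith [h.lt, h.lt_v'], Or.inl (by linarith [h.lt_v])⟩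

theorem inPieces_right (h : ReturnStrip r n K u v α β) : InPieces u v β :=
  ⟨by linarith [h.u_lt'], h.lt_v', Or.inr h.u_lt'⟩

theorem map_alpha (h : ReturnStrip r n K u v α β) : retMap K u v α = u + K * (α - u) :=
  h.map_left (by linarith [h.lt_v])

theorem map_beta (h : ReturnStrip r n K u v α β) : retMap K u v β = u + K * (β - 1 / 2 - u) :=
  h.map_right h.u_lt'

theorem dist_major (h : ReturnStrip r n K u v α β) :
    dist (α : UnitAddCircle) (β : UnitAddCircle) = β - α :=
  dist_coe_of_le h.lt.le (by linarith [h.le_half])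

/-- The translate of the major. -/
theorem isLeaf_translate (h : ReturnStrip r n K u v α β) :
    IsLeaf r ((β - 1 / 2 : ℝ) : UnitAddCircle) ((α + 1 / 2 : ℝ) : UnitAddCircle) := by
  rw [← coe_add_half_eq_sub_half]; exact (h.quad.isLeaf_add_half h.major.1).symm

/-- The image of the major lies under the major. -/
theorem map_major_mem (h : ReturnStrip r n K u v α β) :
    α ≤ retMap K u v β ∧ retMap K u v β ≤ retMap K u v α ∧ retMap K u v α ≤ β := by
  have hK := h.two_le
  have h1 : retMap K u v β ≤ retMap K u v α := by
    rw [h.map_alpha, h.map_beta]; nlinarith [h.le_half]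
  have h2 := h.lt_map h.u_lt (by linarith [h.lt_v])
  have h3 := h.map_lt h.u_lt' h.lt_v'
  have h4 : β - 1 / 2 < retMap K u v β := by
    rw [h.map_beta]; nlinarith [h.u_lt']
  have h5 : retMap K u v α < α + 1 / 2 := by
    rw [h.map_alpha]; nlinarith [h.lt_v, h.len]
  rcases eq_or_lt_of_le h1 with he | hlt
  · rw [he] at h3 ⊢; exact ⟨h2.le, le_rfl, h3.le⟩
  have h6 := h.map_mem h.inPieces_left
  have h7 := h.map_mem h.inPieces_right
  have hlen := h.len_le
  have hrel := h.rel_iff_map h.major.1.rel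
  have hleaf : IsLeaf r (retMap K u v α) (retMap K u v β) := by
    rw [h.coe_map, h.coe_map]
    refine h.quad.isLeaf_iterate h.major.1 n fun he => ?_
    rw [← h.coe_map, ← h.coe_map] at he
    have := eq_of_coe_eq he (by linarith) (by linarith); linarith
  have hle := h.le_half
  have h8 : ¬ (retMap K u v β < α) ∨ β ≤ retMap K u v α := by
    by_contra hcon
    simp only [not_or, not_not, not_le] at hcon
    have hrel' := hrel
    rw [← coe_add_one' (retMap K u v β)] at hrel'
    exact h.quad.lamination.leaf_pair_coe h.major.1 hrel' h2 hcon.2 (by linarith) (by linarith)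
  have h9 : retMap K u v β ≤ α ∨ ¬ (β < retMap K u v α) := by
    by_contra hcon
    simp only [not_or, not_not, not_le] at hcon
    exact h.quad.lamination.leaf_pair_coe h.major.1 (r.symm' hrel) hcon.1 h3 hcon.2 (by linarith)
  by_contra hcon
  have h10 : retMap K u v β ≤ α ∧ β ≤ retMap K u v α ∧
      β - α < retMap K u v α - retMap K u v β := by
    by_cases ha : retMap K u v β < α
    · have hb := h8.resolve_left (not_not.2 ha)
      exact ⟨ha.le, hb, by linarith⟩
    · push Not at ha
      have hb : β < retMap K u v α := by
        by_contra hb; exact hcon ⟨ha, h1, not_lt.1 hb⟩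
      have hc := h9.resolve_right (not_not.2 hb)
      exact ⟨hc, hb.le, by linarith⟩
  have hd := h.major.2 _ _ hleaf.symm
  rw [h.dist_major] at hd
  rcases le_total (retMap K u v α) (retMap K u v β + 1 / 2) with h11 | h11
  · rw [dist_coe_of_le h1 h11] at hd; linarith [h10.2.2]
  · rw [dist_coe_of_ge h11 (by linarith)] at hd; linarith

/-- The images of the major are leaves that are not too short. -/
theorem dist_iterate_major (h : ReturnStrip r n K u v α β) (hw : β - α < 1 / 2) (m : ℕ) :
    IsLeaf r (dbl^[m + 1] (α : UnitAddCircle)) (dbl^[m + 1] (β : UnitAddCircle)) ∧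
      1 - 2 * (β - α) ≤ dist (dbl^[m + 1] (α : UnitAddCircle)) (dbl^[m + 1] (β : UnitAddCircle)) := by
  have h0 := h.dist_major
  have h3 := h.quad.third_le_of_isMajor h.major
  have step : ∀ a b : UnitAddCircle, IsLeaf r a b → 1 / 2 - (β - α) ≤ dist a b →
      1 - 2 * (β - α) ≤ dist (dbl a) (dbl b) := by
    intro a b hab hd
    have hmax := h.major.2 a b hab
    rcases le_total (dist a b) (1 / 4) with h1 | h1
    · rw [dist_dbl_of_le h1]; linarith
    · rw [dist_dbl_of_ge h1]; linarith
  induction m with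
  | zero =>
    have := step _ _ h.major.1 (by rw [h0]; linarith)
    exact ⟨h.quad.isLeaf_dbl h.major.1 (dist_pos.1 (by linarith)), this⟩
  | succ m ih =>
    have := step _ _ ih.1 (by linarith [ih.2])
    rw [Function.iterate_succ_apply' _ (m + 1), Function.iterate_succ_apply' _ (m + 1)]
    exact ⟨h.quad.isLeaf_dbl ih.1 (dist_pos.1 (by linarith)), this⟩

theorem map_sub (h : ReturnStrip r n K u v α β) {x y : ℝ} (hx : InPieces u v x)
    (hy : InPieces u v y) (h1 : x - y < 1 / 2) (h2 : y - x < 1 / 2) :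
    ∃ μ : ℝ, 0 < μ ∧ retMap K u v x - retMap K u v y =
      (if x < v - 1 / 2 then 1 else -1) * (if y < v - 1 / 2 then 1 else -1) * μ * (x - y) := by
  have hK := h.two_le
  have hlen := h.len_le
  rcases hx.2.2 with hx3 | hx3 <;> rcases hy.2.2 with hy3 | hy3
  · refine ⟨K, by linarith, ?_⟩
    rw [h.map_left hx3, h.map_left hy3, if_pos hx3, if_pos hy3]; ring
  · refine ⟨K * ((1 / 2 - (y - x)) / (y - x)), ?_, ?_⟩
    · have : 0 < y - x := by linarith
      exact mul_pos (by linarith) (div_pos (by linarith) this)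
    · rw [h.map_left hx3, h.map_right hy3, if_pos hx3, if_neg (by linarith)]
      have : y - x ≠ 0 := by linarith
      field_simp; ring
  · refine ⟨K * ((1 / 2 - (x - y)) / (x - y)), ?_, ?_⟩
    · have : 0 < x - y := by linarith
      exact mul_pos (by linarith) (div_pos (by linarith) this)
    · rw [h.map_right hx3, h.map_left hy3, if_neg (by linarith), if_pos hy3]
      have : x - y ≠ 0 := by linarith
      field_simp; ring
  · refine ⟨K, by linarith, ?_⟩
    rw [h.map_right hx3, h.map_right hy3, if_neg (by linarith), if_neg (by linarith)]; ring

/-- The return map preserves the separation of pairs of points at mutual distance less than a half. -/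
theorem map_separates (h : ReturnStrip r n K u v α β) {x y c d : ℝ} (hx : InPieces u v x)
    (hy : InPieces u v y) (hc : InPieces u v c) (hd : InPieces u v d)
    (hxc : |x - c| < 1 / 2) (hxd : |x - d| < 1 / 2) (hyc : |y - c| < 1 / 2) (hyd : |y - d| < 1 / 2)
    (hsep : (x - c) * (x - d) * ((y - c) * (y - d)) < 0) :
    (retMap K u v x - retMap K u v c) * (retMap K u v x - retMap K u v d) *
      ((retMap K u v y - retMap K u v c) * (retMap K u v y - retMap K u v d)) < 0 := by
  rw [abs_lt] at hxc hxd hyc hyd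
  obtain ⟨m1, hm1, e1⟩ := h.map_sub hx hc (by linarith) (by linarith)
  obtain ⟨m2, hm2, e2⟩ := h.map_sub hx hd (by linarith) (by linarith)
  obtain ⟨m3, hm3, e3⟩ := h.map_sub hy hc (by linarith) (by linarith)
  obtain ⟨m4, hm4, e4⟩ := h.map_sub hy hd (by linarith) (by linarith)
  rw [e1, e2, e3, e4]
  have hsq : ∀ t : ℝ, (if t < v - 1 / 2 then (1 : ℝ) else -1) * (if t < v - 1 / 2 then 1 else -1) = 1 := by
    intro t; split_ifs <;> norm_num
  have hx2 := hsq x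
  have hy2 := hsq y
  have hc2 := hsq c
  have hd2 := hsq d
  generalize (if x < v - 1 / 2 then (1 : ℝ) else -1) = ex at *
  generalize (if y < v - 1 / 2 then (1 : ℝ) else -1) = ey at *
  generalize (if c < v - 1 / 2 then (1 : ℝ) else -1) = ec at *
  generalize (if d < v - 1 / 2 then (1 : ℝ) else -1) = ed at *
  have : ex * ec * m1 * (x - c) * (ex * ed * m2 * (x - d)) *
      (ey * ec * m3 * (y - c) * (ey * ed * m4 * (y - d))) =
      (ex * ex) * (ey * ey) * (ec * ec) * (ed * ed) * (m1 * m2 * m3 * m4) *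
        ((x - c) * (x - d) * ((y - c) * (y - d))) := by ring
  rw [this, hx2, hy2, hc2, hd2]
  exact mul_neg_of_pos_of_neg (by positivity) hsep

/-- A class pair that separates two points outside of the central strip avoids this strip. -/
theorem inPieces_of_separates (h : ReturnStrip r n K u v α β) {x y c d : ℝ} (hx : InPieces u v x)
    (hy : InPieces u v y) (hcd : r c d) (hc1 : u < c) (hc2 : c < v) (hd1 : u < d) (hd2 : d < v)
    (hsep : (x - c) * (x - d) * ((y - c) * (y - d)) < 0) : InPieces u v c ∧ InPieces u v d := by
  have hlen := h.len_le
  by_cases hc : InPieces u v c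
  · exact ⟨hc, h.inPieces_of_rel hc hcd hd1 (by linarith)⟩
  by_cases hd : InPieces u v d
  · exact ⟨h.inPieces_of_rel hd (r.symm' hcd) hc1 (by linarith), hd⟩
  exfalso
  have hc' : v - 1 / 2 ≤ c ∧ c ≤ u + 1 / 2 := by
    constructor <;> by_contra h'
    · exact hc ⟨hc1, hc2, Or.inl (by linarith)⟩
    · exact hc ⟨hc1, hc2, Or.inr (by linarith)⟩
  have hd' : v - 1 / 2 ≤ d ∧ d ≤ u + 1 / 2 := by
    constructor <;> by_contra h'
    · exact hd ⟨hd1, hd2, Or.inl (by linarith)⟩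
    · exact hd ⟨hd1, hd2, Or.inr (by linarith)⟩
  have h1 : ∀ z, InPieces u v z → 0 < (z - c) * (z - d) := by
    intro z hz
    rcases hz.2.2 with h2 | h2
    · exact mul_pos_of_neg_of_neg (by linarith) (by linarith)
    · exact mul_pos (by linarith) (by linarith)
  have := mul_pos (h1 x hx) (h1 y hy)
  linarith

/-- A leaf that separates two points between the midpoints of the two strips bounded by the major
and its translate, and that is not too short, lies under the major. -/
theorem mem_of_separates (h : ReturnStrip r n K u v α β) (hw : β - α < 1 / 2) {x y c d : ℝ}
    (hx : (β - 1 / 2 + α) / 2 ≤ x ∧ x ≤ (β + α + 1 / 2) / 2)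
    (hy : (β - 1 / 2 + α) / 2 ≤ y ∧ y ≤ (β + α + 1 / 2) / 2)
    (hcd : IsLeaf r c d) (hdist : 1 - 2 * (β - α) ≤ dist (c : UnitAddCircle) d)
    (hc1 : u < c) (hc2 : c < v) (hd1 : u < d) (hd2 : d < v)
    (hsep : (x - c) * (x - d) * ((y - c) * (y - d)) < 0) :
    α ≤ c ∧ c ≤ β ∧ α ≤ d ∧ d ≤ β := by
  have hlen := h.len_le
  have hl := h.quad.lamination
  wlog hlt : c < d generalizing c d
  · have hne : c ≠ d := fun he => hcd.1 (by rw [he])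
    have := this hcd.symm (by rwa [dist_comm]) hd1 hd2 hc1 hc2 (by linarith)
      (lt_of_le_of_ne (not_lt.1 hlt) hne.symm)
    tauto
  have hmax := h.major.2 _ _ hcd
  rw [h.dist_major] at hmax
  have h1 := h.u_lt
  have h2 := h.lt_v
  have h3 := h.u_lt'
  have h4 := h.lt_v'
  have h5 := h.lt
  -- the chord is linked neither with the major nor with its translate
  have n1 : ¬ (α < c ∧ c < β ∧ β < d) := fun ⟨a1, a2, a3⟩ =>
    hl.leaf_pair_coe h.major.1 hcd.rel a1 a2 a3 (by linarith)
  have n2 : ¬ (α < d ∧ d < β ∧ c < α) := fun ⟨a1, a2, a3⟩ => by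
    have := hcd.symm.rel
    rw [← coe_add_one' c] at this
    exact hl.leaf_pair_coe h.major.1 this a1 a2 (by linarith) (by linarith)
  have n3 : ¬ (β - 1 / 2 < c ∧ c < α + 1 / 2 ∧ α + 1 / 2 < d) := fun ⟨a1, a2, a3⟩ =>
    hl.leaf_pair_coe h.isLeaf_translate hcd.rel a1 a2 a3 (by linarith)
  have n4 : ¬ (β - 1 / 2 < d ∧ d < α + 1 / 2 ∧ c < β - 1 / 2) := fun ⟨a1, a2, a3⟩ => by
    have := hcd.symm.rel
    rw [← coe_add_one' c] at this
    exact hl.leaf_pair_coe h.isLeaf_translate this a1 a2 (by linarith) (by linarith)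
  have hl1 : d - c ≤ 1 / 2 → 1 - 2 * (β - α) ≤ d - c ∧ d - c ≤ β - α := fun h6 => by
    rw [dist_coe_of_le hlt.le (by linarith)] at hdist hmax; exact ⟨hdist, hmax⟩
  have hl2 : 1 / 2 ≤ d - c → 1 - (d - c) ≤ β - α := fun h6 => by
    rw [dist_coe_of_ge (by linarith) (by linarith)] at hmax; exact hmax
  -- a chord that leaves the region under the translate of the major does not separate
  have hin : β - 1 / 2 < d ∧ c < α + 1 / 2 ∧ (β - 1 / 2 < c ∨ d < α + 1 / 2) := by
    refine ⟨?_, ?_, ?_⟩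
    · by_contra h6
      have : ∀ z, (β - 1 / 2 + α) / 2 ≤ z → 0 < (z - c) * (z - d) := fun z hz =>
        mul_pos (by linarith) (by linarith)
      linarith [mul_pos (this x hx.1) (this y hy.1)]
    · by_contra h6
      have : ∀ z, z ≤ (β + α + 1 / 2) / 2 → 0 < (z - c) * (z - d) := fun z hz =>
        mul_pos_of_neg_of_neg (by linarith) (by linarith)
      linarith [mul_pos (this x hx.2) (this y hy.2)]
    · by_contra h6
      simp only [not_or, not_lt] at h6
      have : ∀ z, (β - 1 / 2 + α) / 2 ≤ z ∧ z ≤ (β + α + 1 / 2) / 2 → (z - c) * (z - d) < 0 :=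
        fun z hz => mul_neg_of_pos_of_neg (by linarith [hz.1]) (by linarith [hz.2])
      linarith [mul_pos_of_neg_of_neg (this x hx) (this y hy)]
  obtain ⟨i1, i2, i3⟩ := hin
  have hc3 : β - 1 / 2 ≤ c := by
    by_contra h6
    rcases i3 with h7 | h7
    · linarith
    · exact n4 ⟨i1, h7, by linarith⟩
  have hd3 : d ≤ α + 1 / 2 := by
    by_contra h6
    rcases i3 with h7 | h7
    · exact n3 ⟨h7, i2, by linarith⟩
    · linarith
  have hca : α ≤ c := by
    by_contra h6
    push Not at h6
    rcases le_or_gt d α with h7 | h7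
    · have := hl1 (by linarith); linarith
    · have h8 : β ≤ d := by by_contra h8; exact n2 ⟨h7, by linarith, h6⟩
      rcases le_total (d - c) (1 / 2) with h9 | h9
      · have := hl1 h9; linarith
      · have := hl2 h9
        -- the chord is the translate of the major
        have e1 : c = β - 1 / 2 := by linarith
        have e2 : d = α + 1 / 2 := by linarith
        rcases i3 with h10 | h10 <;> linarith
  have hdb : d ≤ β := by
    by_contra h6
    push Not at h6
    rcases le_or_gt β c with h7 | h7
    · have := hl1 (by linarith); linarith
    · have h8 : c ≤ α := by by_contra h8; exact n1 ⟨by linarith, h7, h6⟩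
      have : c = α := le_antisymm h8 hca
      rcases le_total (d - c) (1 / 2) with h9 | h9
      · have := hl1 h9; linarith
      · have := hl2 h9; linarith
  exact ⟨hca, by linarith, by linarith, hdb⟩

end ReturnStrip

namespace ReturnStrip
variable {r : Setoid UnitAddCircle} {n : ℕ} {K u v α β : ℝ}

theorem mem_staySet_of_invariant {a b : ℝ} {S : Set ℝ} (hS : ∀ x ∈ S, a ≤ x ∧ x ≤ b ∧
    (x < v - 1 / 2 ∨ u + 1 / 2 < x) ∧ retMap K u v x ∈ S) : S ⊆ staySet K u v a b := by
  intro x hx j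
  have : (retMap K u v)^[j] x ∈ S := by
    induction j with
    | zero => exact hx
    | succ j ih => rw [Function.iterate_succ_apply']; exact (hS _ ih).2.2.2
  exact ⟨(hS _ this).1, (hS _ this).2.1, (hS _ this).2.2.1⟩

theorem map_mem_staySet {a b x : ℝ} (hx : x ∈ staySet K u v a b) :
    retMap K u v x ∈ staySet K u v a b := fun j => hx (j + 1)

theorem iterate_mem_staySet {a b x : ℝ} (hx : x ∈ staySet K u v a b) (i : ℕ) :
    (retMap K u v)^[i] x ∈ staySet K u v a b := fun j => by
  rw [← Function.iterate_add_apply]; exact hx (j + i)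

theorem inPieces_of_mem {a b x : ℝ} (ha : u < a) (hb : b < v)
    (hx : x ∈ staySet K u v a b) : InPieces u v x :=
  ⟨lt_of_lt_of_le ha (hx 0).1, lt_of_le_of_lt (hx 0).2.1 hb, (hx 0).2.2⟩

/-- Between the midpoints of the two strips bounded by the major and its translate both branches
together are onto, so some point stays there for ever. -/
theorem staySet_mid_nonempty (h : ReturnStrip r n K u v α β) :
    (staySet K u v ((β - 1 / 2 + α) / 2) ((β + α + 1 / 2) / 2)).Nonempty := by
  have hK := h.two_le
  have hK0 : 0 < K := by linarith
  have hlen := h.len_le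
  have hl := h.len
  obtain ⟨m1, m2, m3⟩ := h.map_major_mem
  rw [h.map_alpha] at m2 m3
  rw [h.map_beta] at m1 m2
  have q1 := h.u_lt
  have q2 := h.lt_v
  have q3 := h.u_lt'
  have q4 := h.lt_v'
  have q5 := h.le_half
  obtain ⟨a, ha⟩ : ∃ a, a = (β - 1 / 2 + α) / 2 := ⟨_, rfl⟩
  obtain ⟨b, hb⟩ : ∃ b, b = (β + α + 1 / 2) / 2 := ⟨_, rfl⟩
  rw [← ha, ← hb]
  have hab : b = a + 1 / 2 := by linarith
  have hm1 : a ≤ u + K * (a - u) := by rw [ha]; nlinarith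
  have hm2 : u + K * (a - u) ≤ b := by rw [hb, ha]; nlinarith
  let c₀ : ℝ := u + (b - u) / K
  let d₀ : ℝ := u + 1 / 2 + (a - u) / K
  have hc₀ : K * (c₀ - u) = b - u := by simp only [c₀]; field_simp; ring
  have hd₀ : K * (d₀ - 1 / 2 - u) = a - u := by simp only [d₀]; field_simp; ring
  have hac : a ≤ c₀ := by
    have : K * (a - u) ≤ K * (c₀ - u) := by linarith
    linarith [le_of_mul_le_mul_left this hK0]
  have hdb : d₀ ≤ b := by
    have : K * (d₀ - 1 / 2 - u) ≤ K * (a - u) := by linarith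
    linarith [le_of_mul_le_mul_left this hK0]
  have hcv : c₀ < v - 1 / 2 := by
    have : K * (c₀ - u) < K * (v - 1 / 2 - u) := by linarith
    linarith [lt_of_mul_lt_mul_left this hK0.le]
  have hdu : u + 1 / 2 < d₀ := by
    have : K * 0 < K * (d₀ - 1 / 2 - u) := by linarith
    linarith [lt_of_mul_lt_mul_left this hK0.le]
  let S : ℕ → Set ℝ := fun k => Nat.rec (Icc a b) (fun _ T =>
    (Icc a c₀ ∩ (fun x => u + K * (x - u)) ⁻¹' T) ∪
      (Icc d₀ b ∩ (fun x => u + K * (x - 1 / 2 - u)) ⁻¹' T)) k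
  have hS : ∀ k, S (k + 1) = (Icc a c₀ ∩ (fun x => u + K * (x - u)) ⁻¹' S k) ∪
      (Icc d₀ b ∩ (fun x => u + K * (x - 1 / 2 - u)) ⁻¹' S k) := fun k => rfl
  have hclosed : ∀ k, IsClosed (S k) := fun k => by
    induction k with
    | zero => exact isClosed_Icc
    | succ k ih =>
      rw [hS]
      exact (isClosed_Icc.inter (ih.preimage (by fun_prop))).union
        (isClosed_Icc.inter (ih.preimage (by fun_prop)))
  have hanti : ∀ k, S (k + 1) ⊆ S k := fun k => by
    induction k with
    | zero =>
      rintro x (⟨hx, -⟩ | ⟨hx, -⟩)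
      · exact ⟨hx.1, by linarith [hx.2]⟩
      · exact ⟨by linarith [hx.1], hx.2⟩
    | succ k ih =>
      rw [hS (k + 1), hS k]
      exact union_subset_union (inter_subset_inter_right _ (preimage_mono ih))
        (inter_subset_inter_right _ (preimage_mono ih))
  have hsub : ∀ k, S k ⊆ Icc a b := fun k => by
    induction k with
    | zero => exact le_rfl
    | succ k ih => exact (hanti k).trans ih
  have hne : ∀ k, (S k).Nonempty := fun k => by
    induction k with
    | zero => exact ⟨a, le_rfl, by linarith⟩
    | succ k ih =>
      obtain ⟨y, hy⟩ := ih
      obtain ⟨hy1, hy2⟩ := hsub k hy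
      have e : K * ((y - u) / K) = y - u := by field_simp
      rcases le_total (u + K * (a - u)) y with h1 | h1
      · refine ⟨u + (y - u) / K, Or.inl ⟨⟨?_, ?_⟩, ?_⟩⟩
        · have : K * (a - u) ≤ K * ((y - u) / K) := by linarith
          linarith [le_of_mul_le_mul_left this hK0]
        · have : K * ((y - u) / K) ≤ K * (c₀ - u) := by linarith
          linarith [le_of_mul_le_mul_left this hK0]
        · have : u + K * (u + (y - u) / K - u) = y := by linarith
          simpa only [mem_preimage, this] using hy
      · refine ⟨u + 1 / 2 + (y - u) / K, Or.inr ⟨⟨?_, ?_⟩, ?_⟩⟩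
        · have : K * (d₀ - 1 / 2 - u) ≤ K * ((y - u) / K) := by linarith
          linarith [le_of_mul_le_mul_left this hK0]
        · have : K * ((y - u) / K) ≤ K * (a - u) := by linarith
          linarith [le_of_mul_le_mul_left this hK0]
        · have : u + K * (u + 1 / 2 + (y - u) / K - 1 / 2 - u) = y := by linarith
          simpa only [mem_preimage, this] using hy
  obtain ⟨x, hx⟩ := IsCompact.nonempty_iInter_of_sequence_nonempty_isCompact_isClosed S hanti hne
    isCompact_Icc hclosed
  refine ⟨x, mem_staySet_of_invariant (S := ⋂ k, S k) ?_ hx⟩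
  intro x hx
  rw [mem_iInter] at hx
  have h0 := hx 0
  refine ⟨h0.1, h0.2, ?_⟩
  rcases hx 1 with h1 | h1
  · have hlt : x < v - 1 / 2 := by linarith [h1.1.2]
    refine ⟨Or.inl hlt, mem_iInter.2 fun k => ?_⟩
    rw [h.map_left hlt]
    rcases hx (k + 1) with h2 | h2
    · exact h2.2
    · linarith [h2.1.1]
  · have hlt : u + 1 / 2 < x := by linarith [h1.1.1]
    refine ⟨Or.inr hlt, mem_iInter.2 fun k => ?_⟩
    rw [h.map_right hlt]
    rcases hx (k + 1) with h2 | h2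
    · linarith [h2.1.2]
    · exact h2.2

/-- Some point stays under the major for ever. If an orbit between the midpoints leaves this region,
then it returns under the image of the major; from then on the images of the major separate
consecutive points of the orbit, so it is the endpoints of the image of the major that stay. -/
theorem staySet_nonempty (h : ReturnStrip r n K u v α β) : (staySet K u v α β).Nonempty := by
  obtain ⟨x, hx⟩ := h.staySet_mid_nonempty
  have hK := h.two_le
  have hlen := h.len_le
  have q1 := h.u_lt
  have q2 := h.lt_v
  have q3 := h.u_lt'
  have q4 := h.lt_v'
  have q5 := h.le_half
  by_cases hstay : ∀ j, α ≤ (retMap K u v)^[j] x ∧ (retMap K u v)^[j] x ≤ β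
  · exact ⟨x, fun j => ⟨(hstay j).1, (hstay j).2, (hx j).2.2⟩⟩
  push Not at hstay
  obtain ⟨i, hi⟩ := hstay
  have hy := iterate_mem_staySet hx i
  generalize (retMap K u v)^[i] x = y at hi hy
  have hout : y < α ∨ β < y := by
    by_contra hcon
    push Not at hcon
    exact absurd (hi hcon.1) (not_lt.2 hcon.2)
  have hy0 := hy 0
  simp only [Function.iterate_zero, id] at hy0
  obtain ⟨y1, y2, y3⟩ := hy0
  have hw : β - α < 1 / 2 := by rcases hout with h1 | h1 <;> linarith
  obtain ⟨m1, m2, m3⟩ := h.map_major_mem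
  have hy' : retMap K u v β < retMap K u v y ∧ retMap K u v y < retMap K u v α := by
    rw [h.map_alpha, h.map_beta]
    rcases hout with h1 | h1
    · rw [h.map_left (by linarith)]; constructor <;> nlinarith
    · rw [h.map_right (by linarith)]; constructor <;> nlinarith
  refine ⟨retMap K u v β, ?_⟩
  -- the endpoints of the images of the major separate the points of the orbit from their images
  have main : ∀ j : ℕ, (α ≤ (retMap K u v)^[j + 1] β ∧ (retMap K u v)^[j + 1] β ≤ β ∧
      α ≤ (retMap K u v)^[j + 1] α ∧ (retMap K u v)^[j + 1] α ≤ β) ∧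
      InPieces u v ((retMap K u v)^[j + 1] β) ∧ InPieces u v ((retMap K u v)^[j + 1] α) ∧
      ((retMap K u v)^[j + 1] y - (retMap K u v)^[j + 1] β) *
        ((retMap K u v)^[j + 1] y - (retMap K u v)^[j + 1] α) *
        (((retMap K u v)^[j] y - (retMap K u v)^[j + 1] β) *
        ((retMap K u v)^[j] y - (retMap K u v)^[j + 1] α)) < 0 := by
    intro j
    have hrel : r ((retMap K u v)^[j + 1] β : UnitAddCircle) ((retMap K u v)^[j + 1] α : UnitAddCircle) := by
      rw [h.coe_map_iterate, h.coe_map_iterate]; exact h.quad.rel_iterate (r.symm' h.major.1.rel) _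
    have hpc := fun j => inPieces_of_mem (by linarith) (by linarith) (iterate_mem_staySet hy j)
    have hyj := hy j
    have hyj1 := hy (j + 1)
    induction j with
    | zero =>
      simp only [zero_add, Function.iterate_one, Function.iterate_zero, id] at *
      have hs : (retMap K u v y - retMap K u v β) * (retMap K u v y - retMap K u v α) *
          ((y - retMap K u v β) * (y - retMap K u v α)) < 0 := by
        refine mul_neg_of_neg_of_pos (mul_neg_of_pos_of_neg (by linarith) (by linarith)) ?_
        rcases hout with h1 | h1
        · exact mul_pos_of_neg_of_neg (by linarith) (by linarith)
        · exact mul_pos (by linarith) (by linarith)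
      have := h.inPieces_of_separates (hpc 1) (hpc 0) hrel (by linarith) (by linarith) (by linarith)
        (by linarith) (by simpa using hs)
      exact ⟨⟨m1, by linarith, by linarith, m3⟩, this.1, this.2, hs⟩
    | succ j ih =>
      obtain ⟨⟨a1, a2, a3, a4⟩, p1, p2, hs⟩ := ih (by
        rw [h.coe_map_iterate, h.coe_map_iterate]
        exact h.quad.rel_iterate (r.symm' h.major.1.rel) _) (hy j) (hy (j + 1))
      obtain ⟨z1, z2, z3⟩ := hy j
      obtain ⟨z4, z5, z6⟩ := hy (j + 1)
      have hs' := h.map_separates (hpc (j + 1)) (hpc j) p1 p2 (by rw [abs_lt]; constructor <;> linarith)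
        (by rw [abs_lt]; constructor <;> linarith) (by rw [abs_lt]; constructor <;> linarith)
        (by rw [abs_lt]; constructor <;> linarith) hs
      simp only [← Function.iterate_succ_apply' (retMap K u v)] at hs'
      have b1 := h.map_mem p1
      have b2 := h.map_mem p2
      simp only [← Function.iterate_succ_apply' (retMap K u v)] at b1 b2
      have hleaf := h.dist_iterate_major hw (n * (j + 1 + 1) - 1)
      rw [Nat.sub_add_cancel (by have := h.pos; nlinarith), ← h.coe_map_iterate, ← h.coe_map_iterate] at hleaf
      have hin := h.mem_of_separates hw ⟨hyj1.1, hyj1.2.1⟩ ⟨hyj.1, hyj.2.1⟩ hleaf.1.symm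
        (by rw [dist_comm]; exact hleaf.2) b1.1 b1.2 b2.1 b2.2 hs'
      have hin2 := h.inPieces_of_separates (hpc (j + 1 + 1)) (hpc (j + 1)) hrel b1.1 b1.2 b2.1 b2.2 hs'
      exact ⟨hin, hin2.1, hin2.2, hs'⟩
  intro j
  have := main j
  rw [Function.iterate_succ_apply] at this
  exact ⟨this.1.1, this.1.2.1, this.2.1.2.2⟩

theorem eq_left_of_mem (h : ReturnStrip r n K u v α β) {y : ℝ} (h1 : α ≤ y) (h2 : y + 1 / 2 ≤ β) :
    y = α ∧ β = α + 1 / 2 := by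
  have := h.le_half
  constructor <;> linarith

/-- Under the major, equivalences can be pulled back along the return map. -/
theorem rel_of_map (h : ReturnStrip r n K u v α β) {x y : ℝ} (hx : InPieces u v x)
    (hy : InPieces u v y) (hx1 : α ≤ x) (hx2 : x ≤ β) (hy1 : α ≤ y) (hy2 : y ≤ β)
    (hxy : r (retMap K u v x : UnitAddCircle) (retMap K u v y : UnitAddCircle)) : r x y := by
  have hlen := h.len_le
  have q1 := h.u_lt
  have q2 := h.lt_v
  have q3 := h.u_lt'
  have q4 := h.lt_v'
  have q5 := h.le_half
  have hM := h.major.1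
  have hl := h.quad.lamination
  obtain ⟨z, hz, hzy⟩ : ∃ z, r x z ∧ dbl^[n] z = dbl^[n] (y : UnitAddCircle) := by
    have : dbl^[n] (y : UnitAddCircle) ∈ dbl^[n] '' lamClass r x := by
      rw [h.quad.image_iterate, ← h.coe_map, ← h.coe_map]; exact hxy
    exact this
  obtain ⟨z, hzp, rfl⟩ := h.exists_inPieces hx hz
  rw [← h.coe_map, ← h.coe_map] at hzy
  have b1 := h.map_mem hzp
  have b2 := h.map_mem hy
  have he := eq_of_coe_eq hzy (by linarith) (by linarith)
  have hK0 : K ≠ 0 := by linarith [h.two_le]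
  -- the case distinction is whether `z` is `y` or its translate
  have hcase : z = y ∨ (y < v - 1 / 2 ∧ z = y + 1 / 2) ∨ (u + 1 / 2 < y ∧ z = y - 1 / 2) := by
    rcases hzp.2.2 with h1 | h1 <;> rcases hy.2.2 with h2 | h2
    · left; rw [h.map_left h1, h.map_left h2] at he
      have := mul_left_cancel₀ hK0 (add_left_cancel he); linarith
    · right; right; rw [h.map_left h1, h.map_right h2] at he
      have := mul_left_cancel₀ hK0 (add_left_cancel he); exact ⟨h2, by linarith⟩
    · right; left; rw [h.map_right h1, h.map_left h2] at he
      have := mul_left_cancel₀ hK0 (add_left_cancel he); exact ⟨h2, by linarith⟩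
    · left; rw [h.map_right h1, h.map_right h2] at he
      have := mul_left_cancel₀ hK0 (add_left_cancel he); linarith
  have hclass : β = α + 1 / 2 → ∀ t : ℝ, r α t → α < t → t < α + 1 → t = β := by
    intro hb t ht h1 h2
    have hM' := hM
    rw [hb] at hM'
    have : (t : UnitAddCircle) ∈ lamClass r α := ht
    rw [h.quad.lamClass_diameter hM'] at this
    rcases this with h3 | h3
    · have := eq_of_coe_eq h3 (by linarith) (by linarith); linarith
    · rw [hb]; exact eq_of_coe_eq h3 (by linarith) (by linarith)
  rcases hcase with rfl | ⟨h1, rfl⟩ | ⟨h1, rfl⟩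
  · exact hz
  · have h2 : β ≤ y + 1 / 2 := by linarith
    rcases eq_or_lt_of_le h2 with h3 | h3
    · have := h.eq_left_of_mem hy1 h3.ge
      rw [this.1, ← this.2] at hz
      rw [this.1]; exact r.trans' hz (r.symm' hM.rel)
    by_cases hint : α < x ∧ x < β
    · exact (hl.leaf_pair_coe hM hz hint.1 hint.2 h3 (by linarith)).elim
    have hxα : r x α := by
      rcases eq_or_lt_of_le hx1 with h4 | h4
      · rw [h4]
      · have : x = β := by by_contra h5; exact hint ⟨h4, lt_of_le_of_ne hx2 h5⟩
        rw [this]; exact r.symm' hM.rel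
    rcases eq_or_lt_of_le hy1 with h4 | h4
    · rwa [← h4]
    have hαz := r.trans' (r.symm' hxα) hz
    exfalso
    rcases eq_or_lt_of_le q5 with h5 | h5
    · have := hclass (by linarith) _ hαz (by linarith) (by linarith)
      linarith
    · exact hl.leaf_pair_coe h.isLeaf_translate hαz (by linarith) (by linarith) (by linarith)
        (by linarith)
  · have h2 : y - 1 / 2 ≤ α := by linarith
    rcases eq_or_lt_of_le h2 with h3 | h3
    · have e1 : y = β := by linarith
      rw [h3] at hz
      rw [e1]; exact r.trans' hz hM.rel
    have hz1 := hz
    rw [← coe_add_one' (y - 1 / 2)] at hz1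
    by_cases hint : α < x ∧ x < β
    · exact (hl.leaf_pair_coe hM hz1 hint.1 hint.2 (by linarith) (by linarith)).elim
    have hxβ : r x β := by
      rcases eq_or_lt_of_le hx1 with h4 | h4
      · rw [← h4]; exact hM.rel
      · have : x = β := by by_contra h5; exact hint ⟨h4, lt_of_le_of_ne hx2 h5⟩
        rw [this]
    rcases eq_or_lt_of_le hy2 with h4 | h4
    · rwa [h4]
    have hβz := r.trans' (r.symm' hxβ) hz1
    exfalso
    rcases eq_or_lt_of_le q5 with h5 | h5
    · have := hclass (by linarith) _ (r.trans' hM.rel hβz) (by linarith) (by linarith)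
      linarith
    · exact hl.leaf_pair_coe h.isLeaf_translate hβz (by linarith) (by linarith) (by linarith)
        (by linarith)

theorem continuousAt_map (h : ReturnStrip r n K u v α β) {x : ℝ}
    (hx : x < v - 1 / 2 ∨ u + 1 / 2 < x) : ContinuousAt (retMap K u v) x := by
  rcases hx with hx | hx
  · have : ContinuousAt (fun x => u + K * (x - u)) x := by fun_prop
    refine this.congr ?_
    filter_upwards [Iio_mem_nhds hx] with y hy
    exact (h.map_left hy).symm
  · have : ContinuousAt (fun x => u + K * (x - 1 / 2 - u)) x := by fun_prop
    refine this.congr ?_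
    filter_upwards [Ioi_mem_nhds hx] with y hy
    exact (h.map_right hy).symm

theorem isCompact_staySet (h : ReturnStrip r n K u v α β) : IsCompact (staySet K u v α β) := by
  have hK0 : 0 < K := by linarith [h.two_le]
  have q1 := h.u_lt
  have q4 := h.lt_v'
  have hl := h.len
  -- the set keeps a distance from the strip
  have hC : staySet K u v α β ⊆ Icc α β ∩ ({x | u + K * (x - u) ≤ β} ∪
      {x | α ≤ u + K * (x - 1 / 2 - u)}) := by
    intro x hx
    refine ⟨⟨(hx 0).1, (hx 0).2.1⟩, ?_⟩
    have h1 := hx 1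
    have h0 := (hx 0).2.2
    simp only [Function.iterate_one, Function.iterate_zero, id] at h1 h0
    simp only [mem_union, mem_ofPred_eq]
    rcases h0 with h2 | h2
    · left; rw [← h.map_left h2]; exact h1.2.1
    · right; rw [← h.map_right h2]; exact h1.1
  have h1 : IsClosed {x : ℝ | u + K * (x - u) ≤ β} := isClosed_le (by fun_prop) continuous_const
  have h2 : IsClosed {x : ℝ | α ≤ u + K * (x - 1 / 2 - u)} := isClosed_le continuous_const (by fun_prop)
  refine Metric.isCompact_of_isClosed_isBounded (isClosed_of_closure_subset ?_)
    ((Metric.isBounded_Icc α β).subset fun x hx => ⟨(hx 0).1, (hx 0).2.1⟩)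
  refine mem_staySet_of_invariant fun x hx => ?_
  obtain ⟨⟨h1, h2⟩, h3⟩ := closure_minimal hC (isClosed_Icc.inter (h1.union h2)) hx
  have h4 : x < v - 1 / 2 ∨ u + 1 / 2 < x := by
    simp only [mem_union, mem_ofPred_eq] at h3
    rcases h3 with h3 | h3
    · left
      have : K * (x - u) < K * (v - 1 / 2 - u) := by linarith
      linarith [lt_of_mul_lt_mul_left this hK0.le]
    · right
      have : K * 0 < K * (x - 1 / 2 - u) := by linarith
      linarith [lt_of_mul_lt_mul_left this hK0.le]
  refine ⟨h1, h2, h4, ?_⟩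
  have := (h.continuousAt_map h4).continuousWithinAt.mem_closure_image hx
  refine closure_mono ?_ this
  rintro _ ⟨y, hy, rfl⟩
  exact map_mem_staySet hy

end ReturnStrip

/-- A continuous self-map of a compact set maps some non-empty compact subset onto itself. -/
theorem exists_isCompact_image_eq {f : ℝ → ℝ} {S : Set ℝ} (hS : IsCompact S) (hne : S.Nonempty)
    (hf : ContinuousOn f S) (hmaps : MapsTo f S S) :
    ∃ G ⊆ S, IsCompact G ∧ G.Nonempty ∧ f '' G = G := by
  have hsucc : ∀ i, f^[i + 1] '' S = f '' (f^[i] '' S) := fun i => by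
    rw [Function.iterate_succ', image_comp]
  have hsub : ∀ i, f^[i] '' S ⊆ S := fun i => (hmaps.iterate i).image_subset
  have hcpt : ∀ i, IsCompact (f^[i] '' S) := fun i => by
    induction i with
    | zero => simpa using hS
    | succ i ih => rw [hsucc]; exact ih.image_of_continuousOn (hf.mono (hsub i))
  have hanti : ∀ i, f^[i + 1] '' S ⊆ f^[i] '' S := fun i => by
    rw [Function.iterate_succ, image_comp]; exact image_mono hmaps.image_subset
  refine ⟨⋂ i, f^[i] '' S, (iInter_subset _ 0).trans (hsub 0),
    (hcpt 0).of_isClosed_subset (isClosed_iInter fun i => (hcpt i).isClosed) (iInter_subset _ 0),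
    ?_, ?_⟩
  · exact IsCompact.nonempty_iInter_of_sequence_nonempty_isCompact_isClosed _ hanti
      (fun i => hne.image _) (hcpt 0) (fun i => (hcpt i).isClosed)
  apply Subset.antisymm
  · rintro _ ⟨x, hx, rfl⟩
    rw [mem_iInter] at hx ⊢
    intro i
    exact hanti i (by rw [hsucc]; exact ⟨x, hx i, rfl⟩)
  · intro y hy
    rw [mem_iInter] at hy
    have hcl : ∀ i, IsClosed (f^[i] '' S ∩ f ⁻¹' {y}) := fun i =>
      (hf.mono (hsub i)).preimage_isClosed_of_isClosed (hcpt i).isClosed isClosed_singleton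
    obtain ⟨x, hx⟩ := IsCompact.nonempty_iInter_of_sequence_nonempty_isCompact_isClosed
      (fun i => f^[i] '' S ∩ f ⁻¹' {y}) (fun i => inter_subset_inter_left _ (hanti i))
      (fun i => by
        have := hy (i + 1)
        rw [hsucc] at this
        obtain ⟨x, hx, hxy⟩ := this
        exact ⟨x, hx, hxy⟩) ((hcpt 0).of_isClosed_subset (hcl 0) inter_subset_left) hcl
    rw [mem_iInter] at hx
    exact ⟨x, mem_iInter.2 fun i => (hx i).1, (hx 0).2⟩

namespace ReturnStrip
variable {r : Setoid UnitAddCircle} {n : ℕ} {K u v α β : ℝ}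

/-- A compact set under the major that is mapped onto itself by the return map, with its extreme
points. -/
structure Core (K u v α β : ℝ) (S : Set ℝ) (a b : ℝ) : Prop where
  stay : S ⊆ staySet K u v α β
  image : retMap K u v '' S = S
  least : IsLeast S a
  greatest : IsGreatest S b

variable {S : Set ℝ} {a b : ℝ}

theorem Core.map_mem (c : Core K u v α β S a b) {x : ℝ} (hx : x ∈ S) : retMap K u v x ∈ S := by
  rw [← c.image]; exact ⟨x, hx, rfl⟩

theorem core_inPieces (h : ReturnStrip r n K u v α β) (c : Core K u v α β S a b) {x : ℝ}
    (hx : x ∈ S) : InPieces u v x :=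
  inPieces_of_mem h.u_lt h.lt_v' (c.stay hx)

theorem Core.mem_Icc (c : Core K u v α β S a b) {x : ℝ} (hx : x ∈ S) : α ≤ x ∧ x ≤ β :=
  ⟨(c.stay hx 0).1, (c.stay hx 0).2.1⟩

theorem core_left (h : ReturnStrip r n K u v α β) (c : Core K u v α β S a b) : a < v - 1 / 2 := by
  have hp := h.core_inPieces c c.least.1
  rcases hp.2.2 with h1 | h1
  · exact h1
  · have := c.least.2 (c.map_mem c.least.1)
    linarith [h.map_lt h1 hp.2.1]

theorem core_right (h : ReturnStrip r n K u v α β) (c : Core K u v α β S a b) : u + 1 / 2 < b := by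
  have hp := h.core_inPieces c c.greatest.1
  rcases hp.2.2 with h1 | h1
  · have := c.greatest.2 (c.map_mem c.greatest.1)
    linarith [h.lt_map hp.1 h1]
  · exact h1

theorem core_lt (h : ReturnStrip r n K u v α β) (c : Core K u v α β S a b) : a < b := by
  linarith [h.core_left c, h.core_right c, h.len_le]

theorem core_map_le (h : ReturnStrip r n K u v α β) (c : Core K u v α β S a b) :
    retMap K u v b ≤ retMap K u v a := by
  rw [h.map_left (h.core_left c), h.map_right (h.core_right c)]
  have h1 := (c.mem_Icc c.least.1).1
  have h2 := (c.mem_Icc c.greatest.1).2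
  nlinarith [h.two_le, h.le_half]

theorem core_gap (h : ReturnStrip r n K u v α β) (c : Core K u v α β S a b) {z : ℝ} (hz : z ∈ S) :
    ¬ (retMap K u v b < z ∧ z < retMap K u v a) := by
  rintro ⟨h1, h2⟩
  rw [← c.image] at hz
  obtain ⟨x, hx, rfl⟩ := hz
  have hK := h.two_le
  have hxa := c.least.2 hx
  have hxb := c.greatest.2 hx
  rcases (h.core_inPieces c hx).2.2 with h3 | h3
  · rw [h.map_left h3, h.map_left (h.core_left c)] at h2; nlinarith
  · rw [h.map_right h3, h.map_right (h.core_right c)] at h1; nlinarith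

/-- Neighbouring points of a core are mapped to neighbouring points, until they are the two points
next to the central strip, which are mapped to the extreme points. This induction principle moves
information from the pair of the extreme points back to all pairs of neighbours. -/
theorem core_induction (h : ReturnStrip r n K u v α β) (c : Core K u v α β S a b) {P : ℝ → ℝ → Prop}
    (central : ∀ g g', g ∈ S → g' ∈ S → g < v - 1 / 2 → u + 1 / 2 < g' → retMap K u v g = b →
      retMap K u v g' = a → P g g')
    (step : ∀ g g', g ∈ S → g' ∈ S → g < g' → (g' < v - 1 / 2 ∨ u + 1 / 2 < g) →
      P (retMap K u v g) (retMap K u v g') → P g g')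
    {g g' : ℝ} (hg : g ∈ S) (hg' : g' ∈ S) (hlt : g < g') (hadj : ∀ z ∈ S, ¬ (g < z ∧ z < g')) :
    P g g' := by
  have hK := h.two_le
  have hlen := h.len_le
  have q5 := h.le_half
  have hab := h.core_lt c
  obtain ⟨k, hk⟩ := pow_unbounded_of_one_lt ((b - a) / (g' - g)) (by norm_num : (1 : ℝ) < 2)
  rw [div_lt_iff₀ (by linarith)] at hk
  induction k generalizing g g' with
  | zero =>
    have := c.least.2 hg
    have := c.greatest.2 hg'
    linarith
  | succ k ih =>
    have hp := h.core_inPieces c hg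
    have hp' := h.core_inPieces c hg'
    have i1 := c.mem_Icc hg
    have i2 := c.mem_Icc hg'
    rw [pow_succ] at hk
    have h2k : (0 : ℝ) < 2 ^ k := by positivity
    rcases hp.2.2 with h1 | h1 <;> rcases hp'.2.2 with h2 | h2
    · have e1 := h.map_left h1
      have e2 := h.map_left h2
      refine step g g' hg hg' hlt (Or.inl h2) (ih (c.map_mem hg) (c.map_mem hg') ?_ ?_ ?_)
      · rw [e1, e2]; nlinarith
      · rintro z hz ⟨h3, h4⟩
        rw [← c.image] at hz
        obtain ⟨x, hx, rfl⟩ := hz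
        rcases (h.core_inPieces c hx).2.2 with h5 | h5
        · rw [h.map_left h5] at h3 h4
          exact hadj x hx ⟨by nlinarith, by nlinarith⟩
        · rw [h.map_right h5] at h3 h4
          have := c.mem_Icc hx
          nlinarith
      · have : 2 * (g' - g) ≤ retMap K u v g' - retMap K u v g := by rw [e1, e2]; nlinarith
        nlinarith
    · refine central g g' hg hg' h1 h2 ?_ ?_
      · apply le_antisymm (c.greatest.2 (c.map_mem hg))
        obtain ⟨x, hx, hxb⟩ : b ∈ retMap K u v '' S := by rw [c.image]; exact c.greatest.1
        rw [← hxb]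
        rcases (h.core_inPieces c hx).2.2 with h5 | h5
        · have : x ≤ g := by
            by_contra h6
            exact hadj x hx ⟨by linarith, by linarith⟩
          rw [h.map_left h5, h.map_left h1]; nlinarith
        · have := c.mem_Icc hx
          rw [h.map_right h5, h.map_left h1]; nlinarith
      · apply le_antisymm _ (c.least.2 (c.map_mem hg'))
        obtain ⟨x, hx, hxb⟩ : a ∈ retMap K u v '' S := by rw [c.image]; exact c.least.1
        rw [← hxb]
        rcases (h.core_inPieces c hx).2.2 with h5 | h5
        · have := c.mem_Icc hx
          rw [h.map_left h5, h.map_right h2]; nlinarith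
        · have : g' ≤ x := by
            by_contra h6
            exact hadj x hx ⟨by linarith, by linarith⟩
          rw [h.map_right h5, h.map_right h2]; nlinarith
    · linarith
    · have e1 := h.map_right h1
      have e2 := h.map_right h2
      refine step g g' hg hg' hlt (Or.inr h1) (ih (c.map_mem hg) (c.map_mem hg') ?_ ?_ ?_)
      · rw [e1, e2]; nlinarith
      · rintro z hz ⟨h3, h4⟩
        rw [← c.image] at hz
        obtain ⟨x, hx, rfl⟩ := hz
        rcases (h.core_inPieces c hx).2.2 with h5 | h5
        · rw [h.map_left h5] at h3 h4
          have := c.mem_Icc hx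
          nlinarith
        · rw [h.map_right h5] at h3 h4
          exact hadj x hx ⟨by nlinarith, by nlinarith⟩
      · have : 2 * (g' - g) ≤ retMap K u v g' - retMap K u v g := by rw [e1, e2]; nlinarith
        nlinarith

/-- If the extreme points of a core are equivalent, then so are neighbouring points. -/
theorem core_rel (h : ReturnStrip r n K u v α β) (c : Core K u v α β S a b) (hab : r a b)
    {g g' : ℝ} (hg : g ∈ S) (hg' : g' ∈ S) (hlt : g < g') (hadj : ∀ z ∈ S, ¬ (g < z ∧ z < g')) :
    r g g' := by
  have hpull : ∀ g g', g ∈ S → g' ∈ S →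
      r (retMap K u v g : UnitAddCircle) (retMap K u v g' : UnitAddCircle) → r g g' :=
    fun g g' hg hg' hr => h.rel_of_map (h.core_inPieces c hg) (h.core_inPieces c hg')
      (c.mem_Icc hg).1 (c.mem_Icc hg).2 (c.mem_Icc hg').1 (c.mem_Icc hg').2 hr
  refine h.core_induction c (P := fun g g' => r g g') ?_ ?_ hg hg' hlt hadj
  · intro g g' hg hg' _ _ e1 e2
    refine hpull g g' hg hg' ?_
    rw [e1, e2]; exact r.symm' hab
  · intro g g' hg hg' _ _ hr
    exact hpull g g' hg hg' hr

theorem core_land (h : ReturnStrip r n K u v α β) (c : Core K u v α β S a b)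
    {g g' : ℝ} (hg : g ∈ S) (hg' : g' ∈ S) (hlt : g < g') (hadj : ∀ z ∈ S, ¬ (g < z ∧ z < g')) :
    ∃ i, (retMap K u v)^[i] g = b := by
  refine h.core_induction c (P := fun g _ => ∃ i, (retMap K u v)^[i] g = b) ?_ ?_ hg hg' hlt hadj
  · intro g g' hg hg' _ _ e1 _; exact ⟨1, e1⟩
  · rintro g g' hg hg' _ _ ⟨i, hi⟩
    exact ⟨i + 1, by rw [Function.iterate_succ_apply]; exact hi⟩

/-- The return map has a lift of degree one on sets that its right branch maps below the image of
the leftmost point. -/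
theorem exists_isLiftOn (h : ReturnStrip r n K u v α β) {A : Set UnitAddCircle} {x : ℝ} (hx : u < x)
    (hxv : x < v - 1 / 2) (hA : ∀ t ∈ A, ∃ z : ℝ, (z : UnitAddCircle) = t ∧ InPieces u v z ∧ x ≤ z ∧
      (u + 1 / 2 < z → retMap K u v z ≤ retMap K u v x)) :
    ∃ F : CircleDeg1Lift, IsLiftOn F A n := by
  have hK := h.two_le
  have hlen := h.len_le
  have hl := h.len
  refine _root_.exists_isLiftOn x (fun t => min (u + K * (x - u) + 1)
    (max (min v (u + K * (t - u))) (u + 1 + K * (t - 1 / 2 - u)))) ?_ ?_ ?_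
  · intro s _ t _ hst
    have h1 : K * (s - u) ≤ K * (t - u) := mul_le_mul_of_nonneg_left (by linarith) (by linarith)
    have h2 : K * (s - 1 / 2 - u) ≤ K * (t - 1 / 2 - u) :=
      mul_le_mul_of_nonneg_left (by linarith) (by linarith)
    exact min_le_min le_rfl (max_le_max (min_le_min le_rfl (by linarith)) (by linarith))
  · have h1 : u + K * (x - u) ≤ v := by nlinarith
    have e1 : max (min v (u + K * (x - u))) (u + 1 + K * (x - 1 / 2 - u)) = u + K * (x - u) := by
      rw [min_eq_right h1, max_eq_left (by linarith)]
    have h3 : u + K * (x - u) + 1 ≤ u + 1 + K * (x + 1 - 1 / 2 - u) := by linarith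
    rw [e1, min_eq_right (show u + K * (x - u) ≤ u + K * (x - u) + 1 by linarith),
      min_eq_left (le_max_of_le_right h3)]
  · intro t ht1 ht2 htA
    obtain ⟨z, hz, hzp, hxz, hzf⟩ := hA t htA
    have := eq_of_coe_eq hz (by linarith [hzp.2.1]) (by linarith [hzp.1])
    subst this
    rw [← h.coe_map]
    rcases hzp.2.2 with h3 | h3
    · rw [h.map_left h3]
      have h1 : u + K * (z - u) ≤ v := by nlinarith
      rw [min_eq_right h1, max_eq_left (by nlinarith), min_eq_right]
      have : u < u + K * (x - u) := by nlinarith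
      linarith
    · have h4 := hzf h3
      rw [h.map_right h3, h.map_left hxv] at h4
      rw [h.map_right h3, max_eq_right, min_eq_right (by linarith)]
      · rw [show u + 1 + K * (z - 1 / 2 - u) = u + K * (z - 1 / 2 - u) + 1 by ring, coe_add_one']
      · have : 0 < K * (z - 1 / 2 - u) := mul_pos (by linarith) (by linarith)
        exact (min_le_left _ _).trans (by linarith)

/-- Sets under the strip have period exactly `n` once they are mapped onto themselves by
`dbl^[n]`. -/
theorem hasPeriod (h : ReturnStrip r n K u v α β) {A : Set UnitAddCircle} (hne : A.Nonempty)
    (hA : ∀ t ∈ A, ∃ z : ℝ, (z : UnitAddCircle) = t ∧ InPieces u v z) (himg : dbl^[n] '' A = A) :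
    HasPeriod A n := by
  refine ⟨⟨h.pos, himg⟩, ?_⟩
  rintro k ⟨hk, hkA⟩
  by_contra hlt
  push Not at hlt
  obtain ⟨t, ht⟩ := hne
  obtain ⟨x, rfl, hx⟩ := hA t ht
  have : dbl^[k] (x : UnitAddCircle) ∈ A := by rw [← hkA]; exact ⟨_, ht, rfl⟩
  obtain ⟨y, hy, hyp⟩ := hA _ this
  rw [dbl_iterate_coe] at hy
  exact h.disj k hk hlt x y hx hyp.1 hyp.2.1 hy.symm

theorem not_fixed (h : ReturnStrip r n K u v α β) {x : ℝ} (hx : InPieces u v x) :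
    dbl^[n] (x : UnitAddCircle) ≠ x := by
  rw [← h.coe_map]
  intro he
  have := h.map_mem hx
  have hlen := h.len_le
  exact h.map_ne hx (eq_of_coe_eq he (by linarith [hx.1]) (by linarith [hx.2.1]))

theorem core_shift (h : ReturnStrip r n K u v α β) (c : Core K u v α β S a b) {x δ : ℝ} (hx : x ∈ S)
    (hδ : 0 ≤ δ) (hb : b + δ ≤ β) : InPieces u v (x + δ / K) ∧ α ≤ x + δ / K ∧ x + δ / K ≤ β ∧
      retMap K u v (x + δ / K) = retMap K u v x + δ := by
  have hK := h.two_le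
  have hK0 : 0 < K := by linarith
  have hp := h.core_inPieces c hx
  have hi := c.mem_Icc hx
  have hxb := c.greatest.2 hx
  have hfb := c.greatest.2 (c.map_mem hx)
  have q4 := h.lt_v'
  have hd : 0 ≤ δ / K := div_nonneg hδ hK0.le
  have hd' : δ / K ≤ δ := div_le_self hδ (by linarith)
  have e : K * (δ / K) = δ := by field_simp
  rcases hp.2.2 with h1 | h1
  · rw [h.map_left h1] at hfb
    have : K * (x + δ / K - u) < K * (v - 1 / 2 - u) := by linarith [h.len]
    have h2 : x + δ / K < v - 1 / 2 := by linarith [lt_of_mul_lt_mul_left this hK0.le]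
    exact ⟨⟨by linarith [hp.1], by linarith, Or.inl h2⟩, by linarith, by linarith,
      by rw [h.map_left h1, h.map_left h2]; linarith⟩
  · have h2 : u + 1 / 2 < x + δ / K := by linarith
    exact ⟨⟨by linarith [hp.1], by linarith, Or.inr h2⟩, by linarith, by linarith,
      by rw [h.map_right h1, h.map_right h2]; linarith⟩

theorem core_shift' (h : ReturnStrip r n K u v α β) (c : Core K u v α β S a b) {x δ : ℝ} (hx : x ∈ S)
    (hδ : 0 ≤ δ) (hb : α ≤ a - δ) : InPieces u v (x - δ / K) ∧ α ≤ x - δ / K ∧ x - δ / K ≤ β ∧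
      retMap K u v (x - δ / K) = retMap K u v x - δ := by
  have hK := h.two_le
  have hK0 : 0 < K := by linarith
  have hp := h.core_inPieces c hx
  have hi := c.mem_Icc hx
  have hxb := c.least.2 hx
  have hfb := c.least.2 (c.map_mem hx)
  have q1 := h.u_lt
  have hd : 0 ≤ δ / K := div_nonneg hδ hK0.le
  have hd' : δ / K ≤ δ := div_le_self hδ (by linarith)
  have e : K * (δ / K) = δ := by field_simp
  rcases hp.2.2 with h1 | h1
  · have h2 : x - δ / K < v - 1 / 2 := by linarith
    exact ⟨⟨by linarith [hp.1], by linarith [hp.2.1], Or.inl h2⟩, by linarith, by linarith,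
      by rw [h.map_left h1, h.map_left h2]; linarith⟩
  · rw [h.map_right h1] at hfb
    have : K * 0 < K * (x - δ / K - 1 / 2 - u) := by linarith
    have h2 : u + 1 / 2 < x - δ / K := by linarith [lt_of_mul_lt_mul_left this hK0.le]
    exact ⟨⟨by linarith [hp.1], by linarith [hp.2.1], Or.inr h2⟩, by linarith, by linarith,
      by rw [h.map_right h1, h.map_right h2]; linarith⟩

theorem core_iterate_mem (c : Core K u v α β S a b) {x : ℝ} (hx : x ∈ S) (j : ℕ) :
    (retMap K u v)^[j] x ∈ S := by
  induction j with
  | zero => exact hx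
  | succ j ih => rw [Function.iterate_succ_apply']; exact c.map_mem ih

theorem core_pull (h : ReturnStrip r n K u v α β) (c : Core K u v α β S a b) {x y δ δ' : ℝ}
    (hx : x ∈ S) (hy : y ∈ S) (hδ : 0 ≤ δ) (hb : b + δ ≤ β) (hδ' : 0 ≤ δ') (ha : α ≤ a - δ')
    (j : ℕ) (hr : r (((retMap K u v)^[j] x + δ : ℝ) : UnitAddCircle)
      (((retMap K u v)^[j] y - δ' : ℝ) : UnitAddCircle)) :
    r ((x + δ / K ^ j : ℝ) : UnitAddCircle) ((y - δ' / K ^ j : ℝ) : UnitAddCircle) := by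
  have hK := h.two_le
  induction j generalizing x y with
  | zero => simpa using hr
  | succ j ih =>
    rw [Function.iterate_succ_apply, Function.iterate_succ_apply] at hr
    have h1 := ih (c.map_mem hx) (c.map_mem hy) hr
    have hKj : 1 ≤ K ^ j := one_le_pow₀ (by linarith)
    have d1 : δ / K ^ j ≤ δ := div_le_self hδ hKj
    have d2 : δ' / K ^ j ≤ δ' := div_le_self hδ' hKj
    obtain ⟨a1, a2, a3, a4⟩ := h.core_shift c hx (δ := δ / K ^ j) (by positivity) (by linarith)
    obtain ⟨b1, b2, b3, b4⟩ := h.core_shift' c hy (δ := δ' / K ^ j) (by positivity) (by linarith)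
    rw [← a4, ← b4] at h1
    have := h.rel_of_map a1 b1 a2 a3 b2 b3 h1
    rwa [pow_succ, ← div_div, ← div_div]

/-- If the extreme points of a core are periodic, then they are equivalent: pulling back the major
along their orbits yields equivalent points converging to them. -/
theorem core_rel_of_periodic (h : ReturnStrip r n K u v α β) (c : Core K u v α β S a b) {N : ℕ}
    (hN : 0 < N) (ha : (retMap K u v)^[N] a = a) (hb : (retMap K u v)^[N] b = b) : r b a := by
  have hK := h.two_le
  have i1 := c.mem_Icc c.least.1
  have i2 := c.mem_Icc c.greatest.1
  have hit : ∀ i : ℕ, (retMap K u v)^[N * i] a = a ∧ (retMap K u v)^[N * i] b = b := fun i => by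
    rw [Function.iterate_mul]
    exact ⟨Function.iterate_fixed ha i, Function.iterate_fixed hb i⟩
  have hrel : ∀ i : ℕ, r ((b + (β - b) / K ^ (N * i) : ℝ) : UnitAddCircle)
      ((a - (a - α) / K ^ (N * i) : ℝ) : UnitAddCircle) := fun i => by
    refine h.core_pull c c.greatest.1 c.least.1 (by linarith) (by linarith) (by linarith)
      (by linarith) _ ?_
    rw [(hit i).1, (hit i).2]
    have e1 : b + (β - b) = β := by ring
    have e2 : a - (a - α) = α := by ring
    rw [e1, e2]; exact r.symm' h.major.1.rel
  have hpow : Filter.Tendsto (fun i : ℕ => K ^ (N * i)) Filter.atTop Filter.atTop := by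
    simp_rw [pow_mul]
    refine tendsto_pow_atTop_atTop_of_one_lt ?_
    exact one_lt_pow₀ (by linarith) hN.ne'
  have hlim : ∀ c d : ℝ, Filter.Tendsto (fun i : ℕ => ((c + d / K ^ (N * i) : ℝ) : UnitAddCircle))
      Filter.atTop (nhds (c : UnitAddCircle)) := fun c d => by
    have h1 := (hpow.const_div_atTop d).const_add c
    rw [add_zero] at h1
    exact ((AddCircle.continuous_mk' (1 : ℝ)).tendsto c).comp h1
  have h2 := (hlim b (β - b)).prodMk_nhds (hlim a (-(a - α)))
  have := h.quad.lamination.closed.mem_of_tendsto h2 (Filter.Eventually.of_forall fun i => by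
    have := hrel i
    rw [show a - (a - α) / K ^ (N * i) = a + -(a - α) / K ^ (N * i) by ring] at this
    exact this)
  exact this

end ReturnStrip

/-- Reading off the separation of two points by a chord from a fundamental interval. -/
theorem separates_of_mem_openArc {z c d x y : ℝ} (hc : z ≤ c) (hc' : c < z + 1) (hd : z ≤ d)
    (hd' : d < z + 1) (hx : z ≤ x) (hx' : x < z + 1) (hy : z ≤ y) (hy' : y < z + 1) (hcd : c ≠ d)
    (h1 : (x : UnitAddCircle) ∈ openArc c d) (h2 : (y : UnitAddCircle) ∈ openArc d c) :
    (x - c) * (x - d) * ((y - c) * (y - d)) < 0 := by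
  have key : ∀ {c d x : ℝ}, z ≤ c → c < z + 1 → z ≤ d → d < z + 1 → z ≤ x → x < z + 1 → c < d →
      ((x : UnitAddCircle) ∈ openArc c d → (x - c) * (x - d) < 0) ∧
      ((x : UnitAddCircle) ∈ openArc d c → 0 < (x - c) * (x - d)) := by
    intro c d x hc hc' hd hd' hx hx' hlt
    constructor
    · intro h
      obtain ⟨w, w1, w2, w3⟩ := (mem_openArc_iff hlt (by linarith)).1 h
      have := eq_of_coe_eq w3 (by linarith) (by linarith)
      subst this
      exact mul_neg_of_pos_of_neg (by linarith) (by linarith)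
    · intro h
      rw [← coe_add_one' c] at h
      obtain ⟨w, w1, w2, w3⟩ := (mem_openArc_iff (by linarith) (by linarith)).1 h
      rcases lt_trichotomy x c with h3 | h3 | h3
      · exact mul_pos_of_neg_of_neg (by linarith) (by linarith)
      · subst h3
        rw [← coe_add_one' x] at w3
        have := eq_of_coe_eq w3 (by linarith) (by linarith); linarith
      · rcases lt_or_ge d x with h4 | h4
        · exact mul_pos (by linarith) (by linarith)
        · rw [← coe_add_one' x] at w3
          have := eq_of_coe_eq w3 (by linarith) (by linarith); linarith
  rcases lt_or_gt_of_ne hcd with h | h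
  · exact mul_neg_of_neg_of_pos ((key hc hc' hd hd' hx hx' h).1 h1) ((key hc hc' hd hd' hy hy' h).2 h2)
  · have e1 := (key hd hd' hc hc' hx hx' h).2 h1
    have e2 := (key hd hd' hc hc' hy hy' h).1 h2
    have : (x - c) * (x - d) * ((y - c) * (y - d)) = (x - d) * (x - c) * ((y - d) * (y - c)) := by ring
    rw [this]; exact mul_neg_of_pos_of_neg e1 e2

namespace ReturnStrip
variable {r : Setoid UnitAddCircle} {n : ℕ} {K u v α β : ℝ}

theorem exists_core_of_periodic {x : ℝ} (hx : x ∈ staySet K u v α β) {N : ℕ} (hN : 0 < N)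
    (hper : (retMap K u v)^[N] x = x) :
    ∃ S a b, Core K u v α β S a b ∧ S.Finite ∧ (retMap K u v)^[N] a = a ∧
      (retMap K u v)^[N] b = b := by
  have hmod : ∀ j, (retMap K u v)^[j] x = (retMap K u v)^[j % N] x := fun j =>
    ((show Function.IsPeriodicPt (retMap K u v) N x from hper).iterate_mod_apply j).symm
  have hfin : (range fun j => (retMap K u v)^[j] x).Finite := by
    refine ((Finset.range N).finite_toSet.image fun j => (retMap K u v)^[j] x).subset ?_
    rintro _ ⟨j, rfl⟩
    exact ⟨j % N, by simpa using Nat.mod_lt _ hN, (hmod j).symm⟩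
  have hne : (range fun j => (retMap K u v)^[j] x).Nonempty := ⟨_, 0, rfl⟩
  obtain ⟨a, ha, ha'⟩ := Set.exists_min_image _ id hfin hne
  obtain ⟨b, hb, hb'⟩ := Set.exists_max_image _ id hfin hne
  have hfix : ∀ z ∈ range fun j => (retMap K u v)^[j] x, (retMap K u v)^[N] z = z := by
    rintro _ ⟨j, rfl⟩
    simp only
    rw [← Function.iterate_add_apply, add_comm, Function.iterate_add_apply, hper]
  refine ⟨_, a, b, ⟨?_, ?_, ⟨ha, ha'⟩, ⟨hb, hb'⟩⟩, hfin, hfix a ha, hfix b hb⟩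
  · rintro _ ⟨j, rfl⟩; exact iterate_mem_staySet hx j
  · ext z
    constructor
    · rintro ⟨_, ⟨j, rfl⟩, rfl⟩
      exact ⟨j + 1, Function.iterate_succ_apply' _ _ _⟩
    · rintro ⟨j, rfl⟩
      refine ⟨_, ⟨j + (N - 1), rfl⟩, ?_⟩
      simp only
      rw [← Function.iterate_succ_apply' (retMap K u v), Nat.succ_eq_add_one, add_assoc,
        Nat.sub_add_cancel hN, Function.iterate_add_apply, hper]

theorem core_rel_all (h : ReturnStrip r n K u v α β) {S : Set ℝ} {a b : ℝ}
    (c : Core K u v α β S a b) (hfin : S.Finite) (hab : r a b) {x : ℝ} (hx : x ∈ S) : r a x := by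
  by_contra hcon
  obtain ⟨y, ⟨hyS, hy⟩, hmin⟩ := Set.exists_min_image {x | x ∈ S ∧ ¬ r a x} id
    (hfin.subset fun _ h => h.1) ⟨x, hx, hcon⟩
  have hay : a < y := lt_of_le_of_ne (c.least.2 hyS) (by rintro rfl; exact hy (r.refl' _))
  obtain ⟨g, ⟨hgS, hg⟩, hmax⟩ := Set.exists_max_image {x | x ∈ S ∧ x < y} id
    (hfin.subset fun _ h => h.1) ⟨a, c.least.1, hay⟩
  have hag : r a g := by
    by_contra h1
    have := hmin g ⟨hgS, h1⟩
    simp only [id] at this; linarith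
  refine hy (r.trans' hag (h.core_rel c hab hgS hyS hg ?_))
  rintro z hz ⟨h1, h2⟩
  have := hmax z ⟨hz, h2⟩
  simp only [id] at this; linarith

/-- A periodic point that stays under the major yields a rotational class. -/
theorem exists_rotational_class (h : ReturnStrip r n K u v α β) {x₀ : ℝ}
    (hx₀ : x₀ ∈ staySet K u v α β) {N : ℕ} (hN : 0 < N) (hper : (retMap K u v)^[N] x₀ = x₀) :
    ∃ a : UnitAddCircle, (lamClass r a).Nontrivial ∧ dbl^[n] '' lamClass r a = lamClass r a ∧
      HasPeriod (lamClass r a) n ∧ IsRotationalOfPeriod (lamClass r a) n ∧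
      ∀ t ∈ lamClass r a, ∃ z : ℝ, (z : UnitAddCircle) = t ∧ InPieces u v z ∧ α ≤ z ∧ z ≤ β := by
  obtain ⟨S, a, b, c, hfin, ha, hb⟩ := exists_core_of_periodic hx₀ hN hper
  have hab : r a b := r.symm' (h.core_rel_of_periodic c hN ha hb)
  have hpa := h.core_inPieces c c.least.1
  have hpb := h.core_inPieces c c.greatest.1
  have hal := h.core_left c
  have hbr := h.core_right c
  have hlen := h.len_le
  have hlt := h.core_lt c
  have hl := h.quad.lamination
  have hnt : (lamClass r a).Nontrivial := ⟨a, self_mem_lamClass _, b, hab, fun he => by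
    have := eq_of_coe_eq he (by linarith [hpa.2.1, hpb.1]) (by linarith [hpb.2.1, hpa.1]); linarith⟩
  have himg : dbl^[n] '' lamClass r a = lamClass r a := by
    rw [h.quad.image_iterate, ← h.coe_map]
    exact (lamClass_eq (h.core_rel_all c hfin hab (c.map_mem c.least.1))).symm
  have hrep : ∀ t ∈ lamClass r a, ∃ z : ℝ, InPieces u v z ∧ (z : UnitAddCircle) = t := fun t ht =>
    h.exists_inPieces hpa ht
  have hinj : ∀ z z' : ℝ, InPieces u v z → InPieces u v z' → (z : UnitAddCircle) = z' → z = z' :=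
    fun z z' hz hz' he => eq_of_coe_eq he (by linarith [hz.2.1, hz'.1]) (by linarith [hz.1, hz'.2.1])
  have hΓ : {z : ℝ | InPieces u v z ∧ r a z}.Finite :=
    Set.Finite.of_injOn (f := fun z : ℝ => (z : UnitAddCircle)) (t := lamClass r a)
      (fun z hz => hz.2) (fun z hz z' hz' he => hinj z z' hz.1 hz'.1 he) (hl.finite a)
  have hfΓ : ∀ z, InPieces u v z → r a z → InPieces u v (retMap K u v z) ∧
      r a (retMap K u v z : UnitAddCircle) := fun z hz hrz => by
    have h1 : r a (retMap K u v z : UnitAddCircle) := by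
      rw [h.coe_map, ← mem_lamClass, ← himg]; exact ⟨_, hrz, rfl⟩
    have h2 := h.map_mem hz
    exact ⟨h.inPieces_of_rel hpa h1 h2.1 (by linarith), h1⟩
  obtain ⟨x, ⟨hxp, hxr⟩, hxmin⟩ := Set.exists_min_image _ id hΓ ⟨a, hpa, r.refl' _⟩
  obtain ⟨y, ⟨hyp, hyr⟩, hymax⟩ := Set.exists_max_image _ id hΓ ⟨a, hpa, r.refl' _⟩
  simp only [id] at hxmin hymax
  have hxa := hxmin a ⟨hpa, r.refl' _⟩
  have hby := hymax b ⟨hpb, hab⟩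
  have hhole : IsHole (lamClass r a) y x := by
    rw [← coe_add_one' x, isHole_coe_iff (by linarith [hyp.2.1, hxp.1]) (by linarith), coe_add_one']
    refine ⟨hyr, hxr, fun z h1 h2 hz => ?_⟩
    obtain ⟨z', hz', he⟩ := hrep _ hz
    rw [← he] at hz
    have h3 := hxmin z' ⟨hz', hz⟩
    have h4 := hymax z' ⟨hz', hz⟩
    have := eq_of_coe_eq he (by linarith) (by linarith); linarith
  have hfyx : retMap K u v y ≤ retMap K u v x := by
    by_contra hcon
    push Not at hcon
    have h1 := h.quad.isHole_iterate hhole n (by rw [himg]; exact hnt)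
    have h2 := h.map_mem hxp
    have h3 := h.map_mem hyp
    rw [himg, ← h.coe_map, ← h.coe_map, ← coe_add_one' (retMap K u v x),
      isHole_coe_iff (by linarith) (by linarith)] at h1
    exact h1.2.2 y (h.map_lt (by linarith) hyp.2.1) (by linarith [hyp.2.1]) hyr
  obtain ⟨F, hF⟩ := h.exists_isLiftOn (A := lamClass r a) hxp.1 (by linarith) (fun t ht => by
    obtain ⟨z, hz, rfl⟩ := hrep t ht
    refine ⟨z, rfl, hz, hxmin z ⟨hz, ht⟩, fun hzr => le_trans ?_ hfyx⟩
    rw [h.map_right hzr, h.map_right (by linarith)]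
    have := hymax z ⟨hz, ht⟩
    nlinarith [h.two_le])
  have hmaps : MapsTo dbl^[n] (lamClass r a) (lamClass r a) := mapsTo_iff_image_subset.2 himg.subset
  refine ⟨a, hnt, himg, h.hasPeriod hnt.nonempty (fun t ht => ?_) himg, Or.inl ⟨hl.finite a,
    F.translationNumber, ⟨F, hF, rfl⟩, fun k hk => ?_⟩, fun t ht => ?_⟩
  · obtain ⟨z, hz, he⟩ := hrep t ht; exact ⟨z, he, hz⟩
  · obtain ⟨t, ht, hfix⟩ := hF.exists_fixed_of_finite (hl.finite a) hmaps hnt.nonempty hk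
    obtain ⟨z, hz, rfl⟩ := hrep t ht
    exact h.not_fixed hz hfix
  · obtain ⟨z, hz, rfl⟩ := hrep t ht
    refine ⟨z, rfl, hz, ?_⟩
    by_contra hcon
    have hout : z < α ∨ β < z := by
      by_contra h1; push Not at h1; exact hcon h1
    have hαβ := h.lt
    have q1 := h.u_lt
    have q4 := h.lt_v'
    have hwrap : ∃ z', β < z' ∧ z' < α + 1 ∧ r a z' := by
      rcases hout with h1 | h1
      · exact ⟨z + 1, by linarith [hz.1], by linarith, by rw [coe_add_one']; exact ht⟩
      · exact ⟨z, h1, by linarith [hz.2.1], ht⟩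
    obtain ⟨z', hz1, hz2, hz3⟩ := hwrap
    have hno : ∀ o ∈ S, o = α ∨ o = β := by
      intro o ho
      by_contra h1
      push Not at h1
      have hi := c.mem_Icc ho
      exact hl.leaf_pair_coe h.major.1 (r.trans' (r.symm' (h.core_rel_all c hfin hab ho)) hz3)
        (lt_of_le_of_ne hi.1 h1.1.symm) (lt_of_le_of_ne hi.2 h1.2) hz1 hz2
    have q3 := h.u_lt'
    have q2 := h.lt_v
    have ea : a = α := (hno a c.least.1).resolve_right (by intro h1; linarith)
    have eb : b = β := (hno b c.greatest.1).resolve_left (by intro h1; linarith)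
    have fa : retMap K u v α = β := (hno _ (ea ▸ c.map_mem c.least.1)).resolve_left
      (h.map_ne h.inPieces_left)
    have fb : retMap K u v β = α := (hno _ (eb ▸ c.map_mem c.greatest.1)).resolve_right
      (h.map_ne h.inPieces_right)
    have hleaf := h.major.1
    have hnh : ¬ IsHole (lamClass r α) β α := by
      rw [← coe_add_one' α, isHole_coe_iff (by linarith) (by linarith), coe_add_one']
      intro h1
      exact h1.2.2 z' hz1 hz2 (by rw [← ea]; exact hz3)
    rcases hleaf.2 with h1 | h1
    · have h2 := h.quad.isHole_iterate h1 n (by rw [← ea, himg]; exact hnt)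
      rw [← ea, himg, ea, ← h.coe_map, ← h.coe_map, fa, fb] at h2
      exact hnh h2
    · exact hnh h1

/-- The class of a diameter in the pieces. -/
theorem eq_or_eq_of_rel (h : ReturnStrip r n K u v α β) (hdiam : β = α + 1 / 2) {t : ℝ}
    (ht : r α t) (h1 : u < t) (h2 : t < u + 1) : t = α ∨ t = β := by
  have hK := h.two_le
  have hlen := h.len_le
  have q1 := h.u_lt
  have q2 := h.lt_v
  have q3 := h.u_lt'
  have q4 := h.lt_v'
  have hαβ := h.lt
  have hl := h.quad.lamination
  have hM := h.major.1
  have hM' := hM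
  rw [hdiam] at hM'
  have : (t : UnitAddCircle) ∈ lamClass r α := ht
  rw [h.quad.lamClass_diameter hM'] at this
  rcases this with h3 | h3
  · left; exact eq_of_coe_eq h3 (by linarith) (by linarith)
  · right; rw [hdiam]; exact eq_of_coe_eq h3 (by linarith) (by linarith)

/-- The chords between neighbouring points of a core are leaves, if the extreme points are the
endpoints of a diameter. -/
theorem core_isLeaf (h : ReturnStrip r n K u v α β) (hdiam : β = α + 1 / 2) {S : Set ℝ}
    (c : Core K u v α β S α β) {g g' : ℝ} (hg : g ∈ S) (hg' : g' ∈ S) (hlt : g < g')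
    (hgap : ∀ z ∈ S, ¬ (g < z ∧ z < g')) : IsLeaf r g g' := by
  have hK := h.two_le
  have hlen := h.len_le
  have q1 := h.u_lt
  have q2 := h.lt_v
  have q3 := h.u_lt'
  have q4 := h.lt_v'
  have hαβ := h.lt
  have hl := h.quad.lamination
  have hM := h.major.1
  have hi := c.mem_Icc hg
  have hi' := c.mem_Icc hg'
  have hrel := h.core_rel c hM.rel hg hg' hlt hgap
  rw [isLeaf_coe_iff hlt (by linarith)]
  refine ⟨hrel, Or.inl ?_⟩
  refine h.core_induction c (P := fun g g' => ∀ z : ℝ, g < z → z < g' → ¬ r g z) ?_ ?_ hg hg' hlt hgap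
  · intro g g' hg hg' h1 h2 e1 e2 z hz1 hz2 hz
    have hi := c.mem_Icc hg
    have hi' := c.mem_Icc hg'
    have hzp := h.inPieces_of_rel (h.core_inPieces c hg) hz (by linarith) (by linarith)
    have h3 := h.rel_iff_map hz
    have h4 := h.map_mem hzp
    rw [e1] at h3
    have h5 := h.eq_or_eq_of_rel hdiam (r.trans' hM.rel h3) h4.1 (by linarith)
    rcases hzp.2.2 with h6 | h6
    · rw [h.map_left h1] at e1
      rw [h.map_left h6] at h5
      rcases h5 with h5 | h5 <;> nlinarith
    · rw [h.map_right h2] at e2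
      rw [h.map_right h6] at h5
      rcases h5 with h5 | h5 <;> nlinarith
  · intro g g' hg hg' hlt hcase ih z hz1 hz2 hz
    have hi := c.mem_Icc hg
    have hi' := c.mem_Icc hg'
    refine ih (retMap K u v z) ?_ ?_ (h.rel_iff_map hz)
    · rcases hcase with h1 | h1
      · rw [h.map_left (by linarith), h.map_left (by linarith)]; nlinarith
      · rw [h.map_right (by linarith), h.map_right (by linarith)]; nlinarith
    · rcases hcase with h1 | h1
      · rw [h.map_left (by linarith), h.map_left (by linarith)]; nlinarith
      · rw [h.map_right (by linarith), h.map_right (by linarith)]; nlinarith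

/-- If the major is a diameter, a class pair separating two points under it lies under it. -/
theorem mem_of_separates_diameter (h : ReturnStrip r n K u v α β) (hdiam : β = α + 1 / 2)
    {x y p q : ℝ} (hx1 : α ≤ x) (hx2 : x ≤ β) (hy1 : α ≤ y) (hy2 : y ≤ β) (hp1 : u < p)
    (hp2 : p < u + 1) (hq1 : u < q) (hq2 : q < u + 1) (hpq : r p q)
    (hsep : (x - p) * (x - q) * ((y - p) * (y - q)) < 0) : (α < p ∧ p < β) ∧ α < q ∧ q < β := by
  have hK := h.two_le
  have hlen := h.len_le
  have q1 := h.u_lt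
  have q2 := h.lt_v
  have q3 := h.u_lt'
  have q4 := h.lt_v'
  have hαβ := h.lt
  have hl := h.quad.lamination
  have hM := h.major.1
  have hone : ∀ p q : ℝ, u < p → p < u + 1 → u < q → q < u + 1 → r p q → α < p → p < β →
      α < q ∧ q < β := by
    intro p q hp1 hp2 hq1 hq2 hpq h1 h2
    have hpa : ¬ r α p := fun h3 => by
      rcases h.eq_or_eq_of_rel hdiam h3 hp1 hp2 with h4 | h4 <;> linarith
    constructor
    · rcases lt_trichotomy q α with h3 | h3 | h3
      · rw [← coe_add_one' q] at hpq
        exact (hl.leaf_pair_coe hM hpq h1 h2 (by linarith) (by linarith)).elim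
      · subst h3; exact absurd (r.symm' hpq) hpa
      · exact h3
    · rcases lt_trichotomy q β with h3 | h3 | h3
      · exact h3
      · subst h3; exact absurd (r.trans' hM.rel (r.symm' hpq)) hpa
      · exact (hl.leaf_pair_coe hM hpq h1 h2 (by linarith) (by linarith)).elim
  by_cases hp : α < p ∧ p < β
  · exact ⟨hp, hone p q hp1 hp2 hq1 hq2 hpq hp.1 hp.2⟩
  by_cases hq : α < q ∧ q < β
  · exact ⟨hone q p hq1 hq2 hp1 hp2 (r.symm' hpq) hq.1 hq.2, hq⟩
  exfalso
  have hsame : ∀ t, ¬ (α < t ∧ t < β) → 0 ≤ (x - t) * (y - t) := by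
    intro t ht
    rcases le_or_gt t α with h1 | h1
    · exact mul_nonneg (by linarith) (by linarith)
    · have : β ≤ t := by by_contra h2; exact ht ⟨h1, by linarith⟩
      exact mul_nonneg_of_nonpos_of_nonpos (by linarith) (by linarith)
  have := mul_nonneg (hsame p hp) (hsame q hq)
  have e : (x - p) * (x - q) * ((y - p) * (y - q)) = (x - p) * (y - p) * ((x - q) * (y - q)) := by ring
  linarith

/-- Leaves do not separate the points of a core whose extreme points are the endpoints of a
diameter: the images of such a leaf would stay under the major for ever. -/
theorem core_not_separated (h : ReturnStrip r n K u v α β) (hdiam : β = α + 1 / 2) {S : Set ℝ}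
    (c : Core K u v α β S α β) {F : CircleDeg1Lift}
    (hF : IsLiftOn F (((↑) : ℝ → UnitAddCircle) '' staySet K u v α β) n)
    (hcl : IsClosed (((↑) : ℝ → UnitAddCircle) '' staySet K u v α β))
    (hmaps : MapsTo dbl^[n] (((↑) : ℝ → UnitAddCircle) '' staySet K u v α β)
      (((↑) : ℝ → UnitAddCircle) '' staySet K u v α β))
    (hnoper : ∀ t ∈ ((↑) : ℝ → UnitAddCircle) '' staySet K u v α β, ∀ m : ℕ, 0 < m → dbl^[m] t ≠ t)
    {p q : UnitAddCircle} (hpq : IsLeaf r p q) {x y : ℝ} (hxS : x ∈ S) (hyS : y ∈ S)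
    (hx : (x : UnitAddCircle) ∈ openArc p q) (hy : (y : UnitAddCircle) ∈ openArc q p) : False := by
  have hK := h.two_le
  have hlen := h.len_le
  have q1 := h.u_lt
  have q2 := h.lt_v
  have q3 := h.u_lt'
  have q4 := h.lt_v'
  have hαβ := h.lt
  have hl := h.quad.lamination
  have hM := h.major.1
  have hux : ∀ z ∈ S, u < z ∧ z < u + 1 := fun z hz => by
    have := c.mem_Icc hz
    constructor <;> linarith
  obtain ⟨p, hp1, hp2, rfl⟩ := exists_coe_Ico u p
  obtain ⟨q, hq1, hq2, rfl⟩ := exists_coe_Ico u q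
  have hsep := separates_of_mem_openArc hp1 hp2 hq1 hq2 (hux x hxS).1.le (hux x hxS).2
    (hux y hyS).1.le (hux y hyS).2 (fun h1 => hpq.1 (by rw [h1])) hx hy
  have hpu : u < p := lt_of_le_of_ne hp1 (by
    rintro rfl
    rcases lt_trichotomy q v with h1 | h1 | h1
    · rcases eq_or_lt_of_le hq1 with h2 | h2
      · exact hpq.1 (by rw [h2])
      · exact h.ncls q h2 h1 hpq.rel
    · have i1 := c.mem_Icc hxS
      have i2 := c.mem_Icc hyS
      have := mul_pos_of_neg_of_neg (mul_neg_of_pos_of_neg (show 0 < x - u by linarith)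
        (show x - q < 0 by linarith)) (mul_neg_of_pos_of_neg (show 0 < y - u by linarith)
        (show y - q < 0 by linarith))
      linarith
    · have i1 := c.mem_Icc hxS
      have i2 := c.mem_Icc hyS
      have := mul_pos_of_neg_of_neg (mul_neg_of_pos_of_neg (show 0 < x - u by linarith)
        (show x - q < 0 by linarith)) (mul_neg_of_pos_of_neg (show 0 < y - u by linarith)
        (show y - q < 0 by linarith))
      linarith)
  have hqu : u < q := lt_of_le_of_ne hq1 (by
    rintro rfl
    rcases lt_trichotomy p v with h1 | h1 | h1
    · exact h.ncls p hpu h1 (r.symm' hpq.rel)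
    · have i1 := c.mem_Icc hxS
      have i2 := c.mem_Icc hyS
      have := mul_pos_of_neg_of_neg (mul_neg_of_neg_of_pos (show x - p < 0 by linarith)
        (show 0 < x - u by linarith)) (mul_neg_of_neg_of_pos (show y - p < 0 by linarith)
        (show 0 < y - u by linarith))
      linarith
    · have i1 := c.mem_Icc hxS
      have i2 := c.mem_Icc hyS
      have := mul_pos_of_neg_of_neg (mul_neg_of_neg_of_pos (show x - p < 0 by linarith)
        (show 0 < x - u by linarith)) (mul_neg_of_neg_of_pos (show y - p < 0 by linarith)
        (show 0 < y - u by linarith))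
      linarith)
  have main : ∀ j : ℕ, ((α < (retMap K u v)^[j] p ∧ (retMap K u v)^[j] p < β) ∧
      α < (retMap K u v)^[j] q ∧ (retMap K u v)^[j] q < β) ∧
      InPieces u v ((retMap K u v)^[j] p) ∧ InPieces u v ((retMap K u v)^[j] q) ∧
      ((retMap K u v)^[j] x - (retMap K u v)^[j] p) * ((retMap K u v)^[j] x - (retMap K u v)^[j] q) *
      (((retMap K u v)^[j] y - (retMap K u v)^[j] p) *
        ((retMap K u v)^[j] y - (retMap K u v)^[j] q)) < 0 := by
    intro j
    induction j with
    | zero =>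
      have i1 := c.mem_Icc hxS
      have i2 := c.mem_Icc hyS
      have k1 := h.mem_of_separates_diameter hdiam i1.1 i1.2 i2.1 i2.2 hpu hp2 hqu hq2 hpq.rel hsep
      have k2 := h.inPieces_of_separates (h.core_inPieces c hxS) (h.core_inPieces c hyS) hpq.rel
        hpu (by linarith) hqu (by linarith) hsep
      exact ⟨k1, k2.1, k2.2, hsep⟩
    | succ j ih =>
      obtain ⟨k1, k2, k3, k4⟩ := ih
      have hxj := core_iterate_mem c hxS j
      have hyj := core_iterate_mem c hyS j
      have hxj' := core_iterate_mem c hxS (j + 1)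
      have hyj' := core_iterate_mem c hyS (j + 1)
      have i1 := c.mem_Icc hxj
      have i2 := c.mem_Icc hyj
      have i3 := c.mem_Icc hxj'
      have i4 := c.mem_Icc hyj'
      have hs := h.map_separates (h.core_inPieces c hxj) (h.core_inPieces c hyj) k2 k3
        (by rw [abs_lt]; constructor <;> linarith) (by rw [abs_lt]; constructor <;> linarith)
        (by rw [abs_lt]; constructor <;> linarith) (by rw [abs_lt]; constructor <;> linarith) k4
      have b1 := h.map_mem k2
      have b2 := h.map_mem k3
      simp only [← Function.iterate_succ_apply' (retMap K u v)] at hs b1 b2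
      have hrel : r ((retMap K u v)^[j + 1] p : UnitAddCircle)
          ((retMap K u v)^[j + 1] q : UnitAddCircle) := by
        rw [h.coe_map_iterate, h.coe_map_iterate]; exact h.quad.rel_iterate hpq.rel _
      have k5 := h.mem_of_separates_diameter hdiam i3.1 i3.2 i4.1 i4.2 b1.1 (by linarith) b2.1 (by linarith) hrel hs
      have k6 := h.inPieces_of_separates (h.core_inPieces c hxj') (h.core_inPieces c hyj') hrel
        b1.1 b1.2 b2.1 b2.2 hs
      exact ⟨k5, k6.1, k6.2, hs⟩
  obtain ⟨i, hi⟩ := hF.exists_iterate_eq h.quad h.pos hcl hmaps hnoper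
    (x := p) (y := q) ⟨p, fun j => ⟨(main j).1.1.1.le, (main j).1.1.2.le, (main j).2.1.2.2⟩, rfl⟩
    ⟨q, fun j => ⟨(main j).1.2.1.le, (main j).1.2.2.le, (main j).2.2.1.2.2⟩, rfl⟩ hpq.rel
  rw [← h.coe_map_iterate, ← h.coe_map_iterate] at hi
  obtain ⟨m1, m2, m3, m4⟩ := main i
  have he := eq_of_coe_eq hi (by linarith) (by linarith)
  rw [he] at m4
  nlinarith [mul_nonneg (mul_self_nonneg ((retMap K u v)^[i] x - (retMap K u v)^[i] q))
    (mul_self_nonneg ((retMap K u v)^[i] y - (retMap K u v)^[i] q))]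

/-- If no periodic point stays under the major, then the major is a diameter and an edge of a
Siegel gap. -/
theorem exists_siegel_gap (h : ReturnStrip r n K u v α β)
    (hper : ∀ x ∈ staySet K u v α β, ∀ N : ℕ, 0 < N → (retMap K u v)^[N] x ≠ x) :
    ∃ G : Set UnitAddCircle, IsGap r G ∧ G.Infinite ∧ β = α + 1 / 2 ∧ (α : UnitAddCircle) ∈ G ∧
      (β : UnitAddCircle) ∈ G ∧ dbl^[n] '' G = G ∧ (∀ t ∈ G, ∀ m : ℕ, 0 < m → dbl^[m] t ≠ t) ∧
      HasPeriod G n ∧ IsRotationalOfPeriod G n ∧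
      ∀ t ∈ G, ∃ z : ℝ, (z : UnitAddCircle) = t ∧ InPieces u v z ∧ α ≤ z ∧ z ≤ β := by
  have hK := h.two_le
  have hlen := h.len_le
  have q1 := h.u_lt
  have q2 := h.lt_v
  have q3 := h.u_lt'
  have q4 := h.lt_v'
  have hαβ := h.lt
  have hl := h.quad.lamination
  have hcont : ContinuousOn (retMap K u v) (staySet K u v α β) := fun x hx =>
    (h.continuousAt_map (hx 0).2.2).continuousWithinAt
  obtain ⟨S, hS, hScpt, hSne, hSimg⟩ := exists_isCompact_image_eq h.isCompact_staySet
    h.staySet_nonempty hcont (fun x hx => map_mem_staySet hx)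
  obtain ⟨a, ha⟩ := hScpt.exists_isLeast hSne
  obtain ⟨b, hb⟩ := hScpt.exists_isGreatest hSne
  have c : Core K u v α β S a b := ⟨hS, hSimg, ha, hb⟩
  have hab := h.core_lt c
  have heq : retMap K u v b = retMap K u v a := by
    rcases eq_or_lt_of_le (h.core_map_le c) with h1 | h1
    · exact h1
    obtain ⟨i, hi⟩ := h.core_land c (c.map_mem hb.1) (c.map_mem ha.1) h1 (fun z hz => h.core_gap c hz)
    exact absurd hi (by
      rw [← Function.iterate_succ_apply]; exact hper b (hS hb.1) _ (Nat.succ_pos _))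
  have hhalf : b = a + 1 / 2 := by
    rw [h.map_left (h.core_left c), h.map_right (h.core_right c)] at heq
    have := mul_left_cancel₀ (by linarith : K ≠ 0) (add_left_cancel heq)
    linarith
  obtain ⟨rfl, hβα⟩ := h.eq_left_of_mem (c.mem_Icc ha.1).1 (by rw [← hhalf]; exact (c.mem_Icc hb.1).2)
  have hbβ : b = β := by linarith
  subst hbβ
  have hM := h.major.1
  have hnoper : ∀ t ∈ ((↑) : ℝ → UnitAddCircle) '' staySet K u v a b, ∀ m : ℕ, 0 < m →
      dbl^[m] t ≠ t := by
    rintro _ ⟨x, hx, rfl⟩ m hm he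
    refine hper x hx m hm ?_
    have h1 : dbl^[n * m] (x : UnitAddCircle) = x := by
      rw [mul_comm, Function.iterate_mul]; exact Function.iterate_fixed he n
    rw [← h.coe_map_iterate] at h1
    have i1 := hx 0
    have i2 := hx m
    simp only [Function.iterate_zero, id] at i1
    exact eq_of_coe_eq h1 (by linarith) (by linarith)
  have hfcoe : ∀ T : Set ℝ, dbl^[n] '' (((↑) : ℝ → UnitAddCircle) '' T) =
      ((↑) : ℝ → UnitAddCircle) '' (retMap K u v '' T) := fun T => by
    rw [image_image, image_image]; exact image_congr fun x _ => (h.coe_map x).symm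
  have himg : dbl^[n] '' (((↑) : ℝ → UnitAddCircle) '' S) = ((↑) : ℝ → UnitAddCircle) '' S := by
    rw [hfcoe, hSimg]
  have hmaps : MapsTo dbl^[n] (((↑) : ℝ → UnitAddCircle) '' staySet K u v a b)
      (((↑) : ℝ → UnitAddCircle) '' staySet K u v a b) := by
    rw [mapsTo_iff_image_subset, hfcoe]
    apply image_mono
    rintro _ ⟨x, hx, rfl⟩; exact map_mem_staySet hx
  have hcl : IsClosed (((↑) : ℝ → UnitAddCircle) '' staySet K u v a b) :=
    (h.isCompact_staySet.image (AddCircle.continuous_mk' (1 : ℝ))).isClosed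
  have hGcl : IsClosed (((↑) : ℝ → UnitAddCircle) '' S) :=
    (hScpt.image (AddCircle.continuous_mk' (1 : ℝ))).isClosed
  have hGsub : ((↑) : ℝ → UnitAddCircle) '' S ⊆ ((↑) : ℝ → UnitAddCircle) '' staySet K u v a b :=
    image_mono hS
  have hGne : (((↑) : ℝ → UnitAddCircle) '' S).Nonempty := hSne.image _
  have hGmaps : MapsTo dbl^[n] (((↑) : ℝ → UnitAddCircle) '' S) (((↑) : ℝ → UnitAddCircle) '' S) :=
    mapsTo_iff_image_subset.2 himg.subset
  have hinf : (((↑) : ℝ → UnitAddCircle) '' S).Infinite := by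
    intro hfin
    obtain ⟨t, ht, m, hm, hp⟩ := exists_periodic_of_finite hfin hGmaps hGne
    exact hnoper t (hGsub ht) _ (Nat.mul_pos h.pos hm) hp
  obtain ⟨F, hF⟩ := h.exists_isLiftOn (A := ((↑) : ℝ → UnitAddCircle) '' staySet K u v a b)
    (x := a) q1 (by linarith) (by
      rintro _ ⟨z, hz, rfl⟩
      have hz0 := hz 0
      simp only [Function.iterate_zero, id] at hz0
      refine ⟨z, rfl, inPieces_of_mem q1 q4 hz, hz0.1, fun h1 => ?_⟩
      rw [← heq, h.map_right h1, h.map_right q3]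
      nlinarith [hz0.2.1])
  have hGap : IsGap r (((↑) : ℝ → UnitAddCircle) '' S) := by
    refine ⟨hGcl, by rw [hinf.encard_eq]; exact le_top, ?_, ?_⟩
    · intro p q hpq
      obtain ⟨g, hg, rfl⟩ := hpq.1
      obtain ⟨g', hg', rfl⟩ := hpq.2.1
      have hi := c.mem_Icc hg
      have hi' := c.mem_Icc hg'
      rcases lt_or_ge g g' with hlt | hge
      · rw [isHole_coe_iff hlt (by linarith)] at hpq
        exact h.core_isLeaf hβα c hg hg' hlt fun z hz hz' => hpq.2.2 z hz'.1 hz'.2 ⟨z, hz, rfl⟩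
      · rw [← coe_add_one' g', isHole_coe_iff (by linarith) (by linarith)] at hpq
        have e1 : g = b := by
          by_contra h1
          have := lt_of_le_of_ne hi.2 h1
          exact hpq.2.2 b this (by linarith) ⟨b, hb.1, rfl⟩
        have e2 : g' = a := by
          by_contra h1
          have := lt_of_le_of_ne hi'.1 (Ne.symm h1)
          exact hpq.2.2 (a + 1) (by linarith) (by linarith) ⟨a, ha.1, (coe_add_one' a).symm⟩
        rw [e1, e2]; exact hM.symm
    · intro p q hpq
      by_contra hcon
      simp only [not_or, Set.not_disjoint_iff] at hcon
      obtain ⟨⟨_, hx, x, hxS, rfl⟩, ⟨_, hy, y, hyS, rfl⟩⟩ := hcon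
      exact h.core_not_separated hβα c hF hcl hmaps hnoper hpq hxS hyS hx hy
  have hrep : ∀ t ∈ ((↑) : ℝ → UnitAddCircle) '' S, ∃ z : ℝ, (z : UnitAddCircle) = t ∧
      InPieces u v z ∧ a ≤ z ∧ z ≤ b := by
    rintro _ ⟨z, hz, rfl⟩
    exact ⟨z, rfl, h.core_inPieces c hz, c.mem_Icc hz⟩
  refine ⟨_, hGap, hinf, hβα, ⟨a, ha.1, rfl⟩, ⟨b, hb.1, rfl⟩, himg, fun t ht => hnoper t (hGsub ht),
    h.hasPeriod hGne (fun t ht => ?_) himg, Or.inr ⟨hinf, F.translationNumber,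
      ⟨F, fun t ht => hF t (hGsub ht), rfl⟩,
      (hF.mono hGsub).irrational h.pos hGcl hGmaps hGne fun t ht => hnoper t (hGsub ht)⟩, hrep⟩
  obtain ⟨z, hz, hzp, -⟩ := hrep t ht
  exact ⟨z, hz, hzp⟩

/-- The strip contains a periodic rotational set. -/
theorem exists_rotationalSet (h : ReturnStrip r n K u v α β) :
    ∃ A : Set UnitAddCircle, IsPeriodicRotationalSet r A ∧ A.Nonempty ∧
      ∀ t ∈ A, ∃ z : ℝ, (z : UnitAddCircle) = t ∧ InPieces u v z := by
  by_cases hper : ∃ x ∈ staySet K u v α β, ∃ N : ℕ, 0 < N ∧ (retMap K u v)^[N] x = x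
  · obtain ⟨x, hx, N, hN, hxN⟩ := hper
    obtain ⟨a, h1, h2, h3, h4, h5⟩ := h.exists_rotational_class hx hN hxN
    refine ⟨_, ⟨isLeafOrGap_lamClass h.quad.lamination h1, n, h3, h4⟩, h1.nonempty, fun t ht => ?_⟩
    obtain ⟨z, hz, hzp, -⟩ := h5 t ht
    exact ⟨z, hz, hzp⟩
  · push Not at hper
    obtain ⟨G, h1, h2, h3, h4, h5, h6, h7, h8, h9, h10⟩ := h.exists_siegel_gap hper
    refine ⟨_, ⟨Or.inr h1, n, h8, h9⟩, ⟨_, h4⟩, fun t ht => ?_⟩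
    obtain ⟨z, hz, hzp, -⟩ := h10 t ht
    exact ⟨z, hz, hzp⟩

end ReturnStrip

/-! ### Finite rotational sets -/

theorem arcLen_dbl_of_le {a b : UnitAddCircle} (h : arcLen a b ≤ 1 / 2) :
    arcLen (dbl a) (dbl b) = 2 * arcLen a b := by
  obtain ⟨x, y, h1, h2, rfl, rfl⟩ := exists_coe_pair a b
  rw [arcLen_coe h1 h2] at h ⊢
  rw [dbl_coe, dbl_coe, arcLen_coe (by linarith) (by linarith)]; ring

theorem arcLen_dbl_of_gt {a b : UnitAddCircle} (h : 1 / 2 < arcLen a b) :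
    arcLen (dbl a) (dbl b) = 2 * arcLen a b - 1 := by
  obtain ⟨x, y, h1, h2, rfl, rfl⟩ := exists_coe_pair a b
  rw [arcLen_coe h1 h2] at h ⊢
  rw [dbl_coe, dbl_coe, ← coe_sub_one' (2 * y), arcLen_coe (by linarith) (by linarith)]; ring

theorem image_iterate_eq {A : Set UnitAddCircle} (h : dbl '' A = A) (n : ℕ) : dbl^[n] '' A = A := by
  induction n with
  | zero => simp
  | succ n ih => rw [Function.iterate_succ, image_comp, h, ih]

theorem exists_int_mul {n : ℕ} {z : ℝ} (hz : dbl^[n] (z : UnitAddCircle) = z) :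
    ∃ m : ℤ, (2 ^ n - 1) * z = m := by
  rw [dbl_iterate_coe, coe_eq_coe_iff_exists_int] at hz
  obtain ⟨k, hk⟩ := hz
  exact ⟨k, by linarith⟩

/-- A finite set rotated by doubling: its points in the fundamental interval `(0, 1)` lie between
`x` and `y`, and holes are mapped to holes. The long hole is the one from `y` to `x`, which contains
the fixed point. -/
structure FiniteRotation (G : Set UnitAddCircle) (x y : ℝ) : Prop where
  finite : G.Finite
  image : dbl '' G = G
  holes : ∀ a b, IsHole G a b → IsHole G (dbl a) (dbl b)
  left_mem : (x : UnitAddCircle) ∈ G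
  right_mem : (y : UnitAddCircle) ∈ G
  pos : 0 < x
  lt_one : y < 1
  lt_half : y - x < 1 / 2
  two_mul_le : 2 * x ≤ y
  le_two_mul : x ≤ 2 * y - 1
  mem : ∀ z : ℝ, 0 ≤ z → z < 1 → (z : UnitAddCircle) ∈ G → x ≤ z ∧ z ≤ y

theorem exists_finiteRotation {G : Set UnitAddCircle} (hfin : G.Finite) (himg : dbl '' G = G)
    (hnt : G.Nontrivial) (h0 : (0 : UnitAddCircle) ∉ G)
    (hholes : ∀ a b, IsHole G a b → IsHole G (dbl a) (dbl b)) : ∃ x y, FiniteRotation G x y := by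
  have hmapG : ∀ t ∈ G, dbl t ∈ G := fun t ht => by rw [← himg]; exact ⟨t, ht, rfl⟩
  have hinj := injOn_of_image_eq hfin himg
  have hΓ : {z : ℝ | (0 ≤ z ∧ z < 1) ∧ (z : UnitAddCircle) ∈ G}.Finite :=
    Set.Finite.of_injOn (f := fun z : ℝ => (z : UnitAddCircle)) (t := G)
      (fun z hz => hz.2) (fun z hz z' hz' he =>
        eq_of_coe_eq he (by linarith [hz.1.2, hz'.1.1]) (by linarith [hz.1.1, hz'.1.2])) hfin
  obtain ⟨t, ht⟩ := hnt.nonempty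
  obtain ⟨z₀, hz1, hz2, rfl⟩ := exists_coe_Ico 0 t
  rw [zero_add] at hz2
  obtain ⟨x, ⟨hx1, hxG⟩, hxmin⟩ := Set.exists_min_image _ id hΓ ⟨z₀, ⟨hz1, hz2⟩, ht⟩
  obtain ⟨y, ⟨hy1, hyG⟩, hymax⟩ := Set.exists_max_image _ id hΓ ⟨z₀, ⟨hz1, hz2⟩, ht⟩
  simp only [id] at hxmin hymax
  have hmem : ∀ z : ℝ, 0 ≤ z → z < 1 → (z : UnitAddCircle) ∈ G → x ≤ z ∧ z ≤ y := fun z h1 h2 h3 =>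
    ⟨hxmin z ⟨⟨h1, h2⟩, h3⟩, hymax z ⟨⟨h1, h2⟩, h3⟩⟩
  have hx0 : 0 < x := lt_of_le_of_ne hx1.1 (by rintro rfl; exact h0 hxG)
  have hhalf : ((1 / 2 : ℝ) : UnitAddCircle) ∉ G := by
    intro h
    have := hmapG _ h
    rw [dbl_coe, show (2 * (1 / 2) : ℝ) = 0 + 1 by norm_num, coe_add_one'] at this
    exact h0 this
  have hxhalf : x < 1 / 2 := by
    rcases lt_trichotomy x (1 / 2) with h | h | h
    · exact h
    · rw [h] at hxG; exact absurd hxG hhalf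
    · have h1 := hmapG _ hxG
      rw [dbl_coe, ← coe_sub_one'] at h1
      have := (hmem _ (by linarith) (by linarith [hx1.2]) h1).1
      linarith [hx1.2]
  have hyhalf : 1 / 2 < y := by
    rcases lt_trichotomy y (1 / 2) with h | h | h
    · have h1 := hmapG _ hyG
      rw [dbl_coe] at h1
      have h2 := (hmem y hy1.1 hy1.2 hyG).1
      have := (hmem _ (by linarith) (by linarith) h1).2
      linarith
    · rw [h] at hyG; exact absurd hyG hhalf
    · exact h
  have h2x := hmapG _ hxG
  have h2y := hmapG _ hyG
  rw [dbl_coe] at h2x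
  rw [dbl_coe, ← coe_sub_one'] at h2y
  have h2x' := hmem _ (by linarith) (by linarith) h2x
  have h2y' := hmem _ (by linarith) (by linarith [hy1.2]) h2y
  refine ⟨x, y, hfin, himg, hholes, hxG, hyG, hx0, hy1.2, ?_, h2x'.2, h2y'.1, hmem⟩
  have hhole : IsHole G y x := by
    rw [← coe_add_one' x, isHole_coe_iff (by linarith [hy1.2]) (by linarith), coe_add_one']
    refine ⟨hyG, hxG, fun z h1 h2 hz => ?_⟩
    rcases lt_or_ge z 1 with h3 | h3
    · linarith [(hmem z (by linarith) h3 hz).2]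
    · rw [← coe_sub_one'] at hz
      linarith [(hmem (z - 1) (by linarith) (by linarith [hy1.2]) hz).1]
  have h1 := hholes _ _ hhole
  by_contra hcon
  rcases eq_or_lt_of_le (not_lt.1 hcon) with h2 | h2
  · have : dbl (x : UnitAddCircle) = dbl y := by
      rw [← dbl_add_half]; congr 2; linarith
    have := eq_of_coe_eq (hinj hxG hyG this) (by linarith) (by linarith [hy1.2, hx1.1])
    linarith
  · rw [dbl_coe, dbl_coe, ← coe_sub_one' (2 * y), ← coe_add_one' (2 * x),
      isHole_coe_iff (by linarith [hy1.2]) (by linarith)] at h1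
    exact h1.2.2 y (by linarith [hy1.2]) (by linarith [hy1.2]) hyG

namespace FiniteRotation
variable {G : Set UnitAddCircle} {x y : ℝ}

theorem injOn (h : FiniteRotation G x y) (n : ℕ) : InjOn dbl^[n] G :=
  injOn_of_image_eq h.finite (image_iterate_eq h.image n)

theorem map_mem (h : FiniteRotation G x y) {t : UnitAddCircle} (ht : t ∈ G) : dbl t ∈ G := by
  rw [← h.image]; exact ⟨t, ht, rfl⟩

theorem iterate_mem (h : FiniteRotation G x y) {t : UnitAddCircle} (ht : t ∈ G) (n : ℕ) :
    dbl^[n] t ∈ G := by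
  rw [← image_iterate_eq h.image n]; exact ⟨t, ht, rfl⟩

theorem third_le (h : FiniteRotation G x y) : 1 / 3 ≤ y - x := by
  linarith [h.two_mul_le, h.le_two_mul]

theorem notMem (h : FiniteRotation G x y) {z : ℝ} (h1 : y < z) (h2 : z < x + 1) :
    (z : UnitAddCircle) ∉ G := by
  intro hz
  have := h.third_le
  have := h.pos
  rcases lt_or_ge z 1 with h3 | h3
  · linarith [(h.mem z (by linarith) h3 hz).2]
  · rw [← coe_sub_one'] at hz
    linarith [(h.mem (z - 1) (by linarith) (by linarith [h.lt_one, h.lt_half]) hz).1]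

theorem isHole (h : FiniteRotation G x y) : IsHole G y x := by
  have := h.third_le
  rw [← coe_add_one' x, isHole_coe_iff (by linarith [h.lt_half]) (by linarith), coe_add_one']
  exact ⟨h.right_mem, h.left_mem, fun z h1 h2 => h.notMem h1 h2⟩

theorem exists_periodic (h : FiniteRotation G x y) {t : UnitAddCircle} (ht : t ∈ G) :
    ∃ m, 0 < m ∧ dbl^[m] t = t := by
  have := h.finite.to_subtype
  obtain ⟨i, j, hij, he⟩ := Finite.exists_ne_map_eq_of_infinite
    (fun i : ℕ => (⟨_, h.iterate_mem ht i⟩ : G))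
  have he := congrArg Subtype.val he
  simp only at he
  have key : ∀ i j : ℕ, i < j → dbl^[i] t = dbl^[j] t → ∃ m, 0 < m ∧ dbl^[m] t = t := by
    intro i j hij he
    refine ⟨j - i, by omega, (h.injOn i ht (h.iterate_mem ht _) ?_).symm⟩
    rw [← Function.iterate_add_apply, Nat.add_sub_cancel' hij.le, he]
  rcases lt_or_gt_of_ne hij with h1 | h1
  · exact key i j h1 he
  · exact key j i h1 he.symm

theorem isHole_iterate (h : FiniteRotation G x y) {a b : UnitAddCircle} (hab : IsHole G a b) (k : ℕ) :
    IsHole G (dbl^[k] a) (dbl^[k] b) := by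
  induction k with
  | zero => exact hab
  | succ k ih => rw [Function.iterate_succ_apply', Function.iterate_succ_apply']; exact h.holes _ _ ih

/-- All holes but one are short. -/
theorem arcLen_le (h : FiniteRotation G x y) {a b : UnitAddCircle} (hab : IsHole G a b)
    (ha : a ≠ y) : arcLen a b ≤ y - x := by
  obtain ⟨c, h1, h2, rfl⟩ := exists_coe_Ico 0 a
  have hc := h.mem c h1 (by linarith) hab.1
  have hcy : c < y := lt_of_le_of_ne hc.2 (by rintro rfl; exact ha rfl)
  obtain ⟨d, h3, h4, rfl⟩ := exists_coe_Ioc c b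
  rw [isHole_coe_iff h3 h4] at hab
  have : d ≤ y := by
    by_contra h5
    exact hab.2.2 y hcy (by linarith) h.right_mem
  rw [arcLen_coe h3 h4]; linarith

/-- Holes are mapped onto the long hole. -/
theorem exists_iterate_eq (h : FiniteRotation G x y) {a b : UnitAddCircle} (hab : IsHole G a b) :
    ∃ k, dbl^[k] a = y ∧ dbl^[k] b = x := by
  suffices hs : ∃ k, dbl^[k] a = y by
    obtain ⟨k, hk⟩ := hs
    have := h.isHole_iterate hab k
    rw [hk] at this
    exact ⟨k, hk, this.right_unique h.isHole⟩
  by_contra hcon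
  push Not at hcon
  have hlen : ∀ k, arcLen (dbl^[k] a) (dbl^[k] b) = 2 ^ k * arcLen a b := fun k => by
    induction k with
    | zero => simp
    | succ k ih =>
      have := h.arcLen_le (h.isHole_iterate hab k) (hcon k)
      rw [Function.iterate_succ_apply', Function.iterate_succ_apply',
        arcLen_dbl_of_le (by linarith [h.lt_half]), ih, pow_succ]; ring
  obtain ⟨k, hk⟩ := pow_unbounded_of_one_lt (1 / arcLen a b) (by norm_num : (1 : ℝ) < 2)
  rw [div_lt_iff₀ (arcLen_pos a b), ← hlen k] at hk
  linarith [arcLen_le_one (dbl^[k] a) (dbl^[k] b)]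

theorem exists_period (h : FiniteRotation G x y) : ∃ n, 0 < n ∧
    dbl^[n] (y : UnitAddCircle) = y ∧ dbl^[n] (x : UnitAddCircle) = x ∧
    (∀ k, 0 < k → k < n → dbl^[k] (y : UnitAddCircle) ≠ y) ∧
    (1 - (y - x)) * (2 ^ n - 1) = 2 ^ n / 2 := by
  classical
  have hex := h.exists_periodic h.right_mem
  obtain ⟨hn0, hn⟩ := Nat.find_spec hex
  have hmin : ∀ k, 0 < k → k < Nat.find hex → dbl^[k] (y : UnitAddCircle) ≠ y := fun k h1 h2 h3 =>
    Nat.find_min hex h2 ⟨h1, h3⟩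
  generalize Nat.find hex = n at *
  have hx : dbl^[n] (x : UnitAddCircle) = x := by
    have := h.isHole_iterate h.isHole n
    rw [hn] at this
    exact this.right_unique h.isHole
  refine ⟨n, hn0, hn, hx, hmin, ?_⟩
  have hL : arcLen (y : UnitAddCircle) x = 1 - (y - x) := by
    rw [← coe_add_one' x, arcLen_coe (by linarith [h.lt_half]) (by linarith [h.third_le])]; ring
  have hlen : ∀ k, k < n → arcLen (dbl^[k + 1] (y : UnitAddCircle)) (dbl^[k + 1] (x : UnitAddCircle)) =
      2 ^ k * (2 * (1 - (y - x)) - 1) := fun k => by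
    induction k with
    | zero =>
      intro _
      simp only [zero_add, Function.iterate_one, pow_zero, one_mul]
      rw [arcLen_dbl_of_gt (by rw [hL]; linarith [h.lt_half]), hL]
    | succ k ih =>
      intro hk
      have := h.arcLen_le (h.isHole_iterate h.isHole (k + 1)) (hmin (k + 1) (by omega) hk)
      rw [Function.iterate_succ_apply' _ (k + 1), Function.iterate_succ_apply' _ (k + 1),
        arcLen_dbl_of_le (by linarith [h.lt_half]), ih (by omega), pow_succ]; ring
  have := hlen (n - 1) (by omega)
  rw [Nat.sub_add_cancel hn0, hn, hx, hL] at this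
  have h2 : (2 : ℝ) ^ n = 2 * 2 ^ (n - 1) := by rw [← pow_succ']; congr 1; omega
  rw [h2]; linarith

/-- The orbit of a point of the hole opposite to the fixed point leaves the closed half circle
between the two halves of this point. -/
theorem exists_iterate_notMem (h : FiniteRotation G x y) {z : ℝ} (h1 : 2 * y - 1 < z)
    (h2 : z < 2 * x) : ∃ j, ∀ w : ℝ, z / 2 ≤ w → w ≤ z / 2 + 1 / 2 →
      dbl^[j] (z : UnitAddCircle) ≠ w := by
  obtain ⟨n, hn, hy, hx, -, hlen⟩ := h.exists_period
  obtain ⟨m, hm⟩ := exists_int_mul hy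
  refine ⟨n - 1, fun w hw1 hw2 he => ?_⟩
  have hK : (2 : ℝ) ^ n = 2 * 2 ^ (n - 1) := by rw [← pow_succ']; congr 1; omega
  have hK1 : (1 : ℝ) ≤ 2 ^ (n - 1) := one_le_pow₀ (by norm_num)
  rw [dbl_iterate_coe] at he
  obtain ⟨k, hk⟩ := coe_eq_coe_iff_exists_int.1 he
  rw [hK] at hm hlen
  have hx0 := h.pos
  have hy1 := h.lt_one
  have hhalf := h.lt_half
  have hthird := h.third_le
  obtain ⟨Q, hQ⟩ : ∃ Q : ℤ, (Q : ℝ) = 2 ^ (n - 1) := ⟨2 ^ (n - 1), by push_cast; rfl⟩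
  rw [← hQ] at hm hlen hk hK1
  -- the iterate is `y + Q (z - (2 y - 1))` up to an integer
  have e1 : w = y + Q * (z - (2 * y - 1)) + (m - Q - k : ℤ) := by push_cast; linarith
  have l1 : y < y + Q * (z - (2 * y - 1)) := by nlinarith
  have l2 : y + Q * (z - (2 * y - 1)) < x + 1 := by
    have : (Q : ℝ) * (2 * x - (2 * y - 1)) = 1 - (y - x) := by linarith
    nlinarith
  have hj : m - Q - k = 0 ∨ m - Q - k = -1 := by
    have a1 : ((m - Q - k : ℤ) : ℝ) < 1 := by linarith
    have a2 : (-2 : ℝ) < ((m - Q - k : ℤ) : ℝ) := by linarith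
    have a3 : m - Q - k < 1 := by exact_mod_cast a1
    have a4 : -2 < m - Q - k := by exact_mod_cast a2
    omega
  rcases hj with hj | hj
  · rw [hj] at e1; push_cast at e1
    nlinarith
  · rw [hj] at e1; push_cast at e1
    have : (Q : ℝ) * (2 * x - (2 * y - 1)) = 1 - (y - x) := by linarith
    nlinarith

/-- If a rotational class is fixed, and the major is not one of its edges, then the strip between
the long edge of the class and its translate contains a second periodic rotational set. -/
theorem exists_rotationalSet_ne {r : Setoid UnitAddCircle} (hr : IsQuadraticLamination r)
    (h : FiniteRotation G x y) (hG : lamClass r x = G) {α β : ℝ} (hM : IsMajor r α β) (hα : α < x)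
    (hβ : y < β) (hαβ : β - α ≤ 1 / 2) : ∃ A, IsPeriodicRotationalSet r A ∧ A ≠ G := by
  obtain ⟨n, hn, hy, hx, hmin, hlen⟩ := h.exists_period
  have hx0 := h.pos
  have hy1 := h.lt_one
  have hhalf := h.lt_half
  have hthird := h.third_le
  have hyx : r y x := by
    have : (y : UnitAddCircle) ∈ lamClass r x := by rw [hG]; exact h.right_mem
    exact r.symm' this
  have hleaf : IsLeaf r y x := by
    refine isLeaf_of_isHole (x := (x : UnitAddCircle)) (fun he => ?_) (by rw [hG]; exact h.isHole)
    have := eq_of_coe_eq he (by linarith) (by linarith); linarith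
  have hs : ReturnStrip r n (2 ^ n) y (x + 1) (α + 1 / 2) (β + 1 / 2) := by
    refine ⟨hr, hn, rfl, by rw [coe_add_one']; exact hyx, by linarith, exists_int_mul hy, ?_, ?_,
      hr.isMajor_add_half hM, by linarith, by linarith, by linarith, by linarith, by linarith, ?_⟩
    · intro c d h1 h2 h3 h4 hcd
      rw [← coe_add_one' x] at hleaf
      exact hr.lamination.leaf_pair_coe hleaf hcd h1 h2 h3 h4
    · intro t h1 h2 ht
      refine h.notMem h1 h2 ?_
      rw [← hG]; exact r.trans' (r.symm' hyx) ht
    · intro k hk hkn X Y hX hY1 hY2 he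
      have hX' : dbl (X : UnitAddCircle) ∈ openArc (dbl (y : UnitAddCircle)) (dbl (x : UnitAddCircle)) := by
        rw [dbl_coe, dbl_coe, dbl_coe, ← coe_add_one' (2 * x), mem_openArc_iff (by linarith) (by linarith)]
        rcases hX.2.2 with h1 | h1
        · exact ⟨2 * X, by linarith [hX.1], by linarith, rfl⟩
        · exact ⟨2 * X - 1, by linarith, by linarith [hX.2.1], coe_sub_one' _⟩
      have hk' : ∀ k, k + 1 < n → dbl^[k + 1] (X : UnitAddCircle) ∈
          openArc (dbl^[k + 1] (y : UnitAddCircle)) (dbl^[k + 1] (x : UnitAddCircle)) := by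
        intro k
        induction k with
        | zero => intro _; exact hX'
        | succ k ih =>
          intro hk
          rw [Function.iterate_succ_apply' _ (k + 1), Function.iterate_succ_apply' _ (k + 1),
            Function.iterate_succ_apply' _ (k + 1)]
          refine dbl_mem_openArc ?_ (ih (by omega))
          have := h.arcLen_le (h.isHole_iterate h.isHole (k + 1)) (hmin _ (by omega) (by omega))
          linarith
      have h1 := hk' (k - 1) (by omega)
      rw [Nat.sub_add_cancel hk, dbl_iterate_coe k X, he] at h1
      refine Set.disjoint_left.1 ((h.isHole_iterate h.isHole k).disjoint h.isHole (hmin k hk hkn)) h1 ?_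
      rw [← coe_add_one' x]
      exact coe_mem_openArc hY1 hY2 (by linarith)
  obtain ⟨A, hA, ⟨t, ht⟩, hrep⟩ := hs.exists_rotationalSet
  refine ⟨A, hA, ?_⟩
  rintro rfl
  obtain ⟨z, rfl, hz⟩ := hrep t ht
  exact h.notMem hz.1 hz.2.1 ht

end FiniteRotation

/-! ### The lamination generated by a finite rotational set -/

/-- A set which has representatives in an interval shorter than `1/2` is mapped in an orientation
preserving and covering fashion by doubling. -/
theorem isHole_dbl_of_lt_half {C : Set UnitAddCircle} {z₀ : ℝ}
    (hC : ∀ t ∈ C, ∃ z : ℝ, (z : UnitAddCircle) = t ∧ z₀ ≤ z ∧ z < z₀ + 1 / 2)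
    {a b : UnitAddCircle} (h : IsHole C a b) : IsHole (dbl '' C) (dbl a) (dbl b) := by
  obtain ⟨a, rfl, ha1, ha2⟩ := hC a h.1
  obtain ⟨b, rfl, hb1, hb2⟩ := hC b h.2.1
  have key : ∀ z : ℝ, (z : UnitAddCircle) ∈ dbl '' C → 2 * z₀ ≤ z → z < 2 * z₀ + 2 →
      ∃ c : ℝ, (c : UnitAddCircle) ∈ C ∧ z₀ ≤ c ∧ c < z₀ + 1 / 2 ∧ (z = 2 * c ∨ z = 2 * c + 1) := by
    rintro z ⟨t, ht, he⟩ h1 h2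
    obtain ⟨c, rfl, hc1, hc2⟩ := hC t ht
    rw [dbl_coe] at he
    obtain ⟨k, hk⟩ := coe_eq_coe_iff_exists_int.1 he
    refine ⟨c, ht, hc1, hc2, ?_⟩
    have a1 : (k : ℝ) < 1 := by linarith
    have a2 : (-2 : ℝ) < k := by linarith
    have a3 : k < 1 := by exact_mod_cast a1
    have a4 : -2 < k := by exact_mod_cast a2
    have : k = 0 ∨ k = -1 := by omega
    rcases this with rfl | rfl
    · left; push_cast at hk; linarith
    · right; push_cast at hk; linarith
  rcases lt_or_ge a b with hab | hab
  · rw [isHole_coe_iff hab (by linarith)] at h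
    rw [dbl_coe, dbl_coe, isHole_coe_iff (by linarith) (by linarith), ← dbl_coe, ← dbl_coe]
    refine ⟨⟨_, h.1, rfl⟩, ⟨_, h.2.1, rfl⟩, fun z h1 h2 hz => ?_⟩
    obtain ⟨c, hc, hc1, hc2, he | he⟩ := key z hz (by linarith) (by linarith)
    · exact h.2.2 c (by linarith) (by linarith) hc
    · linarith
  · rw [← coe_add_one' b, isHole_coe_iff (by linarith) (by linarith), coe_add_one'] at h
    rw [dbl_coe, dbl_coe, ← coe_add_one' (2 * b), isHole_coe_iff (by linarith) (by linarith),
      coe_add_one', ← dbl_coe, ← dbl_coe]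
    refine ⟨⟨_, h.1, rfl⟩, ⟨_, h.2.1, rfl⟩, fun z h1 h2 hz => ?_⟩
    obtain ⟨c, hc, hc1, hc2, he | he⟩ := key z hz (by linarith) (by linarith)
    · exact h.2.2 c (by linarith) (by linarith) hc
    · refine h.2.2 (c + 1) (by linarith) (by linarith) ?_
      rwa [coe_add_one']

theorem exists_mem_uIcc_of_crossing {a b : ℝ} (hab : |a - b| < 1)
    (hne : (a : UnitAddCircle) ≠ b) {s t : UnitAddCircle}
    (hs : s ∈ openArc a b) (ht : t ∈ openArc b a) :
    ∃ z ∈ uIcc a b, (z : UnitAddCircle) = s ∨ (z : UnitAddCircle) = t := by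
  rw [abs_lt] at hab
  rcases lt_trichotomy a b with h | rfl | h
  · obtain ⟨z, h1, h2, h3⟩ := (mem_openArc_iff h (by linarith)).1 hs
    exact ⟨z, by rw [uIcc_of_le h.le]; exact ⟨h1.le, h2.le⟩, Or.inl h3⟩
  · exact absurd rfl hne
  · obtain ⟨z, h1, h2, h3⟩ := (mem_openArc_iff h (by linarith)).1 ht
    exact ⟨z, by rw [uIcc_of_ge h.le]; exact ⟨h1.le, h2.le⟩, Or.inr h3⟩

/-- The points `a` and `b` of the line are mapped by `2 ^ i` to representatives of points outside
`G` whose image is in `G`, and no earlier image of the interval between them meets `G`. -/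
structure PullbackPair (G : Set UnitAddCircle) (i : ℕ) (a b : ℝ) : Prop where
  left : dbl ((2 ^ i * a : ℝ) : UnitAddCircle) ∈ G
  right : dbl ((2 ^ i * b : ℝ) : UnitAddCircle) ∈ G
  free : ∀ j ≤ i, ∀ t ∈ uIcc a b, ((2 ^ j * t : ℝ) : UnitAddCircle) ∉ G

namespace PullbackPair
variable {G : Set UnitAddCircle} {i k : ℕ} {a b c : ℝ}

theorem symm (h : PullbackPair G i a b) : PullbackPair G i b a :=
  ⟨h.right, h.left, by rw [uIcc_comm]; exact h.free⟩

theorem mono (h : PullbackPair G i a b) (hk : dbl ((2 ^ i * c : ℝ) : UnitAddCircle) ∈ G)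
    (hc : c ∈ uIcc a b) : PullbackPair G i a c :=
  ⟨h.left, hk, fun j hj t ht => h.free j hj t (uIcc_subset_uIcc_left hc ht)⟩

theorem add_int (h : PullbackPair G i a b) (m : ℤ) : PullbackPair G i (a + m) (b + m) := by
  have key : ∀ (j : ℕ) (t : ℝ), ((2 ^ j * (t + m) : ℝ) : UnitAddCircle) = (2 ^ j * t : ℝ) := by
    intro j t
    rw [coe_eq_coe_iff_exists_int]
    exact ⟨2 ^ j * m, by push_cast; ring⟩
  refine ⟨by rw [key]; exact h.left, by rw [key]; exact h.right, fun j hj t ht => ?_⟩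
  have := h.free j hj (t - m) (by
    rw [mem_uIcc] at ht ⊢
    rcases ht with ht | ht
    · left; constructor <;> linarith
    · right; constructor <;> linarith)
  rwa [← key, sub_add_cancel] at this

theorem le_of_mem (h : PullbackPair G i a b) {t : ℝ} (ht : t ∈ uIcc a b)
    (hk : dbl ((2 ^ k * t : ℝ) : UnitAddCircle) ∈ G) : i ≤ k := by
  by_contra hcon
  refine h.free (k + 1) (by omega) t ht ?_
  rwa [dbl_coe, ← mul_assoc, ← pow_succ'] at hk

theorem trans (h : PullbackPair G i a b) (h' : PullbackPair G k b c) : PullbackPair G i a c := by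
  have hik : i = k := le_antisymm (h.le_of_mem right_mem_uIcc h'.left) (h'.le_of_mem left_mem_uIcc h.right)
  subst hik
  refine ⟨h.left, h'.right, fun j hj t ht => ?_⟩
  rcases uIcc_subset_uIcc_union_uIcc ht with h1 | h1
  · exact h.free j hj t h1
  · exact h'.free j hj t h1

theorem two_mul (h : PullbackPair G (i + 1) a b) : PullbackPair G i (2 * a) (2 * b) := by
  have key : ∀ (j : ℕ) (t : ℝ), (2 : ℝ) ^ j * (2 * t) = 2 ^ (j + 1) * t := fun j t => by
    rw [pow_succ]; ring
  refine ⟨by rw [key]; exact h.left, by rw [key]; exact h.right, fun j hj t ht => ?_⟩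
  have := h.free (j + 1) (by omega) (t / 2) (by
    rw [mem_uIcc] at ht ⊢
    rcases ht with ht | ht
    · left; constructor <;> linarith
    · right; constructor <;> linarith)
  rwa [← key, mul_div_cancel₀ _ (two_ne_zero)] at this

theorem of_two_mul (hG : dbl '' G = G) (h : PullbackPair G i (2 * a) (2 * b)) :
    PullbackPair G (i + 1) a b := by
  have key : ∀ (j : ℕ) (t : ℝ), (2 : ℝ) ^ (j + 1) * t = 2 ^ j * (2 * t) := fun j t => by
    rw [pow_succ]; ring
  have hm : ∀ t ∈ uIcc a b, 2 * t ∈ uIcc (2 * a) (2 * b) := fun t ht => by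
    rw [mem_uIcc] at ht ⊢
    rcases ht with ht | ht
    · left; constructor <;> linarith
    · right; constructor <;> linarith
  refine ⟨by rw [key]; exact h.left, by rw [key]; exact h.right, fun j hj t ht hjt => ?_⟩
  cases j with
  | zero =>
    refine h.free 0 (by omega) (2 * t) (hm t ht) ?_
    rw [pow_zero, one_mul] at hjt ⊢
    rw [← dbl_coe, ← hG]; exact ⟨_, hjt, rfl⟩
  | succ j =>
    rw [key] at hjt
    exact h.free j (by omega) (2 * t) (hm t ht) hjt

theorem left_notMem (h : PullbackPair G i a b) : (a : UnitAddCircle) ∉ G := by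
  have := h.free 0 (by omega) a left_mem_uIcc
  simpa using this

theorem right_notMem (h : PullbackPair G i a b) : (b : UnitAddCircle) ∉ G := h.symm.left_notMem

end PullbackPair

namespace FiniteRotation
variable {G : Set UnitAddCircle} {x y : ℝ}

theorem add_half_notMem (h : FiniteRotation G x y) {z : ℝ} (hz : (z : UnitAddCircle) ∈ G) :
    ((z + 1 / 2 : ℝ) : UnitAddCircle) ∉ G := by
  intro h'
  have := eq_of_coe_eq (h.injOn 1 h' hz (dbl_add_half z)) (by linarith) (by linarith)
  linarith

theorem dbl_mem_iff (h : FiniteRotation G x y) {z : ℝ} : dbl (z : UnitAddCircle) ∈ G ↔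
    (z : UnitAddCircle) ∈ G ∨ ((z + 1 / 2 : ℝ) : UnitAddCircle) ∈ G := by
  constructor
  · intro hz
    rw [← h.image] at hz
    obtain ⟨g, hg, he⟩ := hz
    obtain ⟨g, rfl⟩ := exists_coe g
    rcases dbl_eq_dbl_iff.1 he.symm with h1 | h1
    · left; rwa [h1]
    · right
      have : ((z + 1 / 2 : ℝ) : UnitAddCircle) = g := by
        obtain ⟨k, hk⟩ := coe_eq_coe_iff_exists_int.1 h1
        exact coe_eq_coe_iff_exists_int.2 ⟨k + 1, by push_cast; linarith⟩
      rwa [this]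
  · rintro (hz | hz)
    · exact h.map_mem hz
    · rw [← dbl_add_half]; exact h.map_mem hz

/-- The points of the preimage of `G` outside `G` lie between `x + 1 / 2` and `y + 1 / 2`. -/
theorem exists_int_of_dbl_mem (h : FiniteRotation G x y) {z : ℝ} (hz : dbl (z : UnitAddCircle) ∈ G)
    (hz' : (z : UnitAddCircle) ∉ G) : ∃ k : ℤ, x + 1 / 2 ≤ z - k ∧ z - k ≤ y + 1 / 2 := by
  have h1 := (h.dbl_mem_iff.1 hz).resolve_left hz'
  obtain ⟨w, h2, h3, hw⟩ := exists_coe_Ico 0 ((z + 1 / 2 : ℝ) : UnitAddCircle)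
  have h4 := h.mem w h2 (by linarith) (by rw [hw]; exact h1)
  obtain ⟨k, hk⟩ := coe_eq_coe_iff_exists_int.1 hw
  refine ⟨-k - 1, ?_⟩
  push_cast
  constructor <;> linarith [h4.1, h4.2]

theorem pullbackPair_le (h : FiniteRotation G x y) {i : ℕ} {a b : ℝ} (hp : PullbackPair G i a b) :
    2 ^ i * |a - b| ≤ y - x := by
  wlog hab : a ≤ b generalizing a b
  · rw [abs_sub_comm]; exact this hp.symm (by linarith)
  have hi : (0 : ℝ) < 2 ^ i := by positivity
  rw [abs_sub_comm, abs_of_nonneg (by linarith)]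
  have hfree := hp.free i le_rfl
  rw [uIcc_of_le hab] at hfree
  have hfree' : ∀ t, 2 ^ i * a ≤ t → t ≤ 2 ^ i * b → (t : UnitAddCircle) ∉ G := fun t h1 h2 => by
    have := hfree (t / 2 ^ i) ⟨by rw [le_div_iff₀ hi]; linarith, by rw [div_le_iff₀ hi]; linarith⟩
    rwa [mul_div_cancel₀ _ hi.ne'] at this
  have hle : 2 ^ i * a ≤ 2 ^ i * b := by gcongr
  obtain ⟨k, h1, h2⟩ := h.exists_int_of_dbl_mem hp.left (hfree' _ le_rfl hle)
  obtain ⟨l, h3, h4⟩ := h.exists_int_of_dbl_mem hp.right (hfree' _ hle le_rfl)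
  have hlk : l ≤ k := by
    by_contra hcon
    have : (k : ℝ) + 1 ≤ l := by exact_mod_cast (by omega : k + 1 ≤ l)
    refine hfree' (x + 1 + k) (by linarith [h.lt_half]) (by linarith) ?_
    rw [coe_add_intCast, coe_add_one']; exact h.left_mem
  have : (l : ℝ) ≤ k := by exact_mod_cast hlk
  linarith

theorem abs_sub_le (h : FiniteRotation G x y) {i : ℕ} {a b : ℝ} (hp : PullbackPair G i a b) :
    |a - b| ≤ y - x := by
  have h1 := h.pullbackPair_le hp
  have h2 : (1 : ℝ) ≤ 2 ^ i := one_le_pow₀ (by norm_num)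
  nlinarith [abs_nonneg (a - b)]

/-- The equivalence relation generated by a finite rotational set `G`: besides `G`, the classes
are obtained by pulling back `G + 1/2` along arcs whose images avoid `G`. -/
def setoid (_ : FiniteRotation G x y) : Setoid UnitAddCircle where
  r p q := p = q ∨ (p ∈ G ∧ q ∈ G) ∨ ∃ i, ∃ a b : ℝ, (a : UnitAddCircle) = p ∧
    (b : UnitAddCircle) = q ∧ PullbackPair G i a b
  iseqv := by
    refine ⟨fun p => Or.inl rfl, ?_, ?_⟩
    · rintro p q (h1 | h1 | ⟨i, a, b, h1, h2, h3⟩)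
      · exact Or.inl h1.symm
      · exact Or.inr (Or.inl h1.symm)
      · exact Or.inr (Or.inr ⟨i, b, a, h2, h1, h3.symm⟩)
    · rintro p q s (rfl | h1 | ⟨i, a, b, rfl, rfl, h3⟩) (rfl | h1' | ⟨k, c, d, h1', rfl, h3'⟩)
      · exact Or.inl rfl
      · exact Or.inr (Or.inl h1')
      · exact Or.inr (Or.inr ⟨k, c, d, h1', rfl, h3'⟩)
      · exact Or.inr (Or.inl h1)
      · exact Or.inr (Or.inl ⟨h1.1, h1'.2⟩)
      · exact absurd (h1' ▸ h1.2) h3'.left_notMem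
      · exact Or.inr (Or.inr ⟨i, a, b, rfl, rfl, h3⟩)
      · exact absurd h1'.1 h3.right_notMem
      · obtain ⟨m, hm⟩ := coe_eq_coe_iff_exists_int.1 h1'
        have h4 := h3.add_int m
        rw [← hm] at h4
        exact Or.inr (Or.inr ⟨i, a + m, d, coe_add_intCast _ _, rfl, h4.trans h3'⟩)

theorem setoid_cases (h : FiniteRotation G x y) {a : ℝ} {q : UnitAddCircle} (hq : h.setoid a q) :
    (a : UnitAddCircle) = q ∨ ((a : UnitAddCircle) ∈ G ∧ q ∈ G) ∨
      ∃ i, ∃ b : ℝ, (b : UnitAddCircle) = q ∧ PullbackPair G i a b := by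
  rcases hq with h1 | h1 | ⟨i, c, b, h1, rfl, h3⟩
  · exact Or.inl h1
  · exact Or.inr (Or.inl h1)
  · obtain ⟨m, hm⟩ := coe_eq_coe_iff_exists_int.1 h1.symm
    have := h3.add_int m
    rw [← hm] at this
    exact Or.inr (Or.inr ⟨i, b + m, coe_add_intCast _ _, this⟩)

theorem lamClass_setoid (h : FiniteRotation G x y) {p : UnitAddCircle} (hp : p ∈ G) :
    lamClass h.setoid p = G := by
  ext q
  constructor
  · rintro (h1 | h1 | ⟨i, a, b, h1, -, h3⟩)
    · exact h1 ▸ hp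
    · exact h1.2
    · exact absurd (h1 ▸ hp) h3.left_notMem
  · exact fun hq => Or.inr (Or.inl ⟨hp, hq⟩)

theorem dist_le_of_setoid (h : FiniteRotation G x y) {p q : UnitAddCircle} (hpq : h.setoid p q) :
    dist p q ≤ y - x := by
  have hd : ∀ a b : ℝ, |a - b| ≤ y - x → dist (a : UnitAddCircle) b ≤ y - x := fun a b hab => by
    wlog hle : a ≤ b generalizing a b
    · rw [dist_comm]; exact this b a (by rwa [abs_sub_comm]) (by linarith)
    rw [abs_le] at hab
    rw [dist_coe_of_le hle (by linarith [h.lt_half])]; linarith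
  rcases hpq with rfl | ⟨hp, hq⟩ | ⟨i, a, b, rfl, rfl, h3⟩
  · rw [dist_self]; linarith [h.third_le]
  · obtain ⟨a, h1, h2, rfl⟩ := exists_coe_Ico 0 p
    obtain ⟨b, h3, h4, rfl⟩ := exists_coe_Ico 0 q
    have := h.mem a h1 (by linarith) hp
    have := h.mem b h3 (by linarith) hq
    exact hd a b (by rw [abs_le]; constructor <;> linarith)
  · exact hd a b (h.abs_sub_le h3)

theorem exists_lamClass_setoid_subset (h : FiniteRotation G x y) (p : UnitAddCircle) :
    ∃ i, lamClass h.setoid p ⊆ {p} ∪ G ∪ dbl^[i] ⁻¹' G := by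
  obtain ⟨a, rfl⟩ := exists_coe p
  by_cases hex : ∃ i, ∃ b : ℝ, PullbackPair G i a b
  · obtain ⟨i, b, hb⟩ := hex
    refine ⟨i + 1, fun q hq => ?_⟩
    rcases h.setoid_cases hq with h1 | h1 | ⟨k, c, rfl, h3⟩
    · exact Or.inl (Or.inl h1.symm)
    · exact Or.inl (Or.inr h1.2)
    · have hik : i = k := le_antisymm (hb.le_of_mem left_mem_uIcc h3.left)
        (h3.le_of_mem left_mem_uIcc hb.left)
      refine Or.inr ?_
      rw [mem_preimage, Function.iterate_succ_apply', dbl_iterate_coe, hik]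
      exact h3.right
  · refine ⟨0, fun q hq => ?_⟩
    rcases h.setoid_cases hq with h1 | h1 | ⟨k, c, rfl, h3⟩
    · exact Or.inl (Or.inl h1.symm)
    · exact Or.inl (Or.inr h1.2)
    · exact absurd ⟨k, c, h3⟩ hex

theorem finite_lamClass_setoid (h : FiniteRotation G x y) (p : UnitAddCircle) :
    (lamClass h.setoid p).Finite := by
  obtain ⟨i, hi⟩ := h.exists_lamClass_setoid_subset p
  exact (((finite_singleton p).union h.finite).union (finite_dbl_iterate_preimage h.finite i)).subset hi

theorem isClosed_setoid (h : FiniteRotation G x y) :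
    IsClosed {p : UnitAddCircle × UnitAddCircle | h.setoid p.1 p.2} := by
  let F : ℕ → Set UnitAddCircle := fun N => ⋃ i ∈ Iic N, dbl^[i] ⁻¹' G
  have hF : ∀ N, (F N).Finite := fun N =>
    (finite_Iic N).biUnion fun i _ => finite_dbl_iterate_preimage h.finite i
  -- pairs at small distance, or in one of finitely many finite classes
  let S : ℕ → Set (UnitAddCircle × UnitAddCircle) := fun N =>
    {p | dist p.1 p.2 ≤ 1 / 2 ^ N} ∪ {p | h.setoid p.1 p.2} ∩ F N ×ˢ F N
  have hS : ∀ N, IsClosed (S N) := fun N =>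
    (isClosed_le (by fun_prop) continuous_const).union
      (((hF N).prod (hF N)).subset inter_subset_right).isClosed
  have : {p : UnitAddCircle × UnitAddCircle | h.setoid p.1 p.2} = ⋂ N, S N := by
    ext ⟨p, q⟩
    simp only [mem_iInter, Set.mem_ofPred_eq]
    constructor
    · intro hpq N
      by_cases hd : dist p q ≤ 1 / 2 ^ N
      · exact Or.inl hd
      refine Or.inr ⟨hpq, ?_⟩
      have hp2 : (0 : ℝ) < 2 ^ N := by positivity
      rcases hpq with rfl | ⟨h1, h2⟩ | ⟨i, a, b, rfl, rfl, h3⟩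
      · rw [dist_self] at hd; exact absurd (by positivity) hd
      · exact ⟨mem_biUnion (show 0 ∈ Iic N from Nat.zero_le N) h1,
          mem_biUnion (show 0 ∈ Iic N from Nat.zero_le N) h2⟩
      · have hi : i + 1 ≤ N := by
          by_contra hcon
          refine hd (le_trans (b := |a - b|) ?_ ?_)
          · have h4 := h.abs_sub_le h3
            have h5 := h.lt_half
            wlog hle : a ≤ b generalizing a b
            · rw [dist_comm, abs_sub_comm]
              exact this b a h3.symm (by rwa [dist_comm]) (by rwa [abs_sub_comm]) (by linarith)
            rw [abs_le] at h4
            rw [dist_coe_of_le hle (by linarith), abs_sub_comm]; exact le_abs_self _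
          · have h4 := h.pullbackPair_le h3
            have h5 : (2 : ℝ) ^ N ≤ 2 ^ i * 2 := by
              rw [← pow_succ]; exact pow_le_pow_right₀ (by norm_num) (by omega)
            rw [le_div_iff₀ hp2]
            nlinarith [abs_nonneg (a - b), h.lt_half]
        refine ⟨mem_biUnion (show i + 1 ∈ Iic N from hi) ?_, mem_biUnion (show i + 1 ∈ Iic N from hi) ?_⟩
        · rw [mem_preimage, Function.iterate_succ_apply', dbl_iterate_coe]; exact h3.left
        · rw [mem_preimage, Function.iterate_succ_apply', dbl_iterate_coe]; exact h3.right
    · intro hall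
      by_contra hpq
      have hne : p ≠ q := fun he => hpq (Or.inl he)
      obtain ⟨N, hN⟩ := exists_pow_lt_of_lt_one (dist_pos.2 hne) (by norm_num : (1 / 2 : ℝ) < 1)
      rcases hall N with h1 | h1
      · rw [Set.mem_ofPred_eq, ← one_div_pow] at h1; linarith
      · exact hpq h1.1
  rw [this]
  exact isClosed_iInter hS

theorem setoid_unlinked (h : FiniteRotation G x y) (t₁ t₂ t₃ t₄ : UnitAddCircle)
    (h12 : h.setoid t₁ t₂) (h34 : h.setoid t₃ t₄) (h23 : ¬ h.setoid t₂ t₃) (hne : t₁ ≠ t₂) :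
    ¬ (t₃ ∈ openArc t₁ t₂ ∧ t₄ ∈ openArc t₂ t₁) := by
  rintro ⟨h3, h4⟩
  have hne' : t₃ ≠ t₄ := by
    rintro rfl; exact Set.disjoint_left.1 (disjoint_openArc_openArc hne) h3 h4
  obtain ⟨h5, h6⟩ := mem_openArc_swap hne h4 h3
  have hlt : y - x < 1 := by linarith [h.lt_half]
  rcases h12 with he | ⟨h1, h2⟩ | ⟨i, a, b, rfl, rfl, hp⟩
  · exact hne he
  · rcases h34 with he | ⟨h1', h2'⟩ | ⟨k, c, d, rfl, rfl, hq⟩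
    · exact hne' he
    · exact h23 (Or.inr (Or.inl ⟨h2, h1'⟩))
    · obtain ⟨z, hz, he⟩ := exists_mem_uIcc_of_crossing ((h.abs_sub_le hq).trans_lt hlt) hne'
        h6 h5
      refine hq.free 0 (by omega) z hz ?_
      rw [pow_zero, one_mul]
      rcases he with he | he <;> rw [he] <;> assumption
  · obtain ⟨z, hz, he⟩ := exists_mem_uIcc_of_crossing ((h.abs_sub_le hp).trans_lt hlt) hne h3 h4
    rcases h34 with he' | ⟨h1', h2'⟩ | ⟨k, c, d, rfl, rfl, hq⟩
    · exact hne' he'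
    · refine hp.free 0 (by omega) z hz ?_
      rw [pow_zero, one_mul]
      rcases he with he | he <;> rw [he] <;> assumption
    · obtain ⟨w, hw, he'⟩ := exists_mem_uIcc_of_crossing ((h.abs_sub_le hq).trans_lt hlt) hne' h6 h5
      have hlev : ∀ (j : ℕ) (u v : ℝ), (u : UnitAddCircle) = v →
          dbl ((2 ^ j * v : ℝ) : UnitAddCircle) ∈ G → dbl ((2 ^ j * u : ℝ) : UnitAddCircle) ∈ G := by
        intro j u v huv hv
        rwa [← dbl_iterate_coe, huv, dbl_iterate_coe]
      have hz' : dbl ((2 ^ k * z : ℝ) : UnitAddCircle) ∈ G := by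
        rcases he with he | he
        · exact hlev _ _ _ he hq.left
        · exact hlev _ _ _ he hq.right
      have hw' : dbl ((2 ^ i * w : ℝ) : UnitAddCircle) ∈ G := by
        rcases he' with he | he
        · exact hlev _ _ _ he hp.right
        · exact hlev _ _ _ he hp.left
      have hik : i = k := le_antisymm (hp.le_of_mem hz hz') (hq.le_of_mem hw hw')
      subst hik
      have hbz : h.setoid b z := by
        rw [uIcc_comm] at hz
        exact Or.inr (Or.inr ⟨i, b, z, rfl, rfl, hp.symm.mono hz' hz⟩)
      apply h23
      rcases he with he | he
      · rwa [← he]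
      · refine h.setoid.trans' hbz ?_
        rw [he]
        exact Or.inr (Or.inr ⟨i, d, c, rfl, rfl, hq.symm⟩)

theorem setoid_dbl (h : FiniteRotation G x y) {p q : UnitAddCircle} (hpq : h.setoid p q) :
    h.setoid (dbl p) (dbl q) := by
  rcases hpq with rfl | ⟨h1, h2⟩ | ⟨i, a, b, rfl, rfl, hp⟩
  · exact Or.inl rfl
  · exact Or.inr (Or.inl ⟨h.map_mem h1, h.map_mem h2⟩)
  · cases i with
    | zero =>
      have h1 := hp.left
      have h2 := hp.right
      rw [pow_zero, one_mul] at h1 h2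
      exact Or.inr (Or.inl ⟨h1, h2⟩)
    | succ i => exact Or.inr (Or.inr ⟨i, 2 * a, 2 * b, (dbl_coe a).symm, (dbl_coe b).symm, hp.two_mul⟩)

/-- The points of the preimage of `G` outside `G` form one class. -/
theorem setoid_of_dbl_mem (h : FiniteRotation G x y) {p q : UnitAddCircle} (hp : dbl p ∈ G)
    (hp' : p ∉ G) (hq : dbl q ∈ G) (hq' : q ∉ G) : h.setoid p q := by
  obtain ⟨a, rfl⟩ := exists_coe p
  obtain ⟨b, rfl⟩ := exists_coe q
  obtain ⟨k, h1, h2⟩ := h.exists_int_of_dbl_mem hp hp'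
  obtain ⟨l, h3, h4⟩ := h.exists_int_of_dbl_mem hq hq'
  refine Or.inr (Or.inr ⟨0, a - k, b - l, coe_sub_intCast _ _, coe_sub_intCast _ _, ?_, ?_, ?_⟩)
  · rwa [pow_zero, one_mul, coe_sub_intCast]
  · rwa [pow_zero, one_mul, coe_sub_intCast]
  · intro j hj t ht
    obtain rfl : j = 0 := by omega
    rw [pow_zero, one_mul]
    rw [mem_uIcc] at ht
    have := h.lt_half
    rcases ht with ht | ht <;> exact h.notMem (by linarith) (by linarith)

theorem setoid_forward (h : FiniteRotation G x y) (p : UnitAddCircle) :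
    dbl '' lamClass h.setoid p = lamClass h.setoid (dbl p) := by
  refine Subset.antisymm ?_ ?_
  · rintro _ ⟨q, hq, rfl⟩; exact h.setoid_dbl hq
  · intro w hw
    obtain ⟨a, rfl⟩ := exists_coe p
    rw [dbl_coe] at hw
    rcases h.setoid_cases hw with h1 | ⟨h1, h2⟩ | ⟨i, b, rfl, hp⟩
    · exact ⟨a, h.setoid.refl' _, by rw [dbl_coe, h1]⟩
    · have hg : w ∈ dbl '' G := by rw [h.image]; exact h2
      obtain ⟨g, hg, rfl⟩ := hg
      by_cases ha : (a : UnitAddCircle) ∈ G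
      · exact ⟨g, Or.inr (Or.inl ⟨ha, hg⟩), rfl⟩
      · obtain ⟨g, rfl⟩ := exists_coe g
        refine ⟨((g + 1 / 2 : ℝ) : UnitAddCircle), ?_, dbl_add_half g⟩
        refine h.setoid_of_dbl_mem (by rwa [dbl_coe]) ha ?_ (h.add_half_notMem hg)
        rw [dbl_add_half]; exact h.map_mem hg
    · refine ⟨((b / 2 : ℝ) : UnitAddCircle), Or.inr (Or.inr ⟨i + 1, a, b / 2, rfl, rfl, ?_⟩), ?_⟩
      · exact PullbackPair.of_two_mul h.image (by rwa [mul_div_cancel₀ _ two_ne_zero])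
      · rw [dbl_coe, mul_div_cancel₀ _ two_ne_zero]

theorem setoid_covering (h : FiniteRotation G x y) (p : UnitAddCircle) :
    (dbl '' lamClass h.setoid p).Subsingleton ∨ ∀ a b, IsHole (lamClass h.setoid p) a b →
      IsHole (dbl '' lamClass h.setoid p) (dbl a) (dbl b) := by
  by_cases hp : p ∈ G
  · right
    rw [h.lamClass_setoid hp, h.image]
    exact h.holes
  · right
    obtain ⟨a, rfl⟩ := exists_coe p
    have hfin : {z : ℝ | z = a ∨ ∃ i, PullbackPair G i a z}.Finite := by
      refine Set.Finite.of_injOn (f := fun z : ℝ => (z : UnitAddCircle)) ?_ ?_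
        (h.finite_lamClass_setoid a)
      · rintro z (rfl | ⟨i, hi⟩)
        · exact h.setoid.refl' _
        · exact Or.inr (Or.inr ⟨i, a, z, rfl, rfl, hi⟩)
      · have hbd : ∀ z ∈ {z : ℝ | z = a ∨ ∃ i, PullbackPair G i a z}, |a - z| < 1 / 2 := by
          rintro z (rfl | ⟨i, hi⟩)
          · simp
          · exact (h.abs_sub_le hi).trans_lt h.lt_half
        intro z hz w hw he
        have h1 := abs_lt.1 (hbd z hz)
        have h2 := abs_lt.1 (hbd w hw)
        exact eq_of_coe_eq he (by linarith) (by linarith)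
    obtain ⟨m, hm, hmin⟩ := Set.exists_min_image _ id hfin ⟨a, Or.inl rfl⟩
    simp only [id] at hmin
    intro c d hcd
    refine isHole_dbl_of_lt_half (z₀ := m) (fun q hq => ?_) hcd
    have hlt := h.lt_half
    have hq' : ∃ z : ℝ, (z : UnitAddCircle) = q ∧ (z = a ∨ ∃ i, PullbackPair G i a z) := by
      rcases h.setoid_cases hq with h1 | ⟨h1, h2⟩ | ⟨i, b, rfl, hb⟩
      · exact ⟨a, h1, Or.inl rfl⟩
      · exact absurd h1 hp
      · exact ⟨b, rfl, Or.inr ⟨i, hb⟩⟩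
    obtain ⟨z, rfl, hz⟩ := hq'
    refine ⟨z, rfl, hmin z hz, ?_⟩
    rcases hm with rfl | ⟨i, hi⟩
    · rcases hz with rfl | ⟨k, hk⟩
      · linarith
      · linarith [(abs_le.1 (h.abs_sub_le hk)).1]
    · rcases hz with rfl | ⟨k, hk⟩
      · linarith [(abs_le.1 (h.abs_sub_le hi)).2]
      · linarith [(abs_le.1 (h.abs_sub_le (hi.symm.trans hk))).1]

theorem isQuadraticLamination_setoid (h : FiniteRotation G x y) :
    IsQuadraticLamination h.setoid :=
  ⟨⟨h.isClosed_setoid, h.setoid_unlinked, h.finite_lamClass_setoid⟩, h.setoid_forward,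
    h.setoid_covering⟩

/-- The image of the long edge of a finite rotational set is the minor of a lamination. -/
theorem isMinor (h : FiniteRotation G x y) : IsMinor (dbl y) (dbl x) := by
  have h3 := h.third_le
  have hd : dist (y : UnitAddCircle) x = y - x := by
    rw [dist_comm, dist_coe_of_le (by linarith) (by linarith [h.lt_half])]
  refine ⟨h.setoid, y, x, h.isQuadraticLamination_setoid, ⟨isLeaf_of_isHole (x := (x : UnitAddCircle))
    (fun he => ?_) (by rw [h.lamClass_setoid h.left_mem]; exact h.isHole), fun c d hcd => ?_⟩, rfl, rfl⟩
  · rw [he, dist_self] at hd; linarith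
  · rw [hd]; exact h.dist_le_of_setoid hcd.rel

theorem separatedFromCentre (h : FiniteRotation G x y) {z : ℝ} (h1 : 2 * y - 1 < z) (h2 : z < 2 * x) :
    SeparatedFromCentre (dbl y) (dbl x) z := by
  have h3 := h.third_le
  have h4 := h.lt_half
  left
  rw [dbl_coe, dbl_coe, ← coe_sub_one' (2 * y), arcLen_coe (by linarith) (by linarith)]
  exact ⟨by linarith, coe_mem_openArc h1 h2 (by linarith)⟩

end FiniteRotation

/-! ### Laminations whose major is the long edge of a fixed finite class -/

/-- A quadratic lamination which has the finite rotational set `G` as a class, and in which no class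
meets both components of the strip between the long edge of `G` and its translate by `1/2`. -/
structure CardioidLamination (r : Setoid UnitAddCircle) (G : Set UnitAddCircle) (x y : ℝ) : Prop where
  quad : IsQuadraticLamination r
  rot : FiniteRotation G x y
  cls : lamClass r x = G
  strip : ∀ c d : ℝ, y < c → c < x + 1 / 2 → y + 1 / 2 < d → d < x + 1 → ¬ r c d

section CardioidLamination
variable {r : Setoid UnitAddCircle} {G : Set UnitAddCircle} {x y : ℝ}

/-- An edge of a class crossing the strip would be longer than the edges of the strip. -/
theorem cardioidLamination_of_isMajor (hr : IsQuadraticLamination r) (h : FiniteRotation G x y)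
    (hG : lamClass r x = G) (hM : IsMajor r x y) : CardioidLamination r G x y := by
  refine ⟨hr, h, hG, fun c d hc1 hc2 hd1 hd2 hcd => ?_⟩
  have h3 := h.third_le
  have h4 := h.lt_half
  have hM' := hr.isMajor_add_half hM
  have hout : ((x + 1 / 2 : ℝ) : UnitAddCircle) ∉ lamClass r c := by
    intro hx
    have hy : r c ((y + 1 / 2 : ℝ) : UnitAddCircle) := r.trans' hx hM'.1.rel
    -- `c` would be in the class of `x + 1 / 2`, hence `c + 1 / 2` in the class of `x`
    have h5 := hr.rel_sub_half hx
    rw [add_sub_cancel_right] at h5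
    have h6 : ((c - 1 / 2 : ℝ) : UnitAddCircle) ∈ G := by rw [← hG]; exact r.symm' h5
    rw [← coe_add_half_eq_sub_half] at h6
    exact h.notMem (by linarith) (by linarith) h6
  obtain ⟨p, q, hpq, hmem⟩ := exists_isHole_mem (hr.lamination.isClosed_lamClass c)
    ⟨_, self_mem_lamClass _⟩ hout
  obtain ⟨p, h1, h2, rfl⟩ := exists_coe_Ico (x - 1 / 2) p
  obtain ⟨q, h5, h6, rfl⟩ := exists_coe_Ioc p q
  have hp : p < x + 1 / 2 := by linarith
  obtain ⟨t, ht1, ht2, ht⟩ := (mem_openArc_iff h5 h6).1 hmem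
  have hp' : p ≠ x - 1 / 2 := by
    rintro rfl
    refine hout ?_
    rw [coe_add_half_eq_sub_half]; exact hpq.1
  obtain rfl : t = x + 1 / 2 := by
    obtain ⟨k, hk⟩ := coe_eq_coe_iff_exists_int.1 ht
    have h7 : x - 1 / 2 < p := lt_of_le_of_ne h1 hp'.symm
    have a1 : (-1 : ℝ) < k := by linarith
    have a2 : (k : ℝ) < 1 := by linarith
    rw [hk, int_eq_zero_of_abs_lt a1 a2]; simp
  have hfree := ((isHole_coe_iff h5 h6).1 hpq).2.2
  have hcp : c ≤ p := by
    by_contra hcon; exact hfree c (by linarith) (by linarith) (self_mem_lamClass _)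
  have hqd : q ≤ d := by
    by_contra hcon; exact hfree d (by linarith) (by linarith) hcd
  have hq : y + 1 / 2 < q := by
    rcases lt_trichotomy q (y + 1 / 2) with h7 | h7 | h7
    · refine (hr.lamination.leaf_pair_coe hM'.1 (c := q) (d := c + 1) ?_ (by linarith) h7
        (by linarith) (by linarith)).elim
      rw [coe_add_one']; exact r.symm' hpq.2.1
    · refine (hout (r.trans' hpq.2.1 ?_)).elim
      rw [h7]; exact r.symm' hM'.1.rel
    · exact h7
  have hleaf : IsLeaf r p q := isLeaf_of_isHole (fun he => by
    have := eq_of_coe_eq he (by linarith) (by linarith); linarith) hpq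
  have hd := hM.2 _ _ hleaf
  rw [dist_coe_of_le (x := x) (y := y) (by linarith) (by linarith)] at hd
  rcases le_total q (p + 1 / 2) with h7 | h7
  · rw [dist_coe_of_le (by linarith) h7] at hd; linarith
  · rw [dist_coe_of_ge h7 h6] at hd; linarith

namespace CardioidLamination

theorem rel_of_mem (h : CardioidLamination r G x y) {p q : UnitAddCircle} (hp : p ∈ G) (hq : q ∈ G) :
    r p q := by
  rw [← h.cls] at hp hq; exact r.trans' (r.symm' hp) hq

theorem mem_of_rel (h : CardioidLamination r G x y) {p q : UnitAddCircle} (hp : p ∈ G) (hq : r p q) :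
    q ∈ G := by
  rw [← h.cls] at hp ⊢; exact r.trans' hp hq

theorem mem_iff (h : CardioidLamination r G x y) {p q : UnitAddCircle} (hq : r p q) :
    p ∈ G ↔ q ∈ G := ⟨fun hp => h.mem_of_rel hp hq, fun hp => h.mem_of_rel hp (r.symm' hq)⟩

theorem dbl_mem_iff (h : CardioidLamination r G x y) {p q : UnitAddCircle} (hq : r p q) :
    dbl p ∈ G ↔ dbl q ∈ G := h.mem_iff (h.quad.rel_dbl hq)

theorem rel_of_dbl_mem (h : CardioidLamination r G x y) {p q : UnitAddCircle} (hp : dbl p ∈ G)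
    (hp' : p ∉ G) (hq : dbl q ∈ G) (hq' : q ∉ G) : r p q := by
  obtain ⟨a, rfl⟩ := exists_coe p
  obtain ⟨b, rfl⟩ := exists_coe q
  have h1 := (h.rot.dbl_mem_iff.1 hp).resolve_left hp'
  have h2 := (h.rot.dbl_mem_iff.1 hq).resolve_left hq'
  exact h.quad.rel_add_half_iff.1 (h.rel_of_mem h1 h2)

theorem not_linked (h : CardioidLamination r G x y) {g₁ g₂ a b : ℝ} (hg : r g₁ g₂) (hab : r a b)
    (hga : ¬ r g₂ a) (h1 : g₁ < a) (h2 : a < g₂) (h3 : g₂ < b) (h4 : b < g₁ + 1) : False := by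
  refine h.quad.lamination.unlinked g₁ g₂ a b hg hab hga (fun he => ?_) ⟨coe_mem_openArc h1 h2 (by linarith), ?_⟩
  · have := eq_of_coe_eq he (by linarith) (by linarith); linarith
  · rw [← coe_add_one' g₁]; exact coe_mem_openArc h3 h4 (by linarith)

/-- Between equivalent points of the fundamental domain starting in `G` there is no point of `G`. -/
theorem notMem_of_rel (h : CardioidLamination r G x y) {a b : ℝ} (ha1 : x < a) (ha2 : a < x + 1)
    (hb1 : x < b) (hb2 : b < x + 1) (hab : r a b) (haG : (a : UnitAddCircle) ∉ G) :
    ∀ t ∈ uIcc a b, (t : UnitAddCircle) ∉ G := by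
  wlog hle : a ≤ b generalizing a b
  · rw [uIcc_comm]
    exact this hb1 hb2 ha1 ha2 (r.symm' hab) (fun hb => haG ((h.mem_iff hab).2 hb)) (by linarith)
  rw [uIcc_of_le hle]
  rintro t ⟨h1, h2⟩ ht
  have hta : a ≠ t := by rintro rfl; exact haG ht
  have htb : t ≠ b := by rintro rfl; exact haG ((h.mem_iff hab).2 ht)
  exact h.not_linked (h.rel_of_mem h.rot.left_mem ht) hab (fun hr => haG (h.mem_of_rel ht hr)) ha1
    (lt_of_le_of_ne h1 hta) (lt_of_le_of_ne h2 htb) hb2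

/-- If there is no point of `G` between two equivalent points, then there is no point of the
preimage of `G` either. -/
theorem dbl_notMem_of_notMem (h : CardioidLamination r G x y) {a b : ℝ} (hab : r a b)
    (hfree : ∀ t ∈ uIcc a b, (t : UnitAddCircle) ∉ G) (haG : dbl (a : UnitAddCircle) ∉ G) :
    ∀ t ∈ uIcc a b, dbl (t : UnitAddCircle) ∉ G := by
  wlog hle : a ≤ b generalizing a b
  · rw [uIcc_comm]
    exact this (r.symm' hab) (by rwa [uIcc_comm]) (fun hb => haG ((h.dbl_mem_iff hab).2 hb)) (by linarith)
  wlog hxa : x ≤ a ∧ a < x + 1 generalizing a b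
  · obtain ⟨a', h1, h2, h3⟩ := exists_coe_Ico x a
    obtain ⟨k, hk⟩ := coe_eq_coe_iff_exists_int.1 h3
    have := this (a := a + k) (b := b + k) (by simpa using hab) (fun t ht => ?_) (by simpa using haG)
      (by linarith) (by rw [← hk]; exact ⟨h1, h2⟩)
    · intro t ht
      rw [← coe_add_intCast t k]
      refine this _ ?_
      rw [uIcc_of_le hle] at ht
      rw [uIcc_of_le (by linarith)]
      exact ⟨by linarith [ht.1], by linarith [ht.2]⟩
    · rw [← coe_sub_intCast t k]
      refine hfree _ ?_
      rw [uIcc_of_le (by linarith)] at ht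
      rw [uIcc_of_le hle]
      exact ⟨by linarith [ht.1], by linarith [ht.2]⟩
  rw [uIcc_of_le hle] at hfree ⊢
  have hb : b < x + 1 := by
    by_contra hcon
    refine hfree (x + 1) ⟨hxa.2.le, by linarith⟩ ?_
    rw [coe_add_one']; exact h.rot.left_mem
  rintro t ⟨ht1, ht2⟩ ht
  have hbG : dbl (b : UnitAddCircle) ∉ G := fun hb => haG ((h.dbl_mem_iff hab).2 hb)
  have hta : a < t := lt_of_le_of_ne ht1 (by rintro rfl; exact haG ht)
  have htb : t < b := lt_of_le_of_ne ht2 (by rintro rfl; exact hbG ht)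
  have htG := hfree t ⟨ht1, ht2⟩
  -- another point of the class of `x + 1 / 2` outside `[a, b]` would be linked with `a`, `b`
  have key : ∀ g : ℝ, (g : UnitAddCircle) ∉ G → dbl (g : UnitAddCircle) ∈ G → b < g → g < a + 1 →
      False := by
    intro g h1 h2 h3 h4
    refine h.not_linked (g₁ := g - 1) (g₂ := t) ?_ hab ?_ (by linarith) hta htb (by linarith)
    · rw [coe_sub_one']; exact h.rel_of_dbl_mem h2 h1 ht htG
    · intro hr; exact haG ((h.dbl_mem_iff hr).1 ht)
  have h3 := h.rot.third_le
  have h4 := h.rot.lt_half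
  have hx : ((x + 1 / 2 : ℝ) : UnitAddCircle) ∉ G := h.rot.add_half_notMem h.rot.left_mem
  have hy : ((y + 1 / 2 : ℝ) : UnitAddCircle) ∉ G := h.rot.add_half_notMem h.rot.right_mem
  have hx' : dbl ((x + 1 / 2 : ℝ) : UnitAddCircle) ∈ G := by
    rw [dbl_add_half]; exact h.rot.map_mem h.rot.left_mem
  have hy' : dbl ((y + 1 / 2 : ℝ) : UnitAddCircle) ∈ G := by
    rw [dbl_add_half]; exact h.rot.map_mem h.rot.right_mem
  obtain ⟨k, h5, h6⟩ := h.rot.exists_int_of_dbl_mem ht htG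
  obtain rfl : k = 0 := by
    refine int_eq_zero_of_abs_lt ?_ ?_ <;> linarith
  rw [Int.cast_zero, sub_zero] at h5 h6
  have hax : a < x + 1 / 2 := by
    rcases lt_trichotomy a (x + 1 / 2) with h7 | h7 | h7
    · exact h7
    · rw [h7] at haG; exact absurd hx' haG
    · refine (key (x + 1 / 2 + 1) ?_ ?_ (by linarith) (by linarith)).elim <;> rwa [coe_add_one']
  have hyb : y + 1 / 2 < b := by
    rcases lt_trichotomy b (y + 1 / 2) with h7 | h7 | h7
    · exact (key (y + 1 / 2) hy hy' h7 (by linarith)).elim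
    · rw [h7] at hbG; exact absurd hy' hbG
    · exact h7
  have hya : y < a := by
    by_contra hcon
    exact hfree y ⟨by linarith, by linarith⟩ h.rot.right_mem
  exact h.strip a b hya hax hyb hb hab

/-- Closed intervals of length `1/2` meet the preimage of `G`. -/
theorem exists_dbl_mem (h : CardioidLamination r G x y) {a b : ℝ} (hab : a + 1 / 2 ≤ b) :
    ∃ t, a ≤ t ∧ t ≤ b ∧ dbl (t : UnitAddCircle) ∈ G := by
  obtain ⟨c, h1, h2, h3⟩ := exists_coe_Ico (2 * a) (dbl (x : UnitAddCircle))
  refine ⟨c / 2, by linarith, by linarith, ?_⟩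
  rw [dbl_coe, mul_div_cancel₀ _ two_ne_zero, h3]
  exact h.rot.map_mem h.rot.left_mem

theorem exists_lift (h : CardioidLamination r G x y) {p : UnitAddCircle} (hp : p ∉ G) :
    ∃ a : ℝ, (a : UnitAddCircle) = p ∧ x < a ∧ a < x + 1 := by
  obtain ⟨a, h1, h2, rfl⟩ := exists_coe_Ico x p
  exact ⟨a, rfl, lt_of_le_of_ne h1 (by rintro rfl; exact hp h.rot.left_mem), h2⟩

/-- Two equivalent points outside the preimage of `G` have lifts which bound an interval containing
no point of this preimage. -/
theorem exists_free_lift (h : CardioidLamination r G x y) {a : ℝ} {q : UnitAddCircle}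
    (hq : r a q) (ha : dbl (a : UnitAddCircle) ∉ G) :
    ∃ b : ℝ, (b : UnitAddCircle) = q ∧ ∀ t ∈ uIcc a b, dbl (t : UnitAddCircle) ∉ G := by
  have haG : (a : UnitAddCircle) ∉ G := fun h1 => ha (h.rot.map_mem h1)
  obtain ⟨a', h1, h2, h3⟩ := h.exists_lift haG
  obtain ⟨b', rfl, h5, h6⟩ := h.exists_lift (fun h1 => haG ((h.mem_iff hq).2 h1))
  rw [← h1] at hq haG ha
  have h7 := h.dbl_notMem_of_notMem hq (h.notMem_of_rel h2 h3 h5 h6 hq haG) ha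
  obtain ⟨k, hk⟩ := coe_eq_coe_iff_exists_int.1 h1
  refine ⟨b' - k, coe_sub_intCast _ _, fun t ht => ?_⟩
  rw [← coe_add_intCast t k]
  refine h7 _ ?_
  rw [mem_uIcc] at ht ⊢
  rcases ht with ht | ht
  · left; constructor <;> linarith
  · right; constructor <;> linarith

/-- Equivalent points in the same component of the complement of the preimage of `G` have
equivalent preimages. -/
theorem rel_of_rel_two_mul (h : CardioidLamination r G x y) {a b : ℝ}
    (hfree : ∀ t ∈ uIcc a b, dbl (t : UnitAddCircle) ∉ G)
    (hab : r ((2 * a : ℝ) : UnitAddCircle) ((2 * b : ℝ) : UnitAddCircle)) : r a b := by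
  refine (h.quad.rel_or_rel hab).resolve_right fun hr => ?_
  obtain ⟨c, hc, hfree'⟩ := h.exists_free_lift hr (hfree a left_mem_uIcc)
  obtain ⟨k, hk⟩ := coe_eq_coe_iff_exists_int.1 hc
  have key : ∀ t ∈ uIcc b c, dbl (t : UnitAddCircle) ∉ G := fun t ht =>
    (uIcc_subset_uIcc_union_uIcc ht).elim (fun h1 => hfree t (by rwa [uIcc_comm])) (hfree' t)
  rcases le_or_gt 0 k with h1 | h1
  · have : (0 : ℝ) ≤ k := by exact_mod_cast h1
    obtain ⟨t, h2, h3, h4⟩ := h.exists_dbl_mem (a := b) (b := c) (by linarith)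
    exact key t (by rw [mem_uIcc]; exact Or.inl ⟨h2, h3⟩) h4
  · have : (k : ℝ) ≤ -1 := by exact_mod_cast (by omega : k ≤ -1)
    obtain ⟨t, h2, h3, h4⟩ := h.exists_dbl_mem (a := c) (b := b) (by linarith)
    exact key t (by rw [mem_uIcc]; exact Or.inr ⟨h2, h3⟩) h4

/-- Equivalent points are mapped into `G`: the intervals between their images avoid `G` as long as
they are not in `G`, while their lengths are doubled. -/
theorem exists_iterate_mem (h : CardioidLamination r G x y) {p q : UnitAddCircle} (hpq : r p q)
    (hne : p ≠ q) : ∃ i, dbl^[i] p ∈ G ∧ dbl^[i] q ∈ G := by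
  by_contra hcon
  push Not at hcon
  have hp : ∀ i, dbl^[i] p ∉ G := fun i hi =>
    hcon i hi ((h.mem_iff (h.quad.rel_iterate hpq i)).1 hi)
  obtain ⟨a, rfl, h1, h2⟩ := h.exists_lift (hp 0)
  obtain ⟨b, rfl, h3, h4⟩ := h.exists_lift (fun hq => hp 0 ((h.mem_iff hpq).2 hq))
  have key : ∀ i : ℕ, ∀ t ∈ uIcc (2 ^ i * a) (2 ^ i * b), (t : UnitAddCircle) ∉ G := by
    intro i
    induction i with
    | zero => simpa using h.notMem_of_rel h1 h2 h3 h4 hpq (hp 0)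
    | succ i ih =>
      have h5 := h.quad.rel_iterate hpq i
      have h6 := hp (i + 1)
      rw [dbl_iterate_coe, dbl_iterate_coe] at h5
      rw [Function.iterate_succ_apply', dbl_iterate_coe] at h6
      intro t ht
      have := h.dbl_notMem_of_notMem h5 ih h6 (t / 2) (by
        rw [pow_succ, mem_uIcc] at ht
        rw [mem_uIcc]
        rcases ht with ht | ht
        · left; constructor <;> linarith
        · right; constructor <;> linarith)
      rwa [dbl_coe, mul_div_cancel₀ _ two_ne_zero] at this
  have hab : a ≠ b := fun he => hne (by rw [he])
  obtain ⟨i, hi⟩ := pow_unbounded_of_one_lt (1 / |a - b|) (by norm_num : (1 : ℝ) < 2)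
  rw [div_lt_iff₀ (abs_pos.2 (sub_ne_zero.2 hab)), ← abs_of_pos (by positivity : (0 : ℝ) < 2 ^ i),
    ← abs_mul, mul_sub] at hi
  rcases lt_abs.1 hi with h5 | h5
  · obtain ⟨c, h6, h7, h8⟩ := exists_coe_Ico (2 ^ i * b) (x : UnitAddCircle)
    exact key i c (by rw [mem_uIcc]; right; constructor <;> linarith) (by rw [h8]; exact h.rot.left_mem)
  · obtain ⟨c, h6, h7, h8⟩ := exists_coe_Ico (2 ^ i * a) (x : UnitAddCircle)
    exact key i c (by rw [mem_uIcc]; left; constructor <;> linarith) (by rw [h8]; exact h.rot.left_mem)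

theorem le (h : CardioidLamination r G x y) {r' : Setoid UnitAddCircle}
    (h' : CardioidLamination r' G x y) {p q : UnitAddCircle} (hpq : r p q) : r' p q := by
  suffices key : ∀ (i : ℕ) (p q : UnitAddCircle), r p q → dbl^[i] p ∈ G → dbl^[i] q ∈ G → r' p q by
    by_cases hne : p = q
    · rw [hne]
    · obtain ⟨i, h1, h2⟩ := h.exists_iterate_mem hpq hne
      exact key i p q hpq h1 h2
  intro i
  induction i with
  | zero => intro p q _ h1 h2; exact h'.rel_of_mem h1 h2
  | succ i ih =>
    intro p q hpq h1 h2
    by_cases hp : dbl p ∈ G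
    · have hq := (h.dbl_mem_iff hpq).1 hp
      by_cases hp' : p ∈ G
      · exact h'.rel_of_mem hp' ((h.mem_iff hpq).1 hp')
      · exact h'.rel_of_dbl_mem hp hp' hq (fun hq' => hp' ((h.mem_iff hpq).2 hq'))
    · have h3 := ih _ _ (h.quad.rel_dbl hpq) h1 h2
      obtain ⟨a, rfl⟩ := exists_coe p
      obtain ⟨b, rfl, hfree⟩ := h.exists_free_lift hpq hp
      rw [dbl_coe, dbl_coe] at h3
      exact h'.rel_of_rel_two_mul hfree h3

theorem unique (h : CardioidLamination r G x y) {r' : Setoid UnitAddCircle}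
    (h' : CardioidLamination r' G x y) : r' = r :=
  Setoid.ext fun _ _ => ⟨h'.le h, h.le h'⟩

end CardioidLamination
end CardioidLamination

namespace CardioidLamination
variable {r : Setoid UnitAddCircle} {G : Set UnitAddCircle} {x y : ℝ}

theorem isHole_or_isHole (h : CardioidLamination r G x y) {a b : UnitAddCircle} (hab : IsLeaf r a b)
    (ha : a ∈ G) : IsHole G a b ∨ IsHole G b a := by
  rw [← h.cls] at ha
  rw [← h.cls, lamClass_eq ha]; exact hab.2

theorem nontrivial (h : CardioidLamination r G x y) : G.Nontrivial := by
  refine ⟨_, h.rot.left_mem, _, h.rot.right_mem, fun he => ?_⟩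
  have := eq_of_coe_eq he (by linarith [h.rot.third_le]) (by linarith [h.rot.lt_half])
  linarith [h.rot.third_le]

theorem eq_of_isPeriodicRotationalSet (h : CardioidLamination r G x y) {H : Set UnitAddCircle}
    (hH : IsPeriodicRotationalSet r H) : H = G := by
  obtain ⟨hlg, n, ⟨⟨hn, himg⟩, -⟩, hrot⟩ := hH
  have himgm : ∀ i, dbl^[n * i] '' H = H := fun i => by
    induction i with
    | zero => simp
    | succ i ih => rw [Nat.mul_succ, Function.iterate_add, image_comp, himg, ih]
  have hmaps : MapsTo dbl^[n] H H := fun t ht => himg ▸ mem_image_of_mem _ ht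
  -- a point of `H` mapped into `G` yields a point of `H ∩ G`
  have hmem : ∀ t ∈ H, ∀ i, dbl^[i] t ∈ G → ∀ j ≥ i, dbl^[n * j] t ∈ G := by
    intro t _ i hi j hj
    have : n * j = (n * j - i) + i := by
      have : i ≤ n * j := hj.trans (Nat.le_mul_of_pos_left j hn)
      omega
    rw [this, Function.iterate_add_apply]
    exact h.rot.iterate_mem hi _
  -- the points of `G` are periodic, so a point of `H ∩ G` makes the rotation number rational
  have hper : ∀ t ∈ H, t ∈ G → ∀ F : CircleDeg1Lift, IsLiftOn F H n → ¬ Irrational F.translationNumber := by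
    intro t ht htG F hF hirr
    obtain ⟨m, hm, hmt⟩ := h.rot.exists_periodic htG
    obtain ⟨j, hj⟩ := hF.translationNumber_of_periodic hmaps ht hm (by
      rw [mul_comm, Function.iterate_mul]; exact Function.IsFixedPt.iterate (f := dbl^[m]) hmt n)
    exact hirr ⟨j / m, by rw [hj]; push_cast; rfl⟩
  rcases hlg with ⟨a, b, hab, rfl⟩ | hgap
  · obtain ⟨i, hi1, hi2⟩ := h.exists_iterate_mem hab.rel hab.1
    have hsub : ({a, b} : Set UnitAddCircle) ⊆ G := by
      rw [← himgm i]
      rintro _ ⟨t, rfl | rfl, rfl⟩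
      · exact hmem _ (by simp) i hi1 i le_rfl
      · exact hmem _ (by simp) i hi2 i le_rfl
    obtain ⟨hfin, τ, ⟨F, hF, hτ⟩, hτ'⟩ | ⟨hinf, -⟩ := hrot
    swap
    · exact absurd (by simp) hinf
    -- the return map has no fixed point, so it exchanges the endpoints of the leaf
    have hfix : ∀ t ∈ ({a, b} : Set UnitAddCircle), dbl^[n] t ≠ t := by
      intro t ht he
      obtain ⟨j, hj⟩ := IsLiftOn.translationNumber_of_periodic hF hmaps ht one_pos (by rwa [mul_one])
      refine hτ' j ?_
      rw [← hτ, hj]; simp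
    have hna : dbl^[n] a = b := (hmaps (by simp : a ∈ ({a, b} : Set UnitAddCircle))).resolve_left (hfix a (by simp))
    have hnb : dbl^[n] b = a := (hmaps (by simp : b ∈ ({a, b} : Set UnitAddCircle))).resolve_right (hfix b (by simp))
    have hboth : IsHole G a b ∧ IsHole G b a := by
      rcases h.isHole_or_isHole hab (hsub (by simp)) with h1 | h1
      · have := h.rot.isHole_iterate h1 n
        rw [hna, hnb] at this; exact ⟨h1, this⟩
      · have := h.rot.isHole_iterate h1 n
        rw [hna, hnb] at this; exact ⟨this, h1⟩
    refine Subset.antisymm hsub fun t ht => ?_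
    by_contra hcon
    simp only [mem_insert_iff, mem_singleton_iff, not_or] at hcon
    rcases mem_openArc_or_mem_openArc hcon.1 hcon.2 with h1 | h1
    · exact Set.disjoint_left.1 hboth.1.2.2 h1 ht
    · exact Set.disjoint_left.1 hboth.2.2.2 h1 ht
  · have hne : H.Nonempty := by
      rw [← encard_pos]; exact lt_of_lt_of_le (by norm_num) hgap.three_le
    by_cases hfin : H.Finite
    · have hev : ∀ t ∈ H, ∃ i, dbl^[i] t ∈ G := by
        intro t ht
        obtain ⟨b, hb⟩ := exists_isHole_left hfin ht
        have hl := hgap.edges _ _ hb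
        obtain ⟨i, hi, -⟩ := h.exists_iterate_mem hl.rel hl.1
        exact ⟨i, hi⟩
      choose! i hi using hev
      obtain ⟨N, hN⟩ := (hfin.image i).bddAbove
      have hsub : H ⊆ G := by
        rw [← himgm N]
        rintro _ ⟨t, ht, rfl⟩
        exact hmem t ht _ (hi t ht) N (hN ⟨t, ht, rfl⟩)
      refine Subset.antisymm hsub fun t ht => ?_
      by_contra hcon
      obtain ⟨a, b, hab, htab⟩ := exists_isHole_mem hgap.closed hne hcon
      rcases h.isHole_or_isHole (hgap.edges _ _ hab) (hsub hab.1) with h1 | h1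
      · exact Set.disjoint_left.1 h1.2.2 htab ht
      · have : H ⊆ {a, b} := by
          intro s hs
          by_contra hcon'
          simp only [mem_insert_iff, mem_singleton_iff, not_or] at hcon'
          rcases mem_openArc_or_mem_openArc hcon'.1 hcon'.2 with h2 | h2
          · exact Set.disjoint_left.1 hab.2.2 h2 hs
          · exact Set.disjoint_left.1 h1.2.2 h2 (hsub hs)
        have h3 := hgap.three_le.trans (encard_le_encard this)
        have h4 : (3 : ℕ∞) ≤ 2 := h3.trans ((encard_insert_le {b} a).trans (by rw [encard_singleton]; norm_num))
        exact absurd h4 (by norm_num)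
    · obtain ⟨hfin', -⟩ | ⟨-, τ, ⟨F, hF, hτ⟩, hirr⟩ := hrot
      · exact absurd hfin' hfin
      exfalso
      have hex : ∃ t, t ∉ H := by
        by_contra hcon
        push Not at hcon
        have hl : IsLeaf r y x := isLeaf_of_isHole (x := (x : UnitAddCircle)) (fun he => by
          have := eq_of_coe_eq he (by linarith [h.rot.lt_half]) (by linarith [h.rot.third_le])
          linarith [h.rot.third_le]) (by rw [h.cls]; exact h.rot.isHole)
        have h3 := h.rot.third_le
        have h4 := h.rot.lt_half
        rcases hgap.no_crossing _ _ hl with h1 | h1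
        · rw [← coe_add_one' x] at h1
          exact Set.disjoint_left.1 h1 (coe_mem_openArc (z := y + 1 / 3) (by linarith) (by linarith)
            (by linarith)) (hcon _)
        · exact Set.disjoint_left.1 h1 (coe_mem_openArc (z := x + 1 / 4) (by linarith) (by linarith)
            (by linarith)) (hcon _)
      obtain ⟨t, ht⟩ := hex
      obtain ⟨a, b, hab, -⟩ := exists_isHole_mem hgap.closed hne ht
      have hl := hgap.edges _ _ hab
      obtain ⟨i, hi, -⟩ := h.exists_iterate_mem hl.rel hl.1
      refine hper _ ?_ (hmem a hab.1 i hi i le_rfl) F hF (hτ ▸ hirr)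
      rw [← himgm i]; exact ⟨a, hab.1, rfl⟩

end CardioidLamination

/-! ### The cycle of Fatou gaps attached to a finite rotational set -/

theorem mem_closedArc_iff {a b : ℝ} {t : UnitAddCircle} (h1 : a < b) (h2 : b ≤ a + 1) :
    t ∈ openArc a b ∪ {(a : UnitAddCircle), (b : UnitAddCircle)} ↔
      ∃ z : ℝ, a ≤ z ∧ z ≤ b ∧ (z : UnitAddCircle) = t := by
  simp only [mem_union, mem_insert_iff, mem_singleton_iff, mem_openArc_iff h1 h2]
  constructor
  · rintro (⟨z, h3, h4, rfl⟩ | rfl | rfl)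
    · exact ⟨z, h3.le, h4.le, rfl⟩
    · exact ⟨a, le_rfl, h1.le, rfl⟩
    · exact ⟨b, h1.le, le_rfl, rfl⟩
  · rintro ⟨z, h3, h4, rfl⟩
    rcases eq_or_lt_of_le h3 with rfl | h3
    · exact Or.inr (Or.inl rfl)
    rcases eq_or_lt_of_le h4 with rfl | h4
    · exact Or.inr (Or.inr rfl)
    · exact Or.inl ⟨z, h3, h4, rfl⟩

/-- The points of the circle which never enter the open arc cut off by the chord of `x + 1/2` and
`y + 1/2`. -/
def fatouSet (x y : ℝ) : Set UnitAddCircle :=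
  {z | ∀ i, dbl^[i] z ∉ openArc ((x + 1 / 2 : ℝ) : UnitAddCircle) ((y + 1 / 2 : ℝ) : UnitAddCircle)}

/-- The part of `fatouSet x y` in the closed arc from `a` to `b`. -/
def fatouGap (x y : ℝ) (a b : UnitAddCircle) : Set UnitAddCircle :=
  (openArc a b ∪ {a, b}) ∩ fatouSet x y

section
variable {x y : ℝ}

theorem dbl_mem_fatouSet {z : UnitAddCircle} (hz : z ∈ fatouSet x y) : dbl z ∈ fatouSet x y :=
  fun i => by rw [← Function.iterate_succ_apply]; exact hz (i + 1)

theorem mem_fatouSet_of_dbl_mem {z : UnitAddCircle} (hz : dbl z ∈ fatouSet x y)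
    (hz' : z ∉ openArc ((x + 1 / 2 : ℝ) : UnitAddCircle) ((y + 1 / 2 : ℝ) : UnitAddCircle)) :
    z ∈ fatouSet x y := by
  intro i
  cases i with
  | zero => exact hz'
  | succ i => rw [Function.iterate_succ_apply]; exact hz i

theorem isClosed_fatouSet (x y : ℝ) : IsClosed (fatouSet x y) := by
  have : fatouSet x y = ⋂ i, dbl^[i] ⁻¹' (openArc ((x + 1 / 2 : ℝ) : UnitAddCircle)
      ((y + 1 / 2 : ℝ) : UnitAddCircle))ᶜ := by
    ext z; simp [fatouSet]
  rw [this]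
  exact isClosed_iInter fun i =>
    (isOpen_openArc _ _).isClosed_compl.preimage (continuous_dbl_iterate i)

end

namespace FiniteRotation
variable {G : Set UnitAddCircle} {x y : ℝ}

theorem notMem_openArc (h : FiniteRotation G x y) {z : ℝ} (h1 : y - 1 / 2 ≤ z) (h2 : z ≤ x + 1 / 2) :
    (z : UnitAddCircle) ∉ openArc ((x + 1 / 2 : ℝ) : UnitAddCircle) ((y + 1 / 2 : ℝ) : UnitAddCircle) := by
  have h3 := h.third_le
  have h4 := h.lt_half
  rw [← coe_add_one' z, coe_mem_openArc_iff (by linarith) (by linarith) (by linarith) (by linarith)]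
  intro h5; linarith [h5.2]

theorem subset_fatouSet (h : FiniteRotation G x y) : G ⊆ fatouSet x y := by
  intro t ht i
  have h1 := h.iterate_mem ht i
  have h3 := h.third_le
  have h4 := h.lt_half
  intro h2
  obtain ⟨z, h5, h6, h7⟩ := (mem_openArc_iff (by linarith) (by linarith)).1 h2
  rw [← h7] at h1
  exact h.notMem (by linarith) (by linarith) h1

theorem left_mem_fatouSet (h : FiniteRotation G x y) :
    ((x + 1 / 2 : ℝ) : UnitAddCircle) ∈ fatouSet x y :=
  mem_fatouSet_of_dbl_mem (by rw [dbl_add_half]; exact h.subset_fatouSet (h.map_mem h.left_mem))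
    (left_notMem_openArc _ _)

theorem right_mem_fatouSet (h : FiniteRotation G x y) :
    ((y + 1 / 2 : ℝ) : UnitAddCircle) ∈ fatouSet x y :=
  mem_fatouSet_of_dbl_mem (by rw [dbl_add_half]; exact h.subset_fatouSet (h.map_mem h.right_mem))
    (right_notMem_openArc _ _)

theorem exists_lift_of_isHole (h : FiniteRotation G x y) {p q : UnitAddCircle} (hpq : IsHole G p q) :
    ∃ a b : ℝ, a < b ∧ b < a + 1 ∧ (a : UnitAddCircle) = p ∧ (b : UnitAddCircle) = q ∧
      ((x ≤ a ∧ b ≤ y) ∨ (y = a ∧ b = x + 1)) := by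
  obtain ⟨a, h1, h2, rfl⟩ := exists_coe_Ico x p
  obtain ⟨b, h3, h4, rfl⟩ := exists_coe_Ioc a q
  have hx := h.third_le
  have hy := h.lt_half
  rw [isHole_coe_iff h3 h4] at hpq
  have hay : a ≤ y := by
    by_contra hcon; exact h.notMem (by linarith) (by linarith) hpq.1
  rcases eq_or_lt_of_le hay with rfl | hay
  · have : b = x + 1 := by
      rcases lt_trichotomy b (x + 1) with h5 | h5 | h5
      · exact absurd hpq.2.1 (h.notMem h3 h5)
      · exact h5
      · exact absurd (by rw [coe_add_one']; exact h.left_mem) (hpq.2.2 (x + 1) (by linarith) h5)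
    exact ⟨a, b, h3, by linarith, rfl, rfl, Or.inr ⟨rfl, this⟩⟩
  · have : b ≤ y := by
      by_contra hcon; exact hpq.2.2 y hay (by linarith) h.right_mem
    exact ⟨a, b, h3, by linarith, rfl, rfl, Or.inl ⟨h1, this⟩⟩

theorem exists_eq_two_mul (h : FiniteRotation G x y) {w : UnitAddCircle}
    (hw : w ∈ fatouGap x y (dbl y) (dbl x)) :
    ∃ z, y ≤ z ∧ z ≤ x + 1 / 2 ∧ (z : UnitAddCircle) ∈ fatouSet x y ∧
      ((z + 1 / 2 : ℝ) : UnitAddCircle) ∈ fatouSet x y ∧ dbl z = w := by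
  have hx := h.third_le
  have hy := h.lt_half
  have hw1 := hw.1
  rw [dbl_coe, dbl_coe, ← coe_add_one' (2 * x), mem_closedArc_iff (by linarith) (by linarith)] at hw1
  obtain ⟨z, h1, h2, rfl⟩ := hw1
  have h3 : dbl ((z / 2 : ℝ) : UnitAddCircle) = z := by
    rw [dbl_coe, mul_div_cancel₀ _ two_ne_zero]
  refine ⟨z / 2, by linarith, by linarith, mem_fatouSet_of_dbl_mem (by rw [h3]; exact hw.2)
    (h.notMem_openArc (z := z / 2) (by linarith) (by linarith)), mem_fatouSet_of_dbl_mem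
    (by rw [dbl_add_half, h3]; exact hw.2) ?_, h3⟩
  rw [coe_add_half_eq_sub_half (z / 2)]
  exact h.notMem_openArc (z := z / 2 - 1 / 2) (by linarith) (by linarith)

theorem image_fatouGap (h : FiniteRotation G x y) {p q : UnitAddCircle} (hpq : IsHole G p q) :
    dbl '' fatouGap x y p q = fatouGap x y (dbl p) (dbl q) := by
  have hx := h.third_le
  have hy := h.lt_half
  obtain ⟨a, b, hab, hba, rfl, rfl, h1⟩ := h.exists_lift_of_isHole hpq
  refine Subset.antisymm ?_ ?_
  · rintro _ ⟨t, ⟨ht1, ht2⟩, rfl⟩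
    refine ⟨?_, dbl_mem_fatouSet ht2⟩
    obtain ⟨z, hz1, hz2, rfl⟩ := (mem_closedArc_iff hab hba.le).1 ht1
    rcases h1 with h1 | ⟨rfl, rfl⟩
    · rw [dbl_coe, dbl_coe, dbl_coe, mem_closedArc_iff (by linarith) (by linarith)]
      exact ⟨2 * z, by linarith, by linarith, rfl⟩
    · rw [dbl_coe, dbl_coe, dbl_coe, ← coe_sub_one' (2 * (x + 1)),
        mem_closedArc_iff (by linarith) (by linarith)]
      by_cases hz : z ≤ x + 1 / 2
      · exact ⟨2 * z, by linarith, by linarith, rfl⟩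
      · have : y + 1 / 2 ≤ z := by
          by_contra hcon
          exact ht2 0 (coe_mem_openArc (by linarith) (by linarith) (by linarith))
        exact ⟨2 * z - 1, by linarith, by linarith, coe_sub_one' _⟩
  · intro w hw
    rcases h1 with h1 | ⟨rfl, rfl⟩
    · have hw1 := hw.1
      rw [dbl_coe, dbl_coe, mem_closedArc_iff (by linarith) (by linarith)] at hw1
      obtain ⟨z, hz1, hz2, rfl⟩ := hw1
      have h3 : dbl ((z / 2 : ℝ) : UnitAddCircle) = z := by
        rw [dbl_coe, mul_div_cancel₀ _ two_ne_zero]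
      refine ⟨((z / 2 : ℝ) : UnitAddCircle), ⟨?_, mem_fatouSet_of_dbl_mem (by rw [h3]; exact hw.2)
        (h.notMem_openArc (by linarith) (by linarith))⟩, h3⟩
      rw [mem_closedArc_iff hab hba.le]
      exact ⟨z / 2, by linarith, by linarith, rfl⟩
    · rw [coe_add_one'] at hw
      obtain ⟨z, h2, h3, h4, -, rfl⟩ := h.exists_eq_two_mul hw
      refine ⟨z, ⟨?_, h4⟩, rfl⟩
      rw [mem_closedArc_iff hab hba.le]
      exact ⟨z, h2, by linarith, rfl⟩

theorem image_iterate_fatouGap (h : FiniteRotation G x y) {p q : UnitAddCircle} (hpq : IsHole G p q)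
    (n : ℕ) : dbl^[n] '' fatouGap x y p q = fatouGap x y (dbl^[n] p) (dbl^[n] q) := by
  induction n with
  | zero => simp
  | succ n ih =>
    rw [Function.iterate_succ', image_comp, ih, h.image_fatouGap (h.isHole_iterate hpq n)]; rfl

theorem left_mem_fatouGap (h : FiniteRotation G x y) {p q : UnitAddCircle} (hpq : IsHole G p q) :
    p ∈ fatouGap x y p q := ⟨by simp, h.subset_fatouSet hpq.1⟩

theorem right_mem_fatouGap (h : FiniteRotation G x y) {p q : UnitAddCircle} (hpq : IsHole G p q) :
    q ∈ fatouGap x y p q := ⟨by simp, h.subset_fatouSet hpq.2.1⟩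

/-- The gaps are infinite since the return map to the long one is onto, but not injective. -/
theorem infinite_fatouGap (h : FiniteRotation G x y) {p q : UnitAddCircle} (hpq : IsHole G p q) :
    (fatouGap x y p q).Infinite := by
  have hx := h.third_le
  have hy := h.lt_half
  have hlong : (fatouGap x y y x).Infinite := by
    intro hfin
    obtain ⟨n, hn, hny, hnx, -⟩ := h.exists_period
    have himg := h.image_iterate_fatouGap h.isHole n
    rw [hny, hnx] at himg
    have hmem : ((y + 1 / 2 : ℝ) : UnitAddCircle) ∈ fatouGap x y y x := by
      refine ⟨?_, h.right_mem_fatouSet⟩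
      rw [← coe_add_one' x, mem_closedArc_iff (by linarith) (by linarith)]
      exact ⟨y + 1 / 2, by linarith, by linarith, rfl⟩
    have he : dbl^[n] ((y + 1 / 2 : ℝ) : UnitAddCircle) = dbl^[n] (y : UnitAddCircle) := by
      obtain ⟨m, rfl⟩ : ∃ m, n = m + 1 := ⟨n - 1, by omega⟩
      rw [Function.iterate_succ_apply, Function.iterate_succ_apply, dbl_add_half]
    have := eq_of_coe_eq (injOn_of_image_eq hfin himg hmem (h.left_mem_fatouGap h.isHole) he)
      (by linarith) (by linarith)
    linarith
  obtain ⟨k, hk1, hk2⟩ := h.exists_iterate_eq hpq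
  have := h.image_iterate_fatouGap hpq k
  rw [hk1, hk2] at this
  rw [← this] at hlong
  exact hlong.of_image

/-- Both components of the strip contain points of the long gap. -/
theorem exists_mem_fatouSet (h : FiniteRotation G x y) :
    ∃ z, y < z ∧ z < x + 1 / 2 ∧ (z : UnitAddCircle) ∈ fatouSet x y ∧
      ((z + 1 / 2 : ℝ) : UnitAddCircle) ∈ fatouSet x y := by
  have hinf := (h.infinite_fatouGap (h.holes _ _ h.isHole)).sdiff
    (toFinite {dbl (y : UnitAddCircle), dbl (x : UnitAddCircle)})
  obtain ⟨w, hw, hw'⟩ := hinf.nonempty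
  obtain ⟨z, h1, h2, h3, h4, rfl⟩ := h.exists_eq_two_mul hw
  simp only [mem_insert_iff, mem_singleton_iff, not_or] at hw'
  refine ⟨z, lt_of_le_of_ne h1 ?_, lt_of_le_of_ne h2 ?_, h3, h4⟩
  · rintro rfl; exact hw'.1 rfl
  · rintro rfl; exact hw'.2 (dbl_add_half x)

theorem exists_mem_fatouSet_of_isHole (h : FiniteRotation G x y) {a b : ℝ} (hab : a < b) (hba : b ≤ a + 1)
    (hh : IsHole G a b) : ∃ z, a < z ∧ z < b ∧ (z : UnitAddCircle) ∈ fatouSet x y := by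
  have hinf := (h.infinite_fatouGap hh).sdiff
    (toFinite {(a : UnitAddCircle), (b : UnitAddCircle)})
  obtain ⟨w, hw, hw'⟩ := hinf.nonempty
  obtain ⟨z, h1, h2, h3⟩ := (mem_openArc_iff hab hba).1 (hw.1.resolve_right hw')
  exact ⟨z, h1, h2, by rw [h3]; exact hw.2⟩

theorem isClosed_fatouGap (h : FiniteRotation G x y) {p q : UnitAddCircle} (hpq : IsHole G p q) :
    IsClosed (fatouGap x y p q) := by
  refine IsClosed.inter ?_ (isClosed_fatouSet x y)
  obtain ⟨a, b, hab, hba, rfl, rfl, -⟩ := h.exists_lift_of_isHole hpq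
  have hne : (a : UnitAddCircle) ≠ b := fun he => by
    have := eq_of_coe_eq he (by linarith) (by linarith); linarith
  have : openArc (a : UnitAddCircle) b ∪ {(a : UnitAddCircle), (b : UnitAddCircle)} =
      (openArc (b : UnitAddCircle) a)ᶜ := by
    ext t
    constructor
    · rintro (h1 | rfl | rfl) h2
      · exact Set.disjoint_left.1 (disjoint_openArc_openArc hne) h1 h2
      · exact right_notMem_openArc _ _ h2
      · exact left_notMem_openArc _ _ h2
    · intro h1
      by_cases ha : t = a
      · exact Or.inr (Or.inl ha)
      by_cases hb : t = b
      · exact Or.inr (Or.inr hb)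
      exact Or.inl ((mem_openArc_or_mem_openArc ha hb).resolve_right h1)
  rw [this]
  exact (isOpen_openArc _ _).isClosed_compl

end FiniteRotation

namespace CardioidLamination
variable {r : Setoid UnitAddCircle} {G : Set UnitAddCircle} {x y : ℝ}

/-- A component of the complement of `fatouSet x y`, other than the one cut off by the chord of
`x + 1/2` and `y + 1/2`, has no endpoint in the preimage of `G`. -/
theorem dbl_notMem_of_gap (h : CardioidLamination r G x y) {c d : ℝ} (hcd : c < d) (hdc : d ≤ c + 1)
    (hc : (c : UnitAddCircle) ∈ fatouSet x y) (hd : (d : UnitAddCircle) ∈ fatouSet x y)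
    (hfree : ∀ z : ℝ, c < z → z < d → (z : UnitAddCircle) ∉ fatouSet x y)
    (hW : ∀ z : ℝ, c < z → z < d → (z : UnitAddCircle) ∉
      openArc ((x + 1 / 2 : ℝ) : UnitAddCircle) ((y + 1 / 2 : ℝ) : UnitAddCircle))
    (hc' : dbl (c : UnitAddCircle) ∈ G) (hd' : dbl (d : UnitAddCircle) ∈ G) : False := by
  have h3 := h.rot.third_le
  have h4 := h.rot.lt_half
  have hfreek : ∀ (z : ℝ) (k : ℤ), (z : UnitAddCircle) ∈ fatouSet x y → c < z + k → z + k < d → False :=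
    fun z k h1 h2 h3 => hfree _ h2 h3 (by rwa [coe_add_intCast])
  have hxE : (x : UnitAddCircle) ∈ fatouSet x y := h.rot.subset_fatouSet h.rot.left_mem
  obtain ⟨z₀, hz1, hz2, hz3, hz4⟩ := h.rot.exists_mem_fatouSet
  have hends : ∀ z : ℝ, (z : UnitAddCircle) ∈ fatouSet x y → dbl (z : UnitAddCircle) ∈ G →
      (z : UnitAddCircle) ∉ G → ∃ k : ℤ, z = x + 1 / 2 + k ∨ z = y + 1 / 2 + k := by
    intro z h1 h2 h3
    obtain ⟨k, h5, h6⟩ := h.rot.exists_int_of_dbl_mem h2 h3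
    refine ⟨k, ?_⟩
    by_contra hcon
    push Not at hcon
    refine h1 0 ?_
    rw [Function.iterate_zero, id, ← coe_sub_intCast z k]
    refine coe_mem_openArc (lt_of_le_of_ne h5 fun he => hcon.1 (by linarith))
      (lt_of_le_of_ne h6 fun he => hcon.2 (by linarith)) (by linarith)
  have hG : ∀ (z : ℝ) (k : ℤ), (z : UnitAddCircle) ∈ G → y + k < z → x + 1 + k ≤ z := by
    intro z k h1 h2
    by_contra hcon
    exact h.rot.notMem (z := z - k) (by linarith) (by linarith) (by rwa [coe_sub_intCast])
  by_cases hcG : (c : UnitAddCircle) ∈ G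
  · by_cases hdG : (d : UnitAddCircle) ∈ G
    · obtain ⟨z, h5, h6, h7⟩ := h.rot.exists_mem_fatouSet_of_isHole hcd hdc
        ((isHole_coe_iff hcd hdc).2 ⟨hcG, hdG, fun z h1 h2 hz => hfree z h1 h2 (h.rot.subset_fatouSet hz)⟩)
      exact hfree z h5 h6 h7
    · obtain ⟨k, rfl | rfl⟩ := hends d hd hd' hdG
      · have : c ≤ y + k := by
          by_contra hcon; linarith [hG c k hcG (by linarith)]
        exact hfreek z₀ k hz3 (by linarith) (by linarith)
      · have : c < x + 1 / 2 + k := by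
          by_contra hcon; linarith [hG c k hcG (by linarith)]
        exact hfreek _ k h.rot.left_mem_fatouSet this (by linarith)
  · obtain ⟨k, rfl | rfl⟩ := hends c hc hc' hcG
    · have h5 : d ≤ y + 1 / 2 + k := by
        by_contra hcon
        exact hfreek _ k h.rot.right_mem_fatouSet (by linarith) (by linarith)
      refine hW ((x + 1 / 2 + k + d) / 2) (by linarith) (by linarith) ?_
      rw [← coe_sub_intCast ((x + 1 / 2 + k + d) / 2) k]
      exact coe_mem_openArc (by linarith) (by linarith) (by linarith)
    · have h5 : d ≤ x + 1 + k := by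
        by_contra hcon
        refine hfreek (x + 1) k (by rwa [coe_add_one']) (by linarith) (by linarith)
      by_cases hdG : (d : UnitAddCircle) ∈ G
      · have h6 := hG d k hdG (by linarith)
        exact hfreek _ k hz4 (by linarith) (by linarith)
      · obtain ⟨l, h6, h7⟩ := h.rot.exists_int_of_dbl_mem hd' hdG
        have a1 : (k : ℝ) < l := by linarith
        have a2 : (l : ℝ) < k + 1 := by linarith
        have a3 : k < l := by exact_mod_cast a1
        have a4 : l < k + 1 := by exact_mod_cast a2
        omega

/-- The components of the complement of `fatouSet x y` are cut off by leaves: this is pulled back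
from the one cut off by the chord of `x + 1/2` and `y + 1/2`, since the others double in length. -/
theorem rel_of_gap (h : CardioidLamination r G x y) (N : ℕ) : ∀ c d : ℝ, c < d →
    1 < 2 ^ N * (d - c) → (c : UnitAddCircle) ∈ fatouSet x y → (d : UnitAddCircle) ∈ fatouSet x y →
    (∀ z : ℝ, c < z → z < d → (z : UnitAddCircle) ∉ fatouSet x y) →
    r c d ∧ ∀ z : ℝ, d < z → z < c + 1 → ¬ r c z := by
  have h3 := h.rot.third_le
  have h4 := h.rot.lt_half
  have hlen : ∀ c d : ℝ, (∀ z : ℝ, c < z → z < d → (z : UnitAddCircle) ∉ fatouSet x y) → d ≤ c + 1 := by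
    intro c d hfree
    by_contra hcon
    obtain ⟨z, h1, h2, h3⟩ := exists_coe_Ioc c (x : UnitAddCircle)
    exact hfree z h1 (by linarith) (by rw [h3]; exact h.rot.subset_fatouSet h.rot.left_mem)
  induction N with
  | zero =>
    intro c d hcd hN hc hd hfree
    linarith [hlen c d hfree]
  | succ N ih =>
    intro c d hcd hN hc hd hfree
    have hdc := hlen c d hfree
    by_cases hW : ∃ z : ℝ, c < z ∧ z < d ∧ (z : UnitAddCircle) ∈
      openArc ((x + 1 / 2 : ℝ) : UnitAddCircle) ((y + 1 / 2 : ℝ) : UnitAddCircle)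
    · obtain ⟨z, hz1, hz2, hz⟩ := hW
      obtain ⟨w, hw1, hw2, hw⟩ := (mem_openArc_iff (by linarith) (by linarith)).1 hz
      obtain ⟨k, rfl⟩ := coe_eq_coe_iff_exists_int.1 hw.symm
      have hnot : ∀ t : ℝ, (t : UnitAddCircle) ∈ fatouSet x y → ¬ (x + 1 / 2 + k < t ∧ t < y + 1 / 2 + k) := by
        rintro t ht ⟨h5, h6⟩
        refine ht 0 ?_
        rw [Function.iterate_zero, id, ← coe_sub_intCast t k]
        exact coe_mem_openArc (by linarith) (by linarith) (by linarith)
      have hck : c = x + 1 / 2 + k := by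
        rcases lt_trichotomy c (x + 1 / 2 + k) with h5 | h5 | h5
        · exact absurd (by rw [coe_add_intCast]; exact h.rot.left_mem_fatouSet) (hfree _ h5 (by linarith))
        · exact h5
        · exact absurd ⟨h5, by linarith⟩ (hnot c hc)
      have hdk : d = y + 1 / 2 + k := by
        rcases lt_trichotomy d (y + 1 / 2 + k) with h5 | h5 | h5
        · exact absurd ⟨by linarith, h5⟩ (hnot d hd)
        · exact h5
        · exact absurd (by rw [coe_add_intCast]; exact h.rot.right_mem_fatouSet) (hfree _ (by linarith) h5)
      have hxG := h.rot.add_half_notMem h.rot.left_mem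
      have hxG' : dbl ((x + 1 / 2 : ℝ) : UnitAddCircle) ∈ G := by
        rw [dbl_add_half]; exact h.rot.map_mem h.rot.left_mem
      subst hck hdk
      rw [coe_add_intCast, coe_add_intCast]
      refine ⟨h.quad.rel_add_half (h.rel_of_mem h.rot.left_mem h.rot.right_mem), fun t ht1 ht2 hr => ?_⟩
      obtain ⟨l, h5, h6⟩ := h.rot.exists_int_of_dbl_mem ((h.dbl_mem_iff hr).1 hxG')
        (fun ht => hxG ((h.mem_iff hr).2 ht))
      have a1 : (k : ℝ) < l := by linarith
      have a2 : (l : ℝ) < k + 1 := by linarith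
      have a3 : k < l := by exact_mod_cast a1
      have a4 : l < k + 1 := by exact_mod_cast a2
      omega
    · push Not at hW
      obtain ⟨ih1, ih2⟩ := ih (2 * c) (2 * d) (by linarith) (by rw [pow_succ] at hN; linarith)
        (by rw [← dbl_coe]; exact dbl_mem_fatouSet hc) (by rw [← dbl_coe]; exact dbl_mem_fatouSet hd)
        (fun z h1 h2 hz => hfree (z / 2) (by linarith) (by linarith) (mem_fatouSet_of_dbl_mem
          (by rwa [dbl_coe, mul_div_cancel₀ _ two_ne_zero]) (hW _ (by linarith) (by linarith))))
      have hcG : dbl (c : UnitAddCircle) ∉ G := fun h1 => by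
        refine h.dbl_notMem_of_gap hcd hdc hc hd hfree hW h1 ?_
        rw [dbl_coe] at h1 ⊢
        exact h.mem_of_rel h1 ih1
      have hB : ∀ t, c ≤ t → t ≤ d → dbl (t : UnitAddCircle) ∉ G := by
        intro t h1 h2 ht
        have htc : c < t := lt_of_le_of_ne h1 (by rintro rfl; exact hcG ht)
        have htd : t < d := lt_of_le_of_ne h2 (by
          rintro rfl; refine hcG ?_
          rw [dbl_coe] at ht ⊢
          exact (h.mem_iff ih1).2 ht)
        have htE := hfree t htc htd
        obtain ⟨k, h5, h6⟩ := h.rot.exists_int_of_dbl_mem ht (fun h1 => htE (h.rot.subset_fatouSet h1))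
        refine hW t htc htd ?_
        rw [← coe_sub_intCast t k] at htE ⊢
        refine coe_mem_openArc (lt_of_le_of_ne h5 fun he => ?_) (lt_of_le_of_ne h6 fun he => ?_) (by linarith)
        · rw [← he] at htE; exact htE h.rot.left_mem_fatouSet
        · rw [he] at htE; exact htE h.rot.right_mem_fatouSet
      refine ⟨h.rel_of_rel_two_mul (fun t ht => by
        rw [uIcc_of_le hcd.le] at ht; exact hB t ht.1 ht.2) ih1, fun z hz1 hz2 hr => ?_⟩
      obtain ⟨b, hb, hfree'⟩ := h.exists_free_lift hr hcG
      obtain ⟨k, hk⟩ := coe_eq_coe_iff_exists_int.1 hb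
      have hrb : r ((2 * c : ℝ) : UnitAddCircle) ((2 * b : ℝ) : UnitAddCircle) := by
        rw [← dbl_coe, ← dbl_coe, hb]; exact h.quad.rel_dbl hr
      have hb1 : b < c + 1 / 2 := by
        by_contra hcon
        obtain ⟨t, h5, h6, h7⟩ := h.exists_dbl_mem (a := c) (b := b) (by linarith)
        exact hfree' t (by rw [mem_uIcc]; exact Or.inl ⟨h5, h6⟩) h7
      have hb2 : d < b + 1 / 2 := by
        by_contra hcon
        obtain ⟨t, h5, h6, h7⟩ := h.exists_dbl_mem (a := b) (b := d) (by linarith)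
        rcases le_total t c with h8 | h8
        · exact hfree' t (by rw [mem_uIcc]; exact Or.inr ⟨h5, h8⟩) h7
        · exact hB t h8 h6 h7
      rcases le_or_gt 0 k with h5 | h5
      · have : (0 : ℝ) ≤ k := by exact_mod_cast h5
        exact ih2 (2 * b) (by linarith) (by linarith) hrb
      · have : (k : ℝ) ≤ -1 := by exact_mod_cast (by omega : k ≤ -1)
        refine ih2 (2 * b + 1) (by linarith) (by linarith) ?_
        rwa [coe_add_one']

/-- A leaf which is not an edge of `G` cuts off an arc without points of `fatouSet x y`. -/
theorem notMem_fatouSet_of_rel (h : CardioidLamination r G x y) (i : ℕ) : ∀ c d : ℝ, r c d →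
    (∀ t, c ≤ t → t ≤ d → (t : UnitAddCircle) ∉ G) → dbl^[i] (c : UnitAddCircle) ∈ G →
    ∀ z, c < z → z < d → (z : UnitAddCircle) ∉ fatouSet x y := by
  have h3 := h.rot.third_le
  have h4 := h.rot.lt_half
  induction i with
  | zero =>
    intro c d _ hG hc z h1 h2
    exact absurd hc (hG c le_rfl (by linarith))
  | succ i ih =>
    intro c d hr hG hc z h1 h2 hz
    have hcd : c ≤ d := by linarith
    by_cases hcG : dbl (c : UnitAddCircle) ∈ G
    · obtain ⟨k, h5, h6⟩ := h.rot.exists_int_of_dbl_mem hcG (hG c le_rfl hcd)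
      obtain ⟨l, h7, h8⟩ := h.rot.exists_int_of_dbl_mem ((h.dbl_mem_iff hr).1 hcG) (hG d hcd le_rfl)
      have hlk : l ≤ k := by
        by_contra hcon
        have : (k : ℝ) + 1 ≤ l := by exact_mod_cast (by omega : k + 1 ≤ l)
        refine hG (x + 1 + k) (by linarith) (by linarith) ?_
        rw [coe_add_intCast, coe_add_one']; exact h.rot.left_mem
      have : (l : ℝ) ≤ k := by exact_mod_cast hlk
      refine hz 0 ?_
      rw [Function.iterate_zero, id, ← coe_sub_intCast z k]
      exact coe_mem_openArc (by linarith) (by linarith) (by linarith)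
    · have hB := h.dbl_notMem_of_notMem hr (fun t ht => by
        rw [uIcc_of_le hcd] at ht; exact hG t ht.1 ht.2) hcG
      rw [uIcc_of_le hcd] at hB
      refine ih (2 * c) (2 * d) (by rw [← dbl_coe, ← dbl_coe]; exact h.quad.rel_dbl hr) ?_
        (by rwa [← dbl_coe, ← Function.iterate_succ_apply]) (2 * z) (by linarith) (by linarith)
        (by rw [← dbl_coe]; exact dbl_mem_fatouSet hz)
      intro t ht1 ht2
      have := hB (t / 2) ⟨by linarith, by linarith⟩
      rwa [dbl_coe, mul_div_cancel₀ _ two_ne_zero] at this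

theorem isFatouGap_fatouGap (h : CardioidLamination r G x y) {p q : UnitAddCircle} (hpq : IsHole G p q) :
    IsFatouGap r (fatouGap x y p q) := by
  have hinf := h.rot.infinite_fatouGap hpq
  refine ⟨⟨h.rot.isClosed_fatouGap hpq, ?_, ?_, ?_⟩, hinf⟩
  · rw [hinf.encard_eq]; exact le_top
  · intro c d hcd
    obtain ⟨a, b, hab, hba, rfl, rfl, -⟩ := h.rot.exists_lift_of_isHole hpq
    obtain ⟨c, hc1, hc2, rfl⟩ := (mem_closedArc_iff hab hba.le).1 hcd.1.1
    obtain ⟨d, hd1, hd2, rfl⟩ := (mem_closedArc_iff hab hba.le).1 hcd.2.1.1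
    rcases lt_or_ge c d with h1 | h1
    · have hfree : ∀ z : ℝ, c < z → z < d → (z : UnitAddCircle) ∉ fatouSet x y := fun z h2 h3 hz =>
        ((isHole_coe_iff h1 (by linarith)).1 hcd).2.2 z h2 h3
          ⟨(mem_closedArc_iff hab hba.le).2 ⟨z, by linarith, by linarith, rfl⟩, hz⟩
      obtain ⟨N, hN⟩ := pow_unbounded_of_one_lt (1 / (d - c)) (by norm_num : (1 : ℝ) < 2)
      rw [div_lt_iff₀ (by linarith)] at hN
      obtain ⟨h5, h6⟩ := h.rel_of_gap N c d h1 hN hcd.1.2 hcd.2.1.2 hfree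
      exact (isLeaf_coe_iff h1 (by linarith)).2 ⟨h5, Or.inr h6⟩
    · rw [← coe_add_one' d] at hcd
      have h2 := (isHole_coe_iff (by linarith) (by linarith)).1 hcd
      have hcb : c = b := by
        by_contra hcon
        have : c < b := lt_of_le_of_ne hc2 hcon
        exact h2.2.2 b this (by linarith) (h.rot.right_mem_fatouGap hpq)
      have hda : d = a := by
        by_contra hcon
        have : a < d := lt_of_le_of_ne hd1 (Ne.symm hcon)
        refine h2.2.2 (a + 1) (by linarith) (by linarith) ?_
        rw [coe_add_one']; exact h.rot.left_mem_fatouGap hpq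
      rw [hcb, hda]
      exact (isLeaf_of_isHole (x := (x : UnitAddCircle)) (fun he => by
        have := eq_of_coe_eq he (by linarith) (by linarith); linarith) (by rwa [h.cls])).symm
  · intro c d hcd
    by_cases hc : c ∈ G
    · have key : ∀ c d, c ≠ d → IsHole G c d → Disjoint (openArc c d) (fatouGap x y p q) ∨
          Disjoint (openArc d c) (fatouGap x y p q) := by
        intro c d hne hcd
        by_cases hcp : c = p
        · subst hcp
          obtain rfl := hcd.right_unique hpq
          right
          refine Set.disjoint_left.2 fun t ht1 ht2 => ?_
          rcases ht2.1 with h1 | rfl | rfl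
          · exact Set.disjoint_left.1 (disjoint_openArc_openArc hne) h1 ht1
          · exact right_notMem_openArc _ _ ht1
          · exact left_notMem_openArc _ _ ht1
        · left
          refine Set.disjoint_left.2 fun t ht1 ht2 => ?_
          rcases ht2.1 with h1 | rfl | rfl
          · exact Set.disjoint_left.1 (hcd.disjoint hpq hcp) ht1 h1
          · exact Set.disjoint_left.1 hcd.2.2 ht1 hpq.1
          · exact Set.disjoint_left.1 hcd.2.2 ht1 hpq.2.1
      rcases h.isHole_or_isHole hcd hc with h1 | h1
      · exact key _ _ hcd.1 h1
      · exact (key _ _ hcd.1.symm h1).symm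
    · have key : ∀ c d : ℝ, IsLeaf r c d → (c : UnitAddCircle) ∉ G → x < c → c < x + 1 → x < d → d < x + 1 →
          c < d → Disjoint (openArc (c : UnitAddCircle) d) (fatouGap x y p q) := by
        intro c d hcd hc h1 h2 h3 h4 h5
        have h6 := h.notMem_of_rel h1 h2 h3 h4 hcd.rel hc
        rw [uIcc_of_le h5.le] at h6
        obtain ⟨i, hi, -⟩ := h.exists_iterate_mem hcd.rel hcd.1
        refine Set.disjoint_left.2 fun t ht1 ht2 => ?_
        obtain ⟨z, h7, h8, rfl⟩ := (mem_openArc_iff h5 (by linarith)).1 ht1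
        exact h.notMem_fatouSet_of_rel i c d hcd.rel (fun t h9 h10 => h6 t ⟨h9, h10⟩) hi z h7 h8 ht2.2
      have hd : d ∉ G := fun hd => hc ((h.mem_iff hcd.rel).2 hd)
      obtain ⟨c, rfl, h1, h2⟩ := h.exists_lift hc
      obtain ⟨d, rfl, h3, h4⟩ := h.exists_lift hd
      rcases lt_trichotomy c d with h5 | h5 | h5
      · exact Or.inl (key c d hcd hc h1 h2 h3 h4 h5)
      · exact absurd (by rw [h5]) hcd.1
      · exact Or.inr (key d c hcd.symm hd h3 h4 h1 h2 h5)

theorem hasAttachedFatouCycle (h : CardioidLamination r G x y) : HasAttachedFatouCycle r G := by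
  refine ⟨?_, fatouGap x y, fun a b hab => ⟨h.isFatouGap_fatouGap hab, h.rot.left_mem_fatouGap hab,
    h.rot.right_mem_fatouGap hab, inter_subset_left, h.rot.holes _ _ hab, h.rot.image_fatouGap hab⟩⟩
  rw [← h.cls]
  exact isLeafOrGap_lamClass h.quad.lamination (by rw [h.cls]; exact h.nontrivial)

end CardioidLamination

/-! ### The canonical lamination of a finite rotational set -/

section
variable {r : Setoid UnitAddCircle} {G : Set UnitAddCircle} {x y : ℝ}

theorem FiniteRotation.exists_lift_mem (h : FiniteRotation G x y) {t : UnitAddCircle} (ht : t ∈ G) :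
    ∃ g : ℝ, x ≤ g ∧ g ≤ y ∧ (g : UnitAddCircle) = t := by
  obtain ⟨g, h1, h2, rfl⟩ := exists_coe_Ico x t
  exact ⟨g, h1, not_lt.1 fun h3 => h.notMem h3 h2 ht, rfl⟩

/-- A finite rotational set whose edges are chords of classes is contained in one class. -/
theorem FiniteRotation.rel_of_isHole (h : FiniteRotation G x y)
    (hr : ∀ p q, IsHole G p q → r p q) {p q : UnitAddCircle} (hp : p ∈ G) (hq : q ∈ G) : r p q := by
  suffices hx : ∀ t ∈ G, r x t from r.trans' (r.symm' (hx p hp)) (hx q hq)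
  have hhalf := h.lt_half
  have hfin : {g : ℝ | (x ≤ g ∧ g ≤ y) ∧ (g : UnitAddCircle) ∈ G}.Finite :=
    Set.Finite.of_injOn (f := fun g : ℝ => (g : UnitAddCircle)) (t := G) (fun g hg => hg.2)
      (fun g hg g' hg' he => eq_of_coe_eq he (by linarith [hg.1.2, hg'.1.1])
        (by linarith [hg.1.1, hg'.1.2])) h.finite
  by_contra hcon
  push Not at hcon
  obtain ⟨t, ht, hxt⟩ := hcon
  obtain ⟨g, hg1, hg2, rfl⟩ := h.exists_lift_mem ht
  obtain ⟨g, ⟨⟨⟨hg1, hg2⟩, hgG⟩, hgr⟩, hmin⟩ := Set.exists_min_image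
    ({g : ℝ | (x ≤ g ∧ g ≤ y) ∧ (g : UnitAddCircle) ∈ G} ∩ {g : ℝ | ¬ r x g}) id
    (hfin.subset inter_subset_left) ⟨g, ⟨⟨hg1, hg2⟩, ht⟩, hxt⟩
  have hxg : x < g := lt_of_le_of_ne hg1 (by rintro rfl; exact hgr (r.refl' _))
  obtain ⟨f, ⟨⟨⟨hf1, hf2⟩, hfG⟩, hfg⟩, hmax⟩ := Set.exists_max_image
    ({g : ℝ | (x ≤ g ∧ g ≤ y) ∧ (g : UnitAddCircle) ∈ G} ∩ Iio g) id
    (hfin.subset inter_subset_left) ⟨x, ⟨⟨le_rfl, by linarith⟩, h.left_mem⟩, hxg⟩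
  simp only [id, mem_Iio] at hmin hmax hfg
  have hxf : r x f := by
    by_contra hcon
    linarith [hmin f ⟨⟨⟨hf1, hf2⟩, hfG⟩, hcon⟩]
  refine hgr (r.trans' hxf (hr _ _ ((isHole_coe_iff hfg (by linarith)).2 ⟨hfG, hgG, fun z h1 h2 hz => ?_⟩)))
  linarith [hmax z ⟨⟨⟨by linarith, by linarith⟩, hz⟩, h2⟩]

/-- A set whose edges are edges of infinite gaps on the other side is a class. -/
theorem lamClass_eq_of_attached (hr : IsQuadraticLamination r) (h : FiniteRotation G x y)
    (hF : HasAttachedFatouCycle r G) : lamClass r x = G := by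
  obtain ⟨hlg, V, hV⟩ := hF
  have hrel : ∀ p q, IsHole G p q → r p q := by
    intro p q hpq
    rcases hlg with ⟨a, b, hab, rfl⟩ | hgap
    · rcases hpq.1 with rfl | rfl <;> rcases hpq.2.1 with rfl | rfl
      · exact r.refl' _
      · exact hab.rel
      · exact r.symm' hab.rel
      · exact r.refl' _
    · exact (hgap.edges _ _ hpq).rel
  refine Subset.antisymm (fun z hz => ?_) fun t ht => h.rel_of_isHole hrel h.left_mem ht
  by_contra hzG
  obtain ⟨p, q, hpq, hzpq⟩ := exists_isHole_mem h.finite.isClosed ⟨_, h.left_mem⟩ hzG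
  obtain ⟨⟨hgap, hinf⟩, -, -, hsub, -⟩ := hV p q hpq
  have hpV := (hV p q hpq).2.1
  have hqV := (hV p q hpq).2.2.1
  have hpz : r p z := r.trans' (h.rel_of_isHole hrel hpq.1 h.left_mem) hz
  have hqz : r q z := r.trans' (h.rel_of_isHole hrel hpq.2.1 h.left_mem) hz
  have hzp : z ≠ p := by rintro rfl; exact hzG hpq.1
  have hzq : z ≠ q := by rintro rfl; exact hzG hpq.2.1
  obtain ⟨a, b, hab, hba, rfl, rfl, -⟩ := h.exists_lift_of_isHole hpq
  obtain ⟨z, hz1, hz2, rfl⟩ := (mem_openArc_iff hab hba.le).1 hzpq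
  have h1 : Disjoint (openArc (a : UnitAddCircle) z) (V a b) := by
    refine (hgap.pair_of_infinite hr.lamination hinf hpz hzp.symm).resolve_right fun h1 => ?_
    refine Set.disjoint_left.1 h1 ?_ hqV
    rw [← coe_add_one' a]
    exact coe_mem_openArc hz2 hba (by linarith)
  have h2 : Disjoint (openArc (z : UnitAddCircle) b) (V a b) := by
    refine (hgap.pair_of_infinite hr.lamination hinf hqz hzq.symm).resolve_left fun h1 => ?_
    refine Set.disjoint_left.1 h1 ?_ hpV
    rw [← coe_add_one' a, ← coe_add_one' z]
    exact coe_mem_openArc hba (by linarith) (by linarith)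
  refine hinf ((toFinite {(a : UnitAddCircle), (z : UnitAddCircle), (b : UnitAddCircle)}).subset
    fun t ht => ?_)
  obtain ⟨w, hw1, hw2, rfl⟩ := (mem_closedArc_iff hab hba.le).1 (hsub ht)
  rcases lt_trichotomy w z with h3 | rfl | h3
  · rcases eq_or_lt_of_le hw1 with rfl | h4
    · simp
    · exact absurd ht (Set.disjoint_left.1 h1 (coe_mem_openArc h4 h3 (by linarith)))
  · simp
  · rcases eq_or_lt_of_le hw2 with rfl | h4
    · simp
    · exact absurd ht (Set.disjoint_left.1 h2 (coe_mem_openArc h3 h4 (by linarith)))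

/-- If a cycle of Fatou gaps is attached to `G`, then the endpoints of the long edge of `G + 1/2`
belong to the Fatou gap attached to the long edge of `G`. Otherwise the hole of this Fatou gap in the
middle of the strip would be wider than `1/2`; but the return map moves its endpoints away from the
boundary of the strip, and cannot move both of them across this hole. -/
theorem cardioidLamination_of_attached (hr : IsQuadraticLamination r) (h : FiniteRotation G x y)
    (hF : HasAttachedFatouCycle r G) : CardioidLamination r G x y := by
  have hcls := lamClass_eq_of_attached hr h hF
  refine ⟨hr, h, hcls, ?_⟩
  have h3 := h.third_le
  have h4 := h.lt_half
  obtain ⟨-, V, hV⟩ := hF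
  obtain ⟨⟨hgap, hinf⟩, hyV, hxV, hsub, -, himg⟩ := hV y x h.isHole
  obtain ⟨n, hn, hny, hnx, -, hlen⟩ := h.exists_period
  have himgn : dbl^[n] '' V y x = V y x := by
    suffices ∀ k, dbl^[k] '' V y x = V (dbl^[k] y) (dbl^[k] x) by rw [this, hny, hnx]
    intro k
    induction k with
    | zero => simp
    | succ k ih =>
      rw [Function.iterate_succ', image_comp, ih, (hV _ _ (h.isHole_iterate h.isHole k)).2.2.2.2.2]; rfl
  obtain ⟨m, hm⟩ := exists_int_mul hny
  obtain ⟨l, hl⟩ := exists_int_mul hnx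
  have hK : (2 : ℝ) ≤ 2 ^ n := by
    calc (2 : ℝ) = 2 ^ 1 := by norm_num
      _ ≤ 2 ^ n := pow_le_pow_right₀ (by norm_num) hn
  have hf : ∀ z w : ℝ, (∃ j : ℤ, w = 2 ^ n * z + j) → (z : UnitAddCircle) ∈ V y x →
      (w : UnitAddCircle) ∈ V y x := by
    rintro z w ⟨j, rfl⟩ hz
    rw [coe_add_intCast, ← dbl_iterate_coe, ← himgn]
    exact ⟨_, hz, rfl⟩
  generalize (2 : ℝ) ^ n = K at *
  -- `V y x` is contained in the two components of the strip
  have hlift : ∀ t ∈ V y x, ∃ z : ℝ, y ≤ z ∧ z ≤ x + 1 ∧ (z ≤ x + 1 / 2 ∨ y + 1 / 2 ≤ z) ∧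
      (z : UnitAddCircle) = t := by
    intro t ht
    have h5 := hsub ht
    rw [← coe_add_one' x, mem_closedArc_iff (by linarith) (by linarith)] at h5
    obtain ⟨z, hz1, hz2, rfl⟩ := h5
    refine ⟨z, hz1, hz2, ?_, rfl⟩
    by_contra hcon
    push Not at hcon
    have h6 : dbl (z : UnitAddCircle) ∈ V (dbl y) (dbl x) := by rw [← himg]; exact ⟨_, ht, rfl⟩
    have h7 := (hV _ _ (h.holes _ _ h.isHole)).2.2.2.1 h6
    rw [dbl_coe, dbl_coe, dbl_coe, ← coe_add_one' (2 * x),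
      mem_closedArc_iff (by linarith) (by linarith)] at h7
    obtain ⟨w, hw1, hw2, hw⟩ := h7
    obtain ⟨k, rfl⟩ := coe_eq_coe_iff_exists_int.1 hw
    have a1 : (k : ℝ) < 0 := by linarith
    have a2 : (-1 : ℝ) < k := by linarith
    have a3 : k < 0 := by exact_mod_cast a1
    have a4 : -1 < k := by exact_mod_cast a2
    omega
  have hcl := isClosed_preimage_coe hgap.closed
  obtain ⟨X, ⟨⟨hX1, hX2⟩, hXV⟩, hXmax⟩ := ((isCompact_Icc (a := y) (b := x + 1 / 2)).inter_right
    hcl).exists_isGreatest ⟨y, ⟨le_rfl, by linarith⟩, hyV⟩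
  obtain ⟨Y, ⟨⟨hY1, hY2⟩, hYV⟩, hYmin⟩ := ((isCompact_Icc (a := y + 1 / 2) (b := x + 1)).inter_right
    hcl).exists_isLeast ⟨x + 1, ⟨by linarith, le_rfl⟩, by
      rw [Set.mem_ofPred_eq, coe_add_one']; exact hxV⟩
  rw [Set.mem_ofPred_eq] at hXV hYV
  have hmid : ∀ z : ℝ, y ≤ z → z ≤ x + 1 → (z : UnitAddCircle) ∈ V y x → z ≤ X ∨ Y ≤ z := by
    intro z hz1 hz2 hz
    obtain ⟨w, hw1, hw2, hw3, hw⟩ := hlift _ hz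
    have := eq_of_coe_eq hw (by linarith) (by linarith)
    rw [this] at hw3
    rcases hw3 with h5 | h5
    · exact Or.inl (hXmax ⟨⟨hz1, h5⟩, hz⟩)
    · exact Or.inr (hYmin ⟨⟨h5, hz2⟩, hz⟩)
  have hXY : IsLeaf r X Y := hgap.edges _ _ ((isHole_coe_iff (by linarith) (by linarith)).2
    ⟨hXV, hYV, fun z h5 h6 hz => by
      rcases hmid z (by linarith) (by linarith) hz with h7 | h7 <;> linarith⟩)
  have hG : ∀ z : ℝ, (z : UnitAddCircle) ∈ G → r z x := fun z hz => by
    rw [← hcls] at hz; exact r.symm' hz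
  have hXY' : X = x + 1 / 2 ∧ Y = y + 1 / 2 := by
    rcases lt_or_ge (Y - 1 / 2) X with h5 | h5
    · have hleaf := hr.isLeaf_add_half hXY
      by_contra hcon
      rcases hgap.pair_of_infinite hr.lamination hinf hleaf.rel hleaf.1 with h6 | h6
      · rcases eq_or_lt_of_le hX2 with h7 | h7
        · have h8 : y + 1 / 2 < Y := lt_of_le_of_ne hY1 fun he => hcon ⟨h7, he.symm⟩
          refine Set.disjoint_left.1 h6 (coe_mem_openArc (z := y + 1) (by linarith) (by linarith)
            (by linarith)) ?_
          rwa [coe_add_one']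
        · refine Set.disjoint_left.1 h6 (coe_mem_openArc (z := x + 1) (by linarith) (by linarith)
            (by linarith)) ?_
          rwa [coe_add_one']
      · rw [coe_add_half_eq_sub_half Y] at h6
        exact Set.disjoint_left.1 h6 (coe_mem_openArc (z := X) h5 (by linarith) (by linarith)) hXV
    · exfalso
      have hyX : y < X := by
        refine lt_of_le_of_ne hX1 fun he => ?_
        subst he
        have hYG : (Y : UnitAddCircle) ∈ G := by
          rw [← hcls]; exact r.trans' (r.symm' (hG _ h.right_mem)) hXY.rel
        have hYx : Y = x + 1 := by
          by_contra hcon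
          exact h.notMem (by linarith) (lt_of_le_of_ne hY2 hcon) hYG
        refine hinf ((toFinite {(y : UnitAddCircle), (x : UnitAddCircle)}).subset fun t ht => ?_)
        obtain ⟨z, hz1, hz2, -, rfl⟩ := hlift t ht
        rcases hmid z hz1 hz2 ht with h6 | h6
        · left; rw [le_antisymm h6 hz1]
        · right; rw [show z = x + 1 by linarith, coe_add_one']; rfl
      have hYx : Y < x + 1 := by
        refine lt_of_le_of_ne hY2 fun he => ?_
        subst he
        refine h.notMem hyX (by linarith) ?_
        rw [← hcls]
        have := hXY.rel
        rw [coe_add_one'] at this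
        exact r.symm' this
      have e0 := hmid (y + K * (X - y)) (by nlinarith) (by nlinarith)
        (hf X _ ⟨-m, by push_cast; linarith⟩ hXV)
      have e1 := hmid (x + 1 + K * (Y - (x + 1))) (by nlinarith) (by nlinarith) (by
        rw [show x + 1 + K * (Y - (x + 1)) = x + K * (Y - (x + 1)) + 1 by ring, coe_add_one']
        have : (Y : UnitAddCircle) = ((Y - 1 : ℝ) : UnitAddCircle) := (coe_sub_one' Y).symm
        rw [this] at hYV
        exact hf (Y - 1) _ ⟨-l, by push_cast; linarith⟩ hYV)
      have b0 : Y ≤ y + K * (X - y) := e0.resolve_left (by nlinarith)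
      have b1 : x + 1 + K * (Y - (x + 1)) ≤ X := e1.resolve_right (by nlinarith)
      nlinarith
  obtain ⟨rfl, rfl⟩ := hXY'
  intro c d hc1 hc2 hd1 hd2 hcd
  rcases hgap.pair_of_infinite hr.lamination hinf hcd (fun he => by
    have := eq_of_coe_eq he (by linarith) (by linarith); linarith) with h5 | h5
  · exact Set.disjoint_left.1 h5 (coe_mem_openArc hc2 (by linarith) (by linarith)) hXV
  · refine Set.disjoint_left.1 h5 ?_ hyV
    rw [← coe_add_one' y, ← coe_add_one' c]
    exact coe_mem_openArc (by linarith) (by linarith) (by linarith)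

/-- A lamination whose major is the long edge of a fixed class is the canonical lamination of this
class. -/
theorem CardioidLamination.isCanonicalLamination (h : CardioidLamination r G x y)
    (hrot : IsRotationalOfPeriod G 1) : IsCanonicalLamination r G := by
  refine ⟨⟨h.rot.finite.isClosed, ?_, h.rot.image, fun a b hab => Or.inr (h.rot.holes a b hab), hrot⟩,
    h.quad, Or.inl ⟨h.rot.finite, h.hasAttachedFatouCycle⟩, fun r' hr' hc => ?_⟩
  · exact Order.add_one_le_of_lt (one_lt_encard_iff_nontrivial.2 h.nontrivial)
  · rcases hc with ⟨-, hc⟩ | ⟨hinf, -⟩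
    · exact h.unique (cardioidLamination_of_attached hr' h.rot hc)
    · exact absurd h.rot.finite hinf

end

/-! ### Laminations with an invariant Siegel gap -/

/-- A lamination with an invariant infinite gap which contains no periodic point, and which has a
diameter as an edge. -/
structure SiegelLamination (r : Setoid UnitAddCircle) (G : Set UnitAddCircle) (α : ℝ) : Prop where
  quad : IsQuadraticLamination r
  gap : IsGap r G
  infinite : G.Infinite
  image : dbl '' G = G
  not_periodic : ∀ t ∈ G, ∀ m : ℕ, 0 < m → dbl^[m] t ≠ t
  left_mem : (α : UnitAddCircle) ∈ G
  right_mem : ((α + 1 / 2 : ℝ) : UnitAddCircle) ∈ G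
  mem : ∀ t ∈ G, ∃ z : ℝ, (z : UnitAddCircle) = t ∧ α ≤ z ∧ z ≤ α + 1 / 2

theorem IsQuadraticLamination.rel_sub_int_div_two {r : Setoid UnitAddCircle}
    (hr : IsQuadraticLamination r) {a b : ℝ} (h : r a b) (k : ℤ) :
    r ((a - k / 2 : ℝ) : UnitAddCircle) ((b - k / 2 : ℝ) : UnitAddCircle) := by
  rcases Int.even_or_odd' k with ⟨m, rfl | rfl⟩
  · rw [show a - ((2 * m : ℤ) : ℝ) / 2 = a - m by push_cast; ring,
      show b - ((2 * m : ℤ) : ℝ) / 2 = b - m by push_cast; ring, coe_sub_intCast, coe_sub_intCast]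
    exact h
  · rw [show a - ((2 * m + 1 : ℤ) : ℝ) / 2 = a - 1 / 2 - m by push_cast; ring,
      show b - ((2 * m + 1 : ℤ) : ℝ) / 2 = b - 1 / 2 - m by push_cast; ring, coe_sub_intCast,
      coe_sub_intCast]
    exact hr.rel_sub_half h

namespace SiegelLamination
variable {r : Setoid UnitAddCircle} {G : Set UnitAddCircle} {α : ℝ}

theorem map_mem (h : SiegelLamination r G α) {t : UnitAddCircle} (ht : t ∈ G) : dbl t ∈ G := by
  rw [← h.image]; exact ⟨t, ht, rfl⟩

theorem iterate_mem (h : SiegelLamination r G α) {t : UnitAddCircle} (ht : t ∈ G) (n : ℕ) :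
    dbl^[n] t ∈ G := by
  rw [← image_iterate_eq h.image n]; exact ⟨t, ht, rfl⟩

theorem isLeaf_diameter (h : SiegelLamination r G α) :
    IsLeaf r α ((α + 1 / 2 : ℝ) : UnitAddCircle) := by
  refine (h.gap.edges _ _ ?_).symm
  rw [← coe_add_one' α, isHole_coe_iff (by linarith) (by linarith), coe_add_one']
  refine ⟨h.right_mem, h.left_mem, fun z h1 h2 hz => ?_⟩
  obtain ⟨w, hw, h3, h4⟩ := h.mem _ hz
  have := eq_of_coe_eq hw (by linarith) (by linarith)
  linarith

theorem lamClass_eq (h : SiegelLamination r G α) :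
    lamClass r α = {(α : UnitAddCircle), ((α + 1 / 2 : ℝ) : UnitAddCircle)} :=
  h.quad.lamClass_diameter h.isLeaf_diameter

/-- Doubling maps the two endpoints of the diameter to one point, and preserves the cyclic order of
`G` otherwise. -/
theorem holes (h : SiegelLamination r G α) {p q : UnitAddCircle} (hpq : IsHole G p q) :
    dbl p = dbl q ∨ IsHole G (dbl p) (dbl q) := by
  obtain ⟨a, rfl, ha1, ha2⟩ := h.mem p hpq.1
  obtain ⟨b, rfl, hb1, hb2⟩ := h.mem q hpq.2.1
  rcases lt_or_ge a b with hab | hab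
  · right
    have h1 := (isHole_coe_iff hab (by linarith)).1 hpq
    rw [dbl_coe, dbl_coe, isHole_coe_iff (by linarith) (by linarith), ← dbl_coe, ← dbl_coe]
    refine ⟨h.map_mem hpq.1, h.map_mem hpq.2.1, fun z h2 h3 hz => ?_⟩
    rw [← h.image] at hz
    obtain ⟨t, ht, he⟩ := hz
    obtain ⟨c, rfl, hc1, hc2⟩ := h.mem t ht
    rw [dbl_coe] at he
    have := eq_of_coe_eq he (by linarith) (by linarith)
    exact h1.2.2 c (by linarith) (by linarith) ht
  · left
    rw [← coe_add_one' b] at hpq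
    have h1 := (isHole_coe_iff (by linarith) (by linarith)).1 hpq
    have ha : a = α + 1 / 2 := by
      by_contra hcon
      exact h1.2.2 _ (lt_of_le_of_ne ha2 hcon) (by linarith) h.right_mem
    have hb : b = α := by
      by_contra hcon
      refine h1.2.2 (α + 1) (by linarith) (by linarith [lt_of_le_of_ne hb1 (Ne.symm hcon)]) ?_
      rw [coe_add_one']; exact h.left_mem
    rw [ha, hb, dbl_add_half]

theorem coe_add_int_div_two (α : ℝ) (k : ℤ) :
    ((α + k / 2 : ℝ) : UnitAddCircle) = α ∨
      ((α + k / 2 : ℝ) : UnitAddCircle) = ((α + 1 / 2 : ℝ) : UnitAddCircle) := by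
  rcases Int.even_or_odd' k with ⟨m, rfl | rfl⟩
  · left
    rw [show α + ((2 * m : ℤ) : ℝ) / 2 = α + m by push_cast; ring, coe_add_intCast]
  · right
    rw [show α + ((2 * m + 1 : ℤ) : ℝ) / 2 = α + 1 / 2 + m by push_cast; ring, coe_add_intCast]

theorem isLeaf_add_int_div_two (h : SiegelLamination r G α) (k : ℤ) :
    IsLeaf r ((α + k / 2 : ℝ) : UnitAddCircle) ((α + k / 2 + 1 / 2 : ℝ) : UnitAddCircle) := by
  rcases Int.even_or_odd' k with ⟨m, rfl | rfl⟩
  · rw [show α + ((2 * m : ℤ) : ℝ) / 2 = α + m by push_cast; ring,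
      show α + (m : ℝ) + 1 / 2 = α + 1 / 2 + m by ring, coe_add_intCast, coe_add_intCast]
    exact h.isLeaf_diameter
  · rw [show α + ((2 * m + 1 : ℤ) : ℝ) / 2 = α + 1 / 2 + m by push_cast; ring,
      show α + 1 / 2 + (m : ℝ) + 1 / 2 = α + 1 + m by ring, coe_add_intCast, coe_add_intCast,
      coe_add_one']
    exact h.isLeaf_diameter.symm

/-- Equivalent points other than the endpoints of the diameter are on the same side of it. -/
theorem exists_lift (h : SiegelLamination r G α) {a : ℝ} {q : UnitAddCircle} (hq : r a q)
    (ha : (a : UnitAddCircle) ∉ lamClass r α) :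
    ∃ (k : ℤ) (b : ℝ), (b : UnitAddCircle) = q ∧ α + k / 2 < a ∧ a < α + k / 2 + 1 / 2 ∧
      α + k / 2 < b ∧ b < α + k / 2 + 1 / 2 := by
  have hk : ∀ k : ℤ, ((α + k / 2 : ℝ) : UnitAddCircle) ∈ lamClass r α := fun k => by
    rw [h.lamClass_eq]; exact coe_add_int_div_two α k
  set k := ⌊2 * (a - α)⌋ with hkdef
  have h1 : (k : ℝ) ≤ 2 * (a - α) := Int.floor_le _
  have h2 : 2 * (a - α) < k + 1 := Int.lt_floor_add_one _
  have h3 : α + k / 2 < a := by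
    refine lt_of_le_of_ne (by linarith) fun he => ha ?_
    rw [← he]; exact hk k
  obtain ⟨b, h4, h5, rfl⟩ := exists_coe_Ico (α + k / 2) q
  have hb : (b : UnitAddCircle) ∉ lamClass r α := fun hb => ha (r.trans' hb (r.symm' hq))
  have h6 : α + k / 2 < b := by
    refine lt_of_le_of_ne h4 fun he => hb ?_
    rw [← he]; exact hk k
  refine ⟨k, b, rfl, h3, by linarith, h6, ?_⟩
  rcases lt_trichotomy b (α + k / 2 + 1 / 2) with h7 | h7 | h7
  · exact h7
  · refine absurd ?_ hb
    have := hk (k + 1)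
    push_cast at this
    rw [h7, show α + (k : ℝ) / 2 + 1 / 2 = α + (k + 1) / 2 by ring]
    exact this
  · exact (h.quad.lamination.leaf_pair_coe (h.isLeaf_add_int_div_two k) hq h3 (by linarith) h7 h5).elim

/-- Between equivalent points on the same side of the diameter there is no point of the preimage of
`G`. -/
theorem dbl_notMem_of_rel (h : SiegelLamination r G α) {a b : ℝ} {k : ℤ} (hab : r a b)
    (ha : α + k / 2 < a) (hb : b < α + k / 2 + 1 / 2) : ∀ t, a < t → t < b → dbl (t : UnitAddCircle) ∉ G := by
  intro t h1 h2 ht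
  rw [← h.image] at ht
  obtain ⟨g, hg, he⟩ := ht
  obtain ⟨c, rfl, hc1, hc2⟩ := h.mem g hg
  rw [dbl_coe, dbl_coe] at he
  obtain ⟨j, hj⟩ := coe_eq_coe_iff_exists_int.1 he
  have a1 : (j : ℝ) + k < 1 := by linarith
  have a2 : (-1 : ℝ) < (j : ℝ) + k := by linarith
  have a3 : j + k = 0 := int_eq_zero_of_abs_lt (by push_cast; exact a2) (by push_cast; exact a1)
  have a4 : (j : ℝ) = -k := by exact_mod_cast (by omega : j = -k)
  have hct : c = t - k / 2 := by rw [a4] at hj; linarith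
  subst hct
  have hne : ((a - k / 2 : ℝ) : UnitAddCircle) ≠ ((b - k / 2 : ℝ) : UnitAddCircle) := fun he => by
    have := eq_of_coe_eq he (by linarith) (by linarith); linarith
  rcases h.gap.pair_of_infinite h.quad.lamination h.infinite (h.quad.rel_sub_int_div_two hab k) hne
    with h3 | h3
  · exact Set.disjoint_left.1 h3 (coe_mem_openArc (by linarith) (by linarith) (by linarith)) hg
  · rw [← coe_add_one' (a - k / 2)] at h3
    exact Set.disjoint_left.1 h3 (coe_mem_openArc (z := α + 1 / 2) (by linarith) (by linarith)
      (by linarith)) h.right_mem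

/-- Equivalent points are mapped onto the diameter: the intervals between their images avoid `G` as
long as they do not fall on the diameter, while their lengths are doubled. -/
theorem exists_iterate_mem (h : SiegelLamination r G α) {p q : UnitAddCircle} (hpq : r p q)
    (hne : p ≠ q) : ∃ i, dbl^[i] p ∈ lamClass r α := by
  by_contra hcon
  push Not at hcon
  obtain ⟨a, rfl⟩ := exists_coe p
  obtain ⟨k, b, rfl, h1, h2, h3, h4⟩ := h.exists_lift hpq (hcon 0)
  wlog hab : a < b generalizing a b
  · rcases eq_or_lt_of_le (not_lt.1 hab) with h5 | h5
    · exact hne (by rw [h5])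
    · exact this b (fun i hi => hcon i (r.trans' hi (h.quad.rel_iterate (r.symm' hpq) i))) a
        (r.symm' hpq) hne.symm h3 h4 h1 h2 h5
  have key : ∀ i : ℕ, 2 ^ i * b - 2 ^ i * a < 1 / 2 ∧
      ∀ t, 2 ^ i * a < t → t < 2 ^ i * b → dbl (t : UnitAddCircle) ∉ G := by
    intro i
    induction i with
    | zero =>
      simp only [pow_zero, one_mul]
      exact ⟨by linarith, h.dbl_notMem_of_rel hpq h1 h4⟩
    | succ i ih =>
      have h5 := h.quad.rel_iterate hpq (i + 1)
      have h6 := hcon (i + 1)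
      rw [dbl_iterate_coe, dbl_iterate_coe] at h5
      rw [dbl_iterate_coe] at h6
      have hpos : (2 : ℝ) ^ i * a < 2 ^ i * b := by gcongr
      have hfree : ∀ t, 2 ^ (i + 1) * a < t → t < 2 ^ (i + 1) * b → (t : UnitAddCircle) ∉ G := by
        intro t h7 h8
        have := ih.2 (t / 2) (by rw [pow_succ] at h7; linarith) (by rw [pow_succ] at h8; linarith)
        rwa [dbl_coe, mul_div_cancel₀ _ two_ne_zero] at this
      have e1 : (2 : ℝ) ^ (i + 1) * a = 2 * (2 ^ i * a) := by rw [pow_succ]; ring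
      have e2 : (2 : ℝ) ^ (i + 1) * b = 2 * (2 ^ i * b) := by rw [pow_succ]; ring
      have ih1 := ih.1
      generalize (2 : ℝ) ^ (i + 1) * a = A at *
      generalize (2 : ℝ) ^ (i + 1) * b = B at *
      obtain ⟨k, B', hB', k1, k2, k3, k4⟩ := h.exists_lift h5 h6
      obtain ⟨j, hj⟩ := coe_eq_coe_iff_exists_int.1 hB'
      have hj' : j = 0 ∨ j = -1 := by
        have a1 : (j : ℝ) < 1 := by linarith
        have a2 : (-2 : ℝ) < j := by linarith
        have a3 : j < 1 := by exact_mod_cast a1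
        have a4 : -2 < j := by exact_mod_cast a2
        omega
      rcases hj' with rfl | rfl
      · obtain rfl : B' = B := by simpa using hj
        exact ⟨by linarith, h.dbl_notMem_of_rel h5 k1 k4⟩
      · push_cast at hj
        -- the two intervals cover the circle, except for their endpoints
        have h7 := h.dbl_notMem_of_rel (r.symm' (hB'.symm ▸ h5)) k3 k2
        refine absurd ((toFinite {(A : UnitAddCircle), (B : UnitAddCircle)}).subset fun t ht => ?_)
          h.infinite
        obtain ⟨z, hz1, hz2, rfl⟩ := exists_coe_Ico B' t
        rcases eq_or_lt_of_le hz1 with rfl | hz1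
        · right; exact hB'
        rcases lt_trichotomy z A with h8 | rfl | h8
        · exact absurd (h.map_mem ht) (h7 z hz1 h8)
        · left; rfl
        · exact absurd ht (hfree z h8 (by linarith))
  obtain ⟨i, hi⟩ := pow_unbounded_of_one_lt (1 / (b - a)) (by norm_num : (1 : ℝ) < 2)
  rw [div_lt_iff₀ (by linarith)] at hi
  have := (key i).1
  linarith

theorem le (h : SiegelLamination r G α) {r' : Setoid UnitAddCircle}
    (h' : SiegelLamination r' G α) {p q : UnitAddCircle} (hpq : r p q) : r' p q := by
  have hcls : lamClass r' α = lamClass r α := by rw [h.lamClass_eq, h'.lamClass_eq]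
  have hD : ∀ {p q}, r p q → p ∈ lamClass r α → r' p q := fun {p q} hpq hp => by
    have hq : q ∈ lamClass r α := r.trans' hp hpq
    rw [← hcls] at hp hq
    exact r'.trans' (r'.symm' hp) hq
  suffices key : ∀ (i : ℕ) (p q : UnitAddCircle), r p q → dbl^[i] p ∈ lamClass r α → r' p q by
    by_cases hne : p = q
    · rw [hne]
    · obtain ⟨i, hi⟩ := h.exists_iterate_mem hpq hne
      exact key i p q hpq hi
  intro i
  induction i with
  | zero => intro p q hpq hp; exact hD hpq hp
  | succ i ih =>
    intro p q hpq hi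
    by_cases hp : p ∈ lamClass r α
    · exact hD hpq hp
    have h3 := ih _ _ (h.quad.rel_dbl hpq) hi
    obtain ⟨a, rfl⟩ := exists_coe p
    obtain ⟨k, b, rfl, h4, h5, h6, h7⟩ := h.exists_lift hpq hp
    rw [dbl_coe, dbl_coe] at h3
    refine (h'.quad.rel_or_rel h3).resolve_right fun hr => ?_
    -- the lift of the second preimage would be on the other side of the diameter
    obtain ⟨k', c, hc, k1, k2, k3, k4⟩ := h'.exists_lift hr (by rwa [hcls])
    obtain ⟨j, hj⟩ := coe_eq_coe_iff_exists_int.1 hc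
    have a1 : ((2 * j + 1 - (k' - k) : ℤ) : ℝ) < 1 := by push_cast; linarith
    have a2 : (-1 : ℝ) < ((2 * j + 1 - (k' - k) : ℤ) : ℝ) := by push_cast; linarith
    have a3 := int_eq_zero_of_abs_lt a2 a1
    have a4 : ((k' - k : ℤ) : ℝ) < 1 := by push_cast; linarith
    have a5 : (-1 : ℝ) < ((k' - k : ℤ) : ℝ) := by push_cast; linarith
    have a6 := int_eq_zero_of_abs_lt a5 a4
    omega

theorem eq_of_isPeriodicRotationalSet (h : SiegelLamination r G α) {H : Set UnitAddCircle}
    (hH : IsPeriodicRotationalSet r H) : H = G := by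
  obtain ⟨hlg, n, ⟨⟨hn, himg⟩, -⟩, hrot⟩ := hH
  have himgm : ∀ i, dbl^[n * i] '' H = H := fun i => by
    induction i with
    | zero => simp
    | succ i ih => rw [Nat.mul_succ, Function.iterate_add, image_comp, himg, ih]
  have hmaps : MapsTo dbl^[n] H H := fun t ht => himg ▸ mem_image_of_mem _ ht
  have hDG : ∀ t ∈ lamClass r α, t ∈ G := by
    rw [h.lamClass_eq]; rintro _ (rfl | rfl)
    exacts [h.left_mem, h.right_mem]
  -- endpoints of leaves are not periodic
  have hnp : ∀ p q, r p q → p ≠ q → ∀ m, 0 < m → dbl^[m] p ≠ p := by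
    intro p q hpq hne m hm he
    obtain ⟨i, hi⟩ := h.exists_iterate_mem hpq hne
    refine h.not_periodic _ (hDG _ hi) m hm ?_
    rw [← Function.iterate_add_apply, add_comm, Function.iterate_add_apply, he]
  by_cases hfin : H.Finite
  · exfalso
    have hne : H.Nonempty := by
      rcases hlg with ⟨a, b, hab, rfl⟩ | hgap
      · exact ⟨a, by simp⟩
      · rw [← encard_pos]; exact lt_of_lt_of_le (by norm_num) hgap.three_le
    obtain ⟨t, ht, m, hm, htm⟩ := exists_periodic_of_finite hfin hmaps hne
    have hend : ∃ q, r t q ∧ t ≠ q := by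
      rcases hlg with ⟨a, b, hab, rfl⟩ | hgap
      · rcases ht with rfl | rfl
        · exact ⟨b, hab.rel, hab.1⟩
        · exact ⟨a, r.symm' hab.rel, hab.1.symm⟩
      · obtain ⟨b, hb⟩ := exists_isHole_left hfin ht
        have hl := hgap.edges _ _ hb
        exact ⟨b, hl.rel, hl.1⟩
    obtain ⟨q, hq1, hq2⟩ := hend
    exact hnp t q hq1 hq2 _ (Nat.mul_pos hn hm) htm
  · have hgap : IsGap r H := by
      rcases hlg with ⟨a, b, hab, rfl⟩ | hgap
      · exact absurd (toFinite _) hfin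
      · exact hgap
    obtain ⟨hfin', -⟩ | ⟨-, τ, ⟨F, hF, hτ⟩, hirr⟩ := hrot
    · exact absurd hfin' hfin
    have h0 : (0 : UnitAddCircle) ∉ H := by
      intro h0
      have hfix : dbl^[n * 1] (0 : UnitAddCircle) = 0 :=
        Function.iterate_fixed (by simp [dbl]) _
      obtain ⟨j, hj⟩ := IsLiftOn.translationNumber_of_periodic hF hmaps h0 one_pos hfix
      rw [← hτ, hj] at hirr
      exact hirr ⟨j, by simp⟩
    obtain ⟨t, ht⟩ : H.Nonempty := Set.Infinite.nonempty hfin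
    obtain ⟨a, b, hab, -⟩ := exists_isHole_mem hgap.closed ⟨t, ht⟩ h0
    have hl := hgap.edges _ _ hab
    obtain ⟨i, hi⟩ := h.exists_iterate_mem hl.rel hl.1
    -- a common point of the two gaps which is not the endpoint of a leaf
    obtain ⟨g, hgH, j, hgj⟩ : ∃ g ∈ H, ∃ j, g = dbl^[j + 1] (α : UnitAddCircle) := by
      refine ⟨dbl^[n * (i + 1)] a, by rw [← himgm (i + 1)]; exact ⟨a, hab.1, rfl⟩,
        n * (i + 1) - i - 1, ?_⟩
      have h1 : i + 1 ≤ n * (i + 1) := Nat.le_mul_of_pos_left _ hn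
      have h2 : n * (i + 1) = (n * (i + 1) - i - 1) + 1 + i := by omega
      rw [h2, Function.iterate_add_apply, Nat.add_sub_cancel, Function.iterate_succ_apply,
        Function.iterate_succ_apply, Nat.add_sub_cancel]
      congr 1
      rw [h.lamClass_eq] at hi
      rcases hi with hi | hi
      · rw [hi]
      · rw [mem_singleton_iff.1 hi, dbl_add_half]
    have hgG : g ∈ G := hgj ▸ h.iterate_mem h.left_mem _
    have hgr : ∀ q, r g q → q = g := by
      intro q hq
      by_contra hne
      obtain ⟨k, hk⟩ := h.exists_iterate_mem hq (Ne.symm hne)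
      rw [hgj, ← Function.iterate_add_apply, h.lamClass_eq] at hk
      have : dbl (dbl^[k + (j + 1)] (α : UnitAddCircle)) = dbl α := by
        rcases hk with hk | hk
        · rw [hk]
        · rw [mem_singleton_iff.1 hk, dbl_add_half]
      refine h.not_periodic _ (h.map_mem h.left_mem) (k + (j + 1)) (by omega) ?_
      rw [← Function.iterate_succ_apply, Function.iterate_succ_apply', this]
    have hsub : ∀ A B : Set UnitAddCircle, IsGap r A → IsGap r B → g ∈ A → g ∈ B → A ⊆ B := by
      intro A B hA hB hgA hgB t ht
      by_contra hcon
      obtain ⟨a, b, hab, htab⟩ := exists_isHole_mem hB.closed ⟨g, hgB⟩ hcon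
      have hl := hB.edges _ _ hab
      have hga : g ≠ a := by rintro rfl; exact hl.1 (hgr _ hl.rel).symm
      have hgb : g ≠ b := by rintro rfl; exact hl.1 (hgr _ (r.symm' hl.rel))
      rcases hA.no_crossing _ _ hl with h1 | h1
      · exact Set.disjoint_left.1 h1 htab ht
      · rcases mem_openArc_or_mem_openArc hga hgb with h2 | h2
        · exact Set.disjoint_left.1 hab.2.2 h2 hgB
        · exact Set.disjoint_left.1 h1 h2 hgA
    exact Subset.antisymm (hsub H G hgap h.gap hgH hgG) (hsub G H h.gap hgap hgG hgH)

theorem isCanonicalLamination (h : SiegelLamination r G α) (hrot : IsRotationalOfPeriod G 1) :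
    IsCanonicalLamination r G := by
  refine ⟨⟨h.gap.closed, ?_, h.image, fun a b hab => h.holes hab, hrot⟩, h.quad,
    Or.inr ⟨h.infinite, h.gap⟩, fun r' hr' hc => ?_⟩
  · exact le_trans (by norm_num) h.gap.three_le
  · rcases hc with ⟨hfin, -⟩ | ⟨-, hgap⟩
    · exact absurd hfin h.infinite
    · have h' : SiegelLamination r' G α := { h with quad := hr', gap := hgap }
      exact Setoid.ext fun _ _ => ⟨h'.le h, h.le h'⟩

end SiegelLamination

/-! ### The three types of nonempty quadratic laminations -/

section
variable {r : Setoid UnitAddCircle}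

/-- The whole disk as a strip, bounded by the degenerate chord at the fixed point. -/
theorem returnStrip_one (hr : IsQuadraticLamination r) {α β : ℝ} (hM : IsMajor r α β) (h1 : 0 < α)
    (h2 : α < 1 / 2) (h3 : 1 / 2 < β) (h4 : β < 1) (h5 : β - α ≤ 1 / 2) :
    ReturnStrip r 1 2 0 1 α β := by
  refine ⟨hr, one_pos, by norm_num, ?_, by norm_num, ⟨0, by norm_num⟩, ?_, ?_, hM, h1, by linarith,
    by linarith, h4, h5, by intro k hk hk'; omega⟩
  · have h01 := coe_add_one' 0
    rw [zero_add] at h01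
    rw [h01]
  · intro c d _ _ hd hd'; linarith
  · intro t ht1 ht2 ht
    have := eq_of_coe_eq (hr.rel_zero ht) (b := 0) (by linarith) (by linarith)
    linarith

/-- A major `α β` with `0 < α < 1/2 < β < 1` either is the long edge of a fixed rotational class, or
it separates the long edge of such a class from the fixed point, and then there is a second
rotational set, or it is a diameter and an edge of an invariant Siegel gap. -/
theorem cases_of_isMajor (hr : IsQuadraticLamination r) {α β : ℝ} (hM : IsMajor r α β) (h1 : 0 < α)
    (h2 : α < 1 / 2) (h3 : 1 / 2 < β) (h4 : β < 1) (h5 : β - α ≤ 1 / 2) :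
    (∃ G, CardioidLamination r G α β ∧ IsRotationalOfPeriod G 1 ∧ IsPeriodicRotationalSet r G) ∨
    (∃ G x y, FiniteRotation G x y ∧ α < x ∧ y < β ∧ IsPeriodicRotationalSet r G ∧
      ∃ A, IsPeriodicRotationalSet r A ∧ A ≠ G) ∨
    (β = α + 1 / 2 ∧ ∃ G, SiegelLamination r G α ∧ IsRotationalOfPeriod G 1 ∧
      IsPeriodicRotationalSet r G) := by
  have hs := returnStrip_one hr hM h1 h2 h3 h4 h5
  by_cases hper : ∃ x ∈ staySet 2 0 1 α β, ∃ N : ℕ, 0 < N ∧ (retMap 2 0 1)^[N] x = x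
  · obtain ⟨x₀, hx₀, N, hN, hxN⟩ := hper
    obtain ⟨a, hnt, himg, hp, hrot, hrep⟩ := hs.exists_rotational_class hx₀ hN hxN
    have hset : IsPeriodicRotationalSet r (lamClass r a) :=
      ⟨isLeafOrGap_lamClass hr.lamination hnt, 1, hp, hrot⟩
    have h0 : (0 : UnitAddCircle) ∉ lamClass r a := by
      intro h0
      obtain ⟨z, hz, ⟨hz1, hz2, -⟩, -⟩ := hrep 0 h0
      have := eq_of_coe_eq hz (b := 0) (by linarith) (by linarith)
      linarith
    obtain ⟨x, y, h⟩ := exists_finiteRotation (hr.lamination.finite a) himg hnt h0 (fun p q hpq => by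
      have := hr.isHole_iterate hpq 1 (by rwa [himg])
      rwa [himg] at this)
    have hcls : lamClass r x = lamClass r a := (lamClass_eq h.left_mem).symm
    have hbd : ∀ t : ℝ, 0 < t → t < 1 → (t : UnitAddCircle) ∈ lamClass r a → α ≤ t ∧ t ≤ β := by
      intro t ht1 ht2 ht
      obtain ⟨z, hz, ⟨hz1, hz2, -⟩, hz3, hz4⟩ := hrep t ht
      have := eq_of_coe_eq hz (by linarith) (by linarith)
      exact ⟨this ▸ hz3, this ▸ hz4⟩
    have hth := h.third_le
    have hhalf := h.lt_half
    have hαx := (hbd x h.pos (by linarith [h.lt_one]) h.left_mem).1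
    have hyβ := (hbd y (by linarith [h.pos]) h.lt_one h.right_mem).2
    by_cases hα : (α : UnitAddCircle) ∈ lamClass r a
    · left
      have hβ : (β : UnitAddCircle) ∈ lamClass r a := r.trans' hα hM.1.rel
      obtain rfl : α = x := le_antisymm hαx (h.mem α h1.le (by linarith) hα).1
      obtain rfl : β = y := le_antisymm (h.mem β (by linarith) h4 hβ).2 hyβ
      exact ⟨_, cardioidLamination_of_isMajor hr h hcls hM, hrot, hset⟩
    · right; left
      have hβ : (β : UnitAddCircle) ∉ lamClass r a := fun hβ => hα (r.trans' hβ (r.symm' hM.1.rel))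
      have hαx' : α < x := lt_of_le_of_ne hαx (by rintro rfl; exact hα h.left_mem)
      have hyβ' : y < β := lt_of_le_of_ne hyβ (by rintro rfl; exact hβ h.right_mem)
      exact ⟨_, x, y, h, hαx', hyβ', hset, h.exists_rotationalSet_ne hr hcls hM hαx' hyβ' h5⟩
  · push Not at hper
    right; right
    obtain ⟨G, hgap, hinf, rfl, hαG, hβG, himg, haper, hp, hrot, hrep⟩ := hs.exists_siegel_gap hper
    refine ⟨rfl, G, ⟨hr, hgap, hinf, himg, haper, hαG, hβG, fun t ht => ?_⟩, hrot, Or.inr hgap, 1, hp, hrot⟩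
    obtain ⟨z, hz, -, hz2, hz3⟩ := hrep t ht
    exact ⟨z, hz, hz2, hz3⟩

/-- The empty lamination has no rotational sets: its only gap is the circle, which contains a fixed
point. -/
theorem not_isPeriodicRotationalSet_bot {A : Set UnitAddCircle} :
    ¬ IsPeriodicRotationalSet ⊥ A := by
  rintro ⟨hlg, n, ⟨⟨hn, himg⟩, -⟩, hrot⟩
  have hnl : ∀ a b : UnitAddCircle, ¬ IsLeaf ⊥ a b := fun a b hab => hab.1 hab.rel
  rcases hlg with ⟨a, b, hab, -⟩ | hgap
  · exact hnl a b hab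
  have hne : A.Nonempty := by
    rw [← encard_pos]; exact lt_of_lt_of_le (by norm_num) hgap.three_le
  have h0 : (0 : UnitAddCircle) ∈ A := by
    by_contra h0
    obtain ⟨a, b, hab, -⟩ := exists_isHole_mem hgap.closed hne h0
    exact hnl a b (hgap.edges a b hab)
  have hmaps : MapsTo dbl^[n] A A := fun t ht => himg ▸ mem_image_of_mem _ ht
  have hfix : dbl^[n * 1] (0 : UnitAddCircle) = 0 := Function.iterate_fixed (by simp [dbl]) _
  rcases hrot with ⟨-, τ, ⟨F, hF, hτ⟩, hτ'⟩ | ⟨-, τ, ⟨F, hF, hτ⟩, hirr⟩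
  · obtain ⟨j, hj⟩ := IsLiftOn.translationNumber_of_periodic hF hmaps h0 one_pos hfix
    exact hτ' j (by rw [← hτ, hj]; simp)
  · obtain ⟨j, hj⟩ := IsLiftOn.translationNumber_of_periodic hF hmaps h0 one_pos hfix
    rw [← hτ, hj] at hirr
    exact hirr ⟨j, by simp⟩

/-! ### The central gap of the family of minors -/

theorem arcLen_self (p : UnitAddCircle) : arcLen p p = 1 := by
  obtain ⟨a, rfl⟩ := exists_coe p
  have := arcLen_coe (x := a) (y := a + 1) (by linarith) le_rfl
  rwa [coe_add_one', add_sub_cancel_left] at this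

/-- A point whose orbit stays in a closed half circle bounded by its two halves is not separated
from the centre by a minor. -/
theorem mem_centralGapBasis {z : ℝ} (hz0 : 0 < z) (hz1 : z < 1)
    (hz : ∀ j, ∃ w : ℝ, z / 2 ≤ w ∧ w ≤ z / 2 + 1 / 2 ∧ dbl^[j] (z : UnitAddCircle) = w) :
    (z : UnitAddCircle) ∈ centralGapBasis := by
  rintro p q ⟨r, a, b, hr, hM, rfl, rfl⟩ hsep
  obtain ⟨α, β, h1, h2, h3, h4, h5, hM', hab⟩ := hr.exists_major_lift hM
  have hsep' : SeparatedFromCentre (dbl β) (dbl α) z := by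
    rcases hab with ⟨ha, hb⟩ | ⟨ha, hb⟩
    · rw [ha, hb] at hsep; exact hsep.symm
    · rw [ha, hb] at hsep; exact hsep
  have hd := hr.third_le_of_isMajor hM'
  rw [dist_coe_of_le (by linarith) (by linarith)] at hd
  have hw : 2 * β - 1 < z ∧ z < 2 * α ∧ β ≠ α + 1 / 2 := by
    rcases eq_or_lt_of_le h5 with h6 | h6
    · have : dbl (β : UnitAddCircle) = dbl α := by
        rw [show β = α + 1 / 2 by linarith, dbl_add_half]
      rw [this] at hsep'
      rcases hsep' with ⟨h7, -⟩ | ⟨h7, -⟩ <;> rw [arcLen_self] at h7 <;> norm_num at h7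
    · rcases hsep' with ⟨-, h8⟩ | ⟨h7, -⟩
      · rw [dbl_coe, dbl_coe, ← coe_sub_one' (2 * β), mem_openArc_iff (by linarith) (by linarith)] at h8
        obtain ⟨w, hw1, hw2, hw3⟩ := h8
        have := eq_of_coe_eq hw3 (by linarith) (by linarith)
        subst this
        exact ⟨hw1, hw2, by linarith⟩
      · rw [dbl_coe, dbl_coe, arcLen_coe (by linarith) (by linarith)] at h7
        linarith
  obtain ⟨hw1, hw2, hne⟩ := hw
  have key : ∀ G x y, FiniteRotation G x y → α ≤ x → y ≤ β → False := by
    intro G x y h hx hy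
    obtain ⟨j, hj⟩ := h.exists_iterate_notMem (z := z) (by linarith) (by linarith)
    obtain ⟨w, k1, k2, k3⟩ := hz j
    exact hj w k1 k2 k3
  rcases cases_of_isMajor hr hM' h1 h2 h3 h4 h5 with ⟨G, h, -⟩ | ⟨G, x, y, h, hx, hy, -⟩ | ⟨h, -⟩
  · exact key G α β h.rot le_rfl le_rfl
  · exact key G x y h hx.le hy.le
  · exact hne h

theorem CardioidLamination.mem_centralGapBasis {G : Set UnitAddCircle} {x y : ℝ}
    (h : CardioidLamination r G x y) : dbl x ∈ centralGapBasis ∧ dbl y ∈ centralGapBasis := by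
  have h0 := h.rot.pos
  have h1 := h.rot.lt_one
  have h2 := h.rot.lt_half
  have h3 := h.rot.two_mul_le
  have h4 := h.rot.le_two_mul
  constructor
  · have := h.rot.map_mem h.rot.left_mem
    rw [dbl_coe] at this ⊢
    refine _root_.mem_centralGapBasis (by linarith) (by linarith) fun j => ?_
    obtain ⟨g, hg1, hg2, hg⟩ := h.rot.exists_lift_mem (h.rot.iterate_mem this j)
    exact ⟨g, by linarith, by linarith, hg.symm⟩
  · have := h.rot.map_mem h.rot.right_mem
    rw [dbl_coe, ← coe_sub_one'] at this ⊢
    refine _root_.mem_centralGapBasis (by linarith) (by linarith) fun j => ?_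
    obtain ⟨g, hg1, hg2, hg⟩ := h.rot.exists_lift_mem (h.rot.iterate_mem this j)
    exact ⟨g, by linarith, by linarith, hg.symm⟩

theorem SiegelLamination.mem_centralGapBasis {G : Set UnitAddCircle} {α : ℝ}
    (h : SiegelLamination r G α) (h0 : 0 < α) (h1 : α < 1 / 2) : dbl α ∈ centralGapBasis := by
  have := h.map_mem h.left_mem
  rw [dbl_coe] at this ⊢
  refine _root_.mem_centralGapBasis (by linarith) (by linarith) fun j => ?_
  obtain ⟨g, hg, hg1, hg2⟩ := h.mem _ (h.iterate_mem this j)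
  exact ⟨g, by linarith, by linarith, hg.symm⟩

end

theorem propositionp :
    (∀ r : Setoid UnitAddCircle, IsQuadraticLamination r → r ≠ ⊥ → AtMostOneRotationalSet r →
      ∃ G : Set UnitAddCircle, IsPeriodicRotationalSet r G ∧
        (∀ H : Set UnitAddCircle, IsPeriodicRotationalSet r H → H = G) ∧
        dbl '' G = G ∧ IsCanonicalLamination r G) ∧
    combinatorialMainCardioid =
      {r : Setoid UnitAddCircle | IsQuadraticLamination r ∧ AtMostOneRotationalSet r} := by
  constructor
  · intro r hr hne hone
    obtain ⟨a, b, hM⟩ := hr.lamination.exists_isMajor hne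
    obtain ⟨α, β, h1, h2, h3, h4, h5, hM', -⟩ := hr.exists_major_lift hM
    rcases cases_of_isMajor hr hM' h1 h2 h3 h4 h5 with ⟨G, h, hrot, hset⟩ |
      ⟨G, x, y, -, -, -, hset, A, hA, hAG⟩ | ⟨-, G, h, hrot, hset⟩
    · exact ⟨G, hset, fun H hH => h.eq_of_isPeriodicRotationalSet hH, h.rot.image,
        h.isCanonicalLamination hrot⟩
    · exact absurd (hone A G hA hset) hAG
    · exact ⟨G, hset, fun H hH => h.eq_of_isPeriodicRotationalSet hH, h.image,
        h.isCanonicalLamination hrot⟩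
  · refine Subset.antisymm ?_ ?_
    · rintro r ⟨hr, rfl | ⟨a, b, hM, ha, hb⟩⟩
      · exact ⟨hr, fun A B hA => absurd hA not_isPeriodicRotationalSet_bot⟩
      refine ⟨hr, fun A B hA hB => ?_⟩
      obtain ⟨α, β, h1, h2, h3, h4, h5, hM', hab⟩ := hr.exists_major_lift hM
      rcases cases_of_isMajor hr hM' h1 h2 h3 h4 h5 with ⟨G, h, -⟩ | ⟨G, x, y, h, hx, hy, -⟩ |
        ⟨-, G, h, -⟩
      · rw [h.eq_of_isPeriodicRotationalSet hA, h.eq_of_isPeriodicRotationalSet hB]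
      · -- the minor of the lamination generated by `G` separates `2 * β` from the centre
        have hβ : dbl β ∈ centralGapBasis := by
          rcases hab with ⟨-, h6⟩ | ⟨h6, -⟩
          · rwa [← h6]
          · rwa [← h6]
        rw [dbl_coe, ← coe_sub_one'] at hβ
        exact absurd (h.separatedFromCentre (by linarith) (by linarith)) (hβ _ _ h.isMinor)
      · rw [h.eq_of_isPeriodicRotationalSet hA, h.eq_of_isPeriodicRotationalSet hB]
    · rintro r ⟨hr, hone⟩
      refine ⟨hr, ?_⟩
      by_cases hne : r = ⊥
      · exact Or.inl hne
      right
      obtain ⟨a, b, hM⟩ := hr.lamination.exists_isMajor hne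
      obtain ⟨α, β, h1, h2, h3, h4, h5, hM', -⟩ := hr.exists_major_lift hM
      refine ⟨α, β, hM', ?_⟩
      rcases cases_of_isMajor hr hM' h1 h2 h3 h4 h5 with ⟨G, h, -⟩ |
        ⟨G, x, y, -, -, -, hset, A, hA, hAG⟩ | ⟨rfl, G, h, -⟩
      · exact h.mem_centralGapBasis
      · exact absurd (hone A G hA hset) hAG
      · rw [dbl_add_half]
        exact ⟨h.mem_centralGapBasis h1 h2, h.mem_centralGapBasis h1 h2⟩
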